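/- **Theorem 3.1.** *Setting.* Let $d_1,d_2\in\mathbb N_0$ with $d=d_1+d_2>0$. Let $J_1,\dots,J_{d_2}\subseteq\mathbb R$ be intervals, $D=\mathbb N_0^{d_1}\times J_1\times\cdots\times J_{d_2}$, and let $f\colon D\to\mathbb R$ be measurable and isotonic (non-decreasing in each argument). On a probability space $(\Omega,\mathcal A,P)$ we observe, for each $n\in\mathbb N$ and $1\le t\le n$, $Y_{n,t}=f(I_{n,t})+\varepsilon_{n,t}$, where the covariates $I_{n,t}=(X_{n,t},Z_{n,t})$ satisfy $I_{n,t}\in D$ a.s., with $X_{n,t}$ having values in $\mathbb N_0^{d_1}$ and $Z_{n,t}$ in $\mathbb R^{d_2}$. *(A2)* (i) The errors have finite second moments and there is $\bar\sigma^2<\infty$ such that for all $1\le t\le n$, almost surely, $E(\varepsilon_{n,t}\mid I_{n,1},\dots,I_{n,t},\varepsilon_{n,1},\dots,\varepsilon_{n,t-1})=0$ and $E(\varepsilon_{n,t}^2\mid I_{n,1},\dots,I_{n,t},\varepsilon_{n,1},\dots,\varepsilon_{n,t-1})\le\bar\sigma^2$. (ii) The strong mixing coefficients $\alpha(r)=\sup\{|P(A\cap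 B)-P(A)P(B)|\colon 1\le t,\ t+r\le n,\ A\in\sigma(I_{n,1},\dots,I_{n,t}),\ B\in\sigma(I_{n,t+r},\dots,I_{n,n})\}$ satisfy $\sum_{r\ge1}r^{d_2-1}\alpha(r)<\infty$. (iii) $f$ is bounded on $D$. *(A3)* Each component of $Z_{n,t}$ either has continuous marginal distribution functions (for all $1\le t\le n$), or is the trend $t/n$ a.s. (for all $1\le t\le n$). (i) There are given continuous distribution functions $G_1,\dots,G_{d_2}$ on $\mathbb R$, with corresponding probability measures $Q_1,\dots,Q_{d_2}$, such that for each $K\in\mathbb N_0$ there are constants $0<C_1\le C_2<\infty$ with, for all $n\ge1$, all $k\in\{0,\dots,K\}^{d_1}$ and all $a_j\le b_j$, writing $(a,b]=\prod_j(a_j,b_j]$, $$C_1\prod_{j=1}^{d_2}(G_j(b_j)-G_j(a_j))-\tfrac1n\le\tfrac1n\sum_{t=1}^nP(X_{n,t}=k,\,Z_{n,t}\in(a,b])\le\tfrac1n\sum_{t=1}^nP(Z_{n,t}\in(a,b])\le C_2\prod_{j=1}^{d_2}(G_j(b_j)-G_j(a_j))+\tfrac1n .$$ (ii) There is $C_3<\infty$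 such that for all $1\le t\le n$ and all hyperrectangles $C$ (products of $d$ intervals), $P(I_{n,t}\in C\mid I_{n,s},\varepsilon_{n,s},\,1\le s\le t-d)\le C_3\,P(I_{n,t}\in C)$ almost surely. *Estimator.* For $B\subseteq D$ let $\mathrm{Av}_Y(B)$ be the average of the $Y_{n,t}$, $t\le n$, with $I_{n,t}\in B$ (set to $0$ if there are none). With the componentwise order $\preceq$ and $[a,b]=\{z\colon a\preceq z\preceq b\}$, put, for $x\in D$, $$\underline f_n(x)=\max_{a\in D,\,a\preceq x}\ \min_{b\in D,\,b\succeq x}\mathrm{Av}_Y([a,b]),\qquad \overline f_n(x)=\min_{b\in D,\,b\succeq x}\ \max_{a\in D,\,a\preceq x}\mathrm{Av}_Y([a,b]),$$ and let $\widehat f_n$ be any isotonic function on $D$ (measurable jointly in $(\omega,x)$) with $\underline f_n\le\widehat f_n\le\overline f_n$ on $D$. *Notation.* Let $\widetilde M_n=\lfloor n^{1/(d_2+2)}\rfloor$, $\widetilde h_n=1/\widetilde M_n$, $G_j^{-1}(u)=\inf\{x\in\mathbb R\colon G_j(x)\ge u\}\in[-\infty,\infty]$. Fix $K\in\mathbb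 N_0$ and $C_4>0$. For $k\in\{0,\dots,K\}^{d_1}$ and $l\in\{1,\dots,\widetilde M_n\}^{d_2}$ let $\widetilde B_{k,l}=\{k\}\times\prod_{j}\bigl(G_j^{-1}((l_j-1)\widetilde h_n),G_j^{-1}(l_j\widetilde h_n)\bigr]$, and let $$\widetilde A_n=\bigl\{\#\{t\le n\colon I_{n,t}\in\widetilde B_{k,l}\}\ge C_4\,n^{2/(d_2+2)}\ \text{ for all such }k,l\bigr\},\qquad \widetilde D_n=\{0,\dots,K\}^{d_1}\times\prod_{j=1}^{d_2}\bigl(G_j^{-1}(\widetilde h_n),G_j^{-1}(1-\widetilde h_n)\bigr].$$ Let $\nu=\mu^{d_1}\otimes Q_1\otimes\cdots\otimes Q_{d_2}$, where $\mu^{d_1}$ is the counting measure on $\mathbb N_0^{d_1}$. *Conclusion.* Under (A2) and (A3), for every $K\in\mathbb N_0$ and every $C_4>0$, $$E\Bigl[\int_{\widetilde D_n}|\widehat f_n(x)-f(x)|\,\nu(dx)\;\mathbf 1_{\widetilde A_n}\Bigr]=O\bigl(n^{-1/(d_2+2)}\bigr)\qquad(n\to\infty).$$ In particular the rate does not depend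 on the number $d_1$ of discrete regressors. -/

import Mathlib

open MeasureTheory ProbabilityTheory Filter

namespace IsoReg

/-- Values of the covariate vector `I = (X, Z)`: `d₁` components in `ℕ₀`, `d₂` real components.
It carries the componentwise order `≤`, so that `Set.Icc a b` is the closed hyperrectangle
`[a₁, b₁] × ⋯ × [a_d, b_d]`. -/
abbrev Covariate (d₁ d₂ : ℕ) : Type := (Fin d₁ → ℕ) × (Fin d₂ → ℝ)

/-- The domain `D = ℕ₀^{d₁} × J₁ × ⋯ × J_{d₂}` of the regression function. -/
def domain (d₁ : ℕ) {d₂ : ℕ} (J : Fin d₂ → Set ℝ) : Set (Covariate d₁ d₂) :=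
  {x | ∀ j, x.2 j ∈ J j}

/-! ### The estimator -/

section Estimator

variable {d₁ d₂ : ℕ}

open Classical in
/-- The number of `t ∈ {1, …, n}` with `I_t ∈ B`. -/
noncomputable def obsCount (n : ℕ) (I : ℕ → Covariate d₁ d₂) (B : Set (Covariate d₁ d₂)) : ℕ :=
  ((Finset.Icc 1 n).filter (fun t => I t ∈ B)).card

open Classical in
/-- `Av_Y(B)`, the average of those `Y_t`, `1 ≤ t ≤ n`, for which `I_t ∈ B`
(with value `0` if there is no such `t`). -/
noncomputable def avg (n : ℕ) (I : ℕ → Covariate d₁ d₂) (Y : ℕ → ℝ)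
    (B : Set (Covariate d₁ d₂)) : ℝ :=
  (∑ t ∈ (Finset.Icc 1 n).filter (fun t => I t ∈ B), Y t) / (obsCount n I B : ℝ)

/-- The max-min estimator over hyperrectangles with corners in `D`.  Only finitely many values
of the average occur, so supremum and infimum are attained when `x ∈ D`. -/
noncomputable def lowerEst (D : Set (Covariate d₁ d₂)) (n : ℕ) (I : ℕ → Covariate d₁ d₂)
    (Y : ℕ → ℝ) (x : Covariate d₁ d₂) : ℝ :=
  ⨆ a : {a : Covariate d₁ d₂ // a ∈ D ∧ a ≤ x}, ⨅ b : {b : Covariate d₁ d₂ // b ∈ D ∧ x ≤ b},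
    avg n I Y (Set.Icc a.1 b.1)

/-- The min-max estimator over hyperrectangles with corners in `D`. -/
noncomputable def upperEst (D : Set (Covariate d₁ d₂)) (n : ℕ) (I : ℕ → Covariate d₁ d₂)
    (Y : ℕ → ℝ) (x : Covariate d₁ d₂) : ℝ :=
  ⨅ b : {b : Covariate d₁ d₂ // b ∈ D ∧ x ≤ b}, ⨆ a : {a : Covariate d₁ d₂ // a ∈ D ∧ a ≤ x},
    avg n I Y (Set.Icc a.1 b.1)

/-- `g` is a hyperrectangle isotonic estimate on `D` from the sample `(I_t, Y_t)`, `1 ≤ t ≤ n`: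
any isotonic function between the max-min and the min-max estimator. -/
def IsIsotonicEstimate (D : Set (Covariate d₁ d₂)) (n : ℕ) (I : ℕ → Covariate d₁ d₂)
    (Y : ℕ → ℝ) (g : Covariate d₁ d₂ → ℝ) : Prop :=
  MonotoneOn g D ∧ ∀ x ∈ D, lowerEst D n I Y x ≤ g x ∧ g x ≤ upperEst D n I Y x

end Estimator

/-! ### Grid, cells, event and region -/

/-- `M̃_n = [n^{1/(d₂+2)}]`. -/
noncomputable def gridM (d₂ n : ℕ) : ℕ := ⌊(n : ℝ) ^ (1 / ((d₂ : ℝ) + 2))⌋₊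

/-- `h̃_n = 1 / M̃_n`. -/
noncomputable def gridH (d₂ n : ℕ) : ℝ := 1 / (gridM d₂ n : ℝ)

/-- The quantile function `G⁻¹(u) = inf {x : G(x) ≥ u}` of the distribution function `G` of `μ`,
with values in `[-∞, ∞]`. -/
noncomputable def quantile (μ : Measure ℝ) (u : ℝ) : EReal :=
  sInf ((fun x : ℝ => (x : EReal)) '' {x : ℝ | u ≤ cdf μ x})

section Grid

variable {d₁ d₂ : ℕ}

/-- The cell `{k} × ∏ⱼ (Gⱼ⁻¹((lⱼ-1) h̃_n), Gⱼ⁻¹(lⱼ h̃_n)]`. -/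
def cell (Q : Fin d₂ → Measure ℝ) (n : ℕ) (k : Fin d₁ → ℕ) (l : Fin d₂ → ℕ) :
    Set (Covariate d₁ d₂) :=
  {x | x.1 = k ∧ ∀ j, quantile (Q j) (((l j : ℝ) - 1) * gridH d₂ n) < (x.2 j : EReal) ∧
    (x.2 j : EReal) ≤ quantile (Q j) ((l j : ℝ) * gridH d₂ n)}

/-- The event `Ã_n` that each cell with `k ∈ {0, …, K}^{d₁}`, `l ∈ {1, …, M̃_n}^{d₂}` contains at
least `C₄ n^{2/(d₂+2)}` of the observed covariates. -/
def goodEvent {Ω : Type*} (Q : Fin d₂ → Measure ℝ) (K : ℕ) (C₄ : ℝ) (n : ℕ)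
    (I : ℕ → Ω → Covariate d₁ d₂) : Set Ω :=
  {ω | ∀ (k : Fin d₁ → ℕ) (l : Fin d₂ → ℕ), (∀ i, k i ≤ K) →
    (∀ j, 1 ≤ l j ∧ l j ≤ gridM d₂ n) →
    C₄ * (n : ℝ) ^ (2 / ((d₂ : ℝ) + 2)) ≤ (obsCount n (fun t => I t ω) (cell Q n k l) : ℝ)}

/-- The interior region `D̃_n = {0, …, K}^{d₁} × ∏ⱼ (Gⱼ⁻¹(h̃_n), Gⱼ⁻¹(1 - h̃_n)]`. -/
def region (d₁ : ℕ) (Q : Fin d₂ → Measure ℝ) (K n : ℕ) : Set (Covariate d₁ d₂) :=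
  {x | (∀ i, x.1 i ≤ K) ∧ ∀ j, quantile (Q j) (gridH d₂ n) < (x.2 j : EReal) ∧
    (x.2 j : EReal) ≤ quantile (Q j) (1 - gridH d₂ n)}

/-- `ν = μ^{d₁} ⊗ Q₁ ⊗ ⋯ ⊗ Q_{d₂}` with the counting measure `μ^{d₁}` on `ℕ₀^{d₁}`. -/
noncomputable def nu (d₁ : ℕ) (Q : Fin d₂ → Measure ℝ) : Measure (Covariate d₁ d₂) :=
  (Measure.count : Measure (Fin d₁ → ℕ)).prod (Measure.pi Q)

/-- A hyperrectangle: a product of `d₁ + d₂` intervals of any kind (bounded or not). -/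
def IsHyperrectangle (C : Set (Covariate d₁ d₂)) : Prop :=
  ∃ (S : Fin d₁ → Set ℕ) (T : Fin d₂ → Set ℝ), (∀ i, (S i).OrdConnected) ∧
    (∀ j, (T j).OrdConnected) ∧ C = {x | (∀ i, x.1 i ∈ S i) ∧ ∀ j, x.2 j ∈ T j}

end Grid

/-! ### The assumptions -/

section Assumptions

variable {Ω : Type*} [MeasurableSpace Ω] {d₁ d₂ : ℕ}

/-- The σ-algebra generated by the variables `V_t`, `t ∈ S`. -/
abbrev sigmaOf {Ω β : Type*} [MeasurableSpace β] (V : ℕ → Ω → β) (S : Set ℕ) : MeasurableSpace Ω :=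
  ⨆ t ∈ S, MeasurableSpace.comap (V t) inferInstance

/-- The strong mixing coefficient `α(r)` of the triangular array `I_{n,t}`, `1 ≤ t ≤ n`: the
supremum, over all rows `n` and all times `t`, of `|P(A ∩ B) - P(A) P(B)|` over `A` in the
σ-algebra of the row up to time `t` and `B` in that of the row from time `t + r` on.
(The set is nonempty and bounded by `1`.) -/
noncomputable def alphaMix (P : Measure Ω) (I : ℕ → ℕ → Ω → Covariate d₁ d₂) (r : ℕ) : ℝ :=
  sSup {c : ℝ | ∃ (n t : ℕ) (A B : Set Ω), 1 ≤ t ∧ t + r ≤ n ∧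
    MeasurableSet[sigmaOf (I n) (Set.Icc 1 t)] A ∧
    MeasurableSet[sigmaOf (I n) (Set.Icc (t + r) n)] B ∧
    c = |P.real (A ∩ B) - P.real A * P.real B|}

/-- Assumption (A2).  The argument `D` is the domain of `f`. -/
structure AssumptionA2 (P : Measure Ω) (D : Set (Covariate d₁ d₂)) (f : Covariate d₁ d₂ → ℝ)
    (I : ℕ → ℕ → Ω → Covariate d₁ d₂) (ε : ℕ → ℕ → Ω → ℝ) : Prop where
  /-- finite second moments, without which the next two fields would be meaningless -/
  memLp : ∀ n t, 1 ≤ t → t ≤ n → MemLp (ε n t) 2 P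
  condExp_eq_zero : ∀ n t, 1 ≤ t → t ≤ n →
    P[ε n t | sigmaOf (I n) (Set.Icc 1 t) ⊔ sigmaOf (ε n) (Set.Ico 1 t)] =ᵐ[P] 0
  condExp_sq_le : ∃ σsq : ℝ, ∀ n t, 1 ≤ t → t ≤ n →
    ∀ᵐ ω ∂P, (P[fun ω' => (ε n t ω') ^ 2 |
      sigmaOf (I n) (Set.Icc 1 t) ⊔ sigmaOf (ε n) (Set.Ico 1 t)]) ω ≤ σsq
  mixing : Summable fun r : ℕ => ((r + 1 : ℕ) : ℝ) ^ ((d₂ : ℤ) - 1) * alphaMix P I (r + 1)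
  bounded : ∃ b : ℝ, ∀ x ∈ D, |f x| ≤ b

/-- Assumption (A3).  The measure `Q j` has distribution function `G_j = cdf (Q j)`. -/
structure AssumptionA3 (P : Measure Ω) (Q : Fin d₂ → Measure ℝ)
    (I : ℕ → ℕ → Ω → Covariate d₁ d₂) (ε : ℕ → ℕ → Ω → ℝ) : Prop where
  /-- each component of `Z` either has continuous marginal distribution functions or is the
  trend `t / n` -/
  components : ∀ j : Fin d₂,
    (∀ n t, 1 ≤ t → t ≤ n → Continuous (cdf (P.map (fun ω => (I n t ω).2 j)))) ∨
    (∀ n t, 1 ≤ t → t ≤ n → ∀ᵐ ω ∂P, (I n t ω).2 j = (t : ℝ) / (n : ℝ))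
  continuous_cdf : ∀ j, Continuous (cdf (Q j))
  average_bounds : ∀ K : ℕ, ∃ C₁ C₂ : ℝ, 0 < C₁ ∧ C₁ ≤ C₂ ∧
    ∀ n : ℕ, 1 ≤ n → ∀ k : Fin d₁ → ℕ, (∀ i, k i ≤ K) →
    ∀ a b : Fin d₂ → ℝ, (∀ j, a j ≤ b j) →
      C₁ * ∏ j, (cdf (Q j) (b j) - cdf (Q j) (a j)) - 1 / (n : ℝ) ≤
        1 / (n : ℝ) * ∑ t ∈ Finset.Icc 1 n,
          P.real {ω | (I n t ω).1 = k ∧ ∀ j, (I n t ω).2 j ∈ Set.Ioc (a j) (b j)} ∧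
      1 / (n : ℝ) * ∑ t ∈ Finset.Icc 1 n,
          P.real {ω | (I n t ω).1 = k ∧ ∀ j, (I n t ω).2 j ∈ Set.Ioc (a j) (b j)} ≤
        1 / (n : ℝ) * ∑ t ∈ Finset.Icc 1 n,
          P.real {ω | ∀ j, (I n t ω).2 j ∈ Set.Ioc (a j) (b j)} ∧
      1 / (n : ℝ) * ∑ t ∈ Finset.Icc 1 n,
          P.real {ω | ∀ j, (I n t ω).2 j ∈ Set.Ioc (a j) (b j)} ≤
        C₂ * ∏ j, (cdf (Q j) (b j) - cdf (Q j) (a j)) + 1 / (n : ℝ)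
  /-- conditional probabilities given the past up to time `t - d`, `d = d₁ + d₂` -/
  condProb_le : ∃ C₃ : ℝ, ∀ n t, 1 ≤ t → t ≤ n → ∀ C : Set (Covariate d₁ d₂),
    IsHyperrectangle C →
    ∀ᵐ ω ∂P, (P[(I n t ⁻¹' C).indicator (fun _ => (1 : ℝ)) |
        sigmaOf (I n) {s | 1 ≤ s ∧ s + (d₁ + d₂) ≤ t} ⊔
          sigmaOf (ε n) {s | 1 ≤ s ∧ s + (d₁ + d₂) ≤ t}]) ω ≤
      C₃ * P.real (I n t ⁻¹' C)

end Assumptions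

end IsoReg

set_option linter.unusedSectionVars false

/-! Let `r = n ^ (1/(d₂+2))`, so that the grid has about `r ^ d₂` cells per discrete value. For `x`
in the cell `l`, fix the upper corner `b` in the min-max estimator just below the grid line `l + 1`.
The estimator is then at most `f b` plus the largest average of errors over rectangles `[a, b]` with
`a ≤ x`; the max-min estimator is treated symmetrically with a corner just above the line `l - 2`.
Thus the estimation error on a cell is an increment of `f` over three cells in each direction plus
an averaged noise (`abs_estimate_sub_le`).

Bias: `f` is bounded and monotone, so the increments telescope along the diagonals of the grid and
only boundary terms remain, a fraction `O(1/r)` of all cells (`sum_diagonal_increment_le`). No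
smoothness of `f` is needed.

Noise: rectangles are sorted by the dyadic number `2 ^ p j` of cells they span in each continuous
direction. On the good event such a rectangle contains at least `C₄ r² ∏ 2 ^ p j` observations
(`mul_prod_le_obsCount`), while the supremum of the error sums over all rectangles in the
surrounding block is `O(r ∏ √2 ^ p j)` in `L¹` (`exists_block_bound`). The quotients `r⁻¹ ∏ √2⁻ᵖ`
are summable over `p`, so no logarithm appears. Only continuous coordinates are localized; discrete
ones are unrestricted in the blocks, which is why `d₁` does not affect the rate.

The core is `ErrorModel.exists_orthant_bound`: over orthants inside a box with expected count below
`V`, error sums are `O(√V)` in `L¹` uniformly, although errors have only second moments. Each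
coordinate is cut dyadically according to the expected counting measure. An orthant is a union of
products of cells, one product for every tuple of levels. For fixed levels the possible products are
disjoint and have expected count at most `V / 2 ^ max`, so fourth moments control their maximum
(`ErrorModel.integral_iSup_le`) with geometric decay. Fourth moments become available by truncating
the errors at a threshold that decreases with the level; what is cut off is charged to thin slabs
(`abs_chaining_le`), and the conditional means created by truncation are controlled by the second
moments. Dependence enters through the martingale property and through the bound on hit
probabilities given the lagged past. -/

namespace IsoReg

/-! ### Moments of error sums and counts under a lagged bound on hit probabilities. -/

section Moments

variable {Ω E : Type*} [mΩ : MeasurableSpace Ω] [MeasurableSpace E]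

/-- The σ-algebra generated by the covariates up to time `t` and the errors before time `t`. -/
abbrev pastSigma (I : ℕ → Ω → E) (ε : ℕ → Ω → ℝ) (t : ℕ) : MeasurableSpace Ω :=
  sigmaOf I (Set.Icc 1 t) ⊔ sigmaOf ε (Set.Ico 1 t)

/-- The σ-algebra generated by covariates and errors up to time `t - d`. -/
abbrev laggedSigma (d : ℕ) (I : ℕ → Ω → E) (ε : ℕ → Ω → ℝ) (t : ℕ) : MeasurableSpace Ω :=
  sigmaOf I {s | 1 ≤ s ∧ s + d ≤ t} ⊔ sigmaOf ε {s | 1 ≤ s ∧ s + d ≤ t}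

lemma sigmaOf_mono {β : Type*} [MeasurableSpace β] (V : ℕ → Ω → β) {S T : Set ℕ} (h : S ⊆ T) :
    sigmaOf V S ≤ sigmaOf V T :=
  biSup_mono h

lemma sigmaOf_le {β : Type*} [MeasurableSpace β] {V : ℕ → Ω → β} (hV : ∀ t, Measurable (V t))
    (S : Set ℕ) : sigmaOf V S ≤ mΩ :=
  iSup₂_le fun t _ => (hV t).comap_le

lemma measurable_sigmaOf {β : Type*} [MeasurableSpace β] (V : ℕ → Ω → β) {S : Set ℕ} {t : ℕ}
    (ht : t ∈ S) : Measurable[sigmaOf V S] (V t) :=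
  Measurable.mono (comap_measurable (V t))
    (le_iSup₂_of_le (f := fun t (_ : t ∈ S) => MeasurableSpace.comap (V t) inferInstance)
      t ht le_rfl) le_rfl

variable {I : ℕ → Ω → E} {ε : ℕ → Ω → ℝ}

lemma pastSigma_mono {s t : ℕ} (h : s ≤ t) : pastSigma I ε s ≤ pastSigma I ε t :=
  sup_le_sup (sigmaOf_mono I fun _ hx => ⟨hx.1, hx.2.trans h⟩)
    (sigmaOf_mono ε fun _ hx => ⟨hx.1, lt_of_lt_of_le hx.2 h⟩)

lemma pastSigma_le (hI : ∀ t, Measurable (I t)) (hε : ∀ t, Measurable (ε t)) (t : ℕ) :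
    pastSigma I ε t ≤ mΩ :=
  sup_le (sigmaOf_le hI _) (sigmaOf_le hε _)

lemma laggedSigma_le (hI : ∀ t, Measurable (I t)) (hε : ∀ t, Measurable (ε t)) (d t : ℕ) :
    laggedSigma d I ε t ≤ mΩ :=
  sup_le (sigmaOf_le hI _) (sigmaOf_le hε _)

lemma pastSigma_le_laggedSigma {d s t : ℕ} (h : s + d ≤ t) :
    pastSigma I ε s ≤ laggedSigma d I ε t :=
  sup_le_sup (sigmaOf_mono I fun x hx => ⟨hx.1, by have := hx.2; omega⟩)
    (sigmaOf_mono ε fun x hx => ⟨hx.1, by have := hx.2; omega⟩)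

lemma measurable_past_covariate {s t : ℕ} (hs : 1 ≤ s) (h : s ≤ t) :
    Measurable[pastSigma I ε t] (I s) :=
  (measurable_sigmaOf I (S := Set.Icc 1 t) ⟨hs, h⟩).mono le_sup_left le_rfl

lemma measurable_past_error {s t : ℕ} (hs : 1 ≤ s) (h : s < t) :
    Measurable[pastSigma I ε t] (ε s) :=
  (measurable_sigmaOf ε (S := Set.Ico 1 t) ⟨hs, h⟩).mono le_sup_right le_rfl

lemma measurable_lagged_covariate {d s t : ℕ} (hs : 1 ≤ s) (h : s + d ≤ t) :
    Measurable[laggedSigma d I ε t] (I s) :=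
  (measurable_sigmaOf I (S := {s | 1 ≤ s ∧ s + d ≤ t}) ⟨hs, h⟩).mono le_sup_left le_rfl

lemma measurable_lagged_error {d s t : ℕ} (hs : 1 ≤ s) (h : s + d ≤ t) :
    Measurable[laggedSigma d I ε t] (ε s) :=
  (measurable_sigmaOf ε (S := {s | 1 ≤ s ∧ s + d ≤ t}) ⟨hs, h⟩).mono le_sup_right le_rfl

/-- The indicator of `I_t ∈ B`. -/
noncomputable def hit (I : ℕ → Ω → E) (B : Set E) (t : ℕ) (ω : Ω) : ℝ :=
  (I t ⁻¹' B).indicator (fun _ => (1 : ℝ)) ω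

lemma hit_nonneg (B : Set E) (t : ℕ) (ω : Ω) : 0 ≤ hit I B t ω :=
  Set.indicator_nonneg (fun _ _ => zero_le_one) _

lemma hit_le_one (B : Set E) (t : ℕ) (ω : Ω) : hit I B t ω ≤ 1 :=
  Set.indicator_le' (fun _ _ => le_rfl) (fun _ _ => zero_le_one) _

lemma abs_hit_le_one (B : Set E) (t : ℕ) (ω : Ω) : |hit I B t ω| ≤ 1 := by
  rw [abs_of_nonneg (hit_nonneg B t ω)]; exact hit_le_one B t ω

lemma hit_cases (B : Set E) (t : ℕ) (ω : Ω) : hit I B t ω = 0 ∨ hit I B t ω = 1 := by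
  unfold hit; by_cases h : ω ∈ I t ⁻¹' B <;> simp [h]

lemma measurable_hit {m : MeasurableSpace Ω} {B : Set E} (hB : MeasurableSet B) {t : ℕ}
    (h : Measurable[m] (I t)) : Measurable[m] (hit I B t) :=
  (@measurable_const _ _ _ m _).indicator (h hB)

lemma integral_hit (P : Measure Ω) {B : Set E} (hB : MeasurableSet B) {t : ℕ}
    (h : Measurable (I t)) : ∫ ω, hit I B t ω ∂P = P.real (I t ⁻¹' B) :=
  integral_indicator_one (h hB)

/-- The expected number of times `1 ≤ s ≤ t` with `I_s ∈ B`. -/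
noncomputable def expCount (P : Measure Ω) (I : ℕ → Ω → E) (B : Set E) (t : ℕ) : ℝ :=
  ∑ s ∈ Finset.Icc 1 t, P.real (I s ⁻¹' B)

lemma expCount_nonneg (P : Measure Ω) (B : Set E) (t : ℕ) : 0 ≤ expCount P I B t :=
  Finset.sum_nonneg fun _ _ => measureReal_nonneg

lemma expCount_mono_time (P : Measure Ω) (B : Set E) {s t : ℕ} (h : s ≤ t) :
    expCount P I B s ≤ expCount P I B t :=
  Finset.sum_le_sum_of_subset_of_nonneg (Finset.Icc_subset_Icc le_rfl h)
    fun _ _ _ => measureReal_nonneg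

lemma expCount_succ (P : Measure Ω) (B : Set E) (t : ℕ) :
    expCount P I B (t + 1) = expCount P I B t + P.real (I (t + 1) ⁻¹' B) :=
  Finset.sum_Icc_succ_top (by omega) _

lemma expCount_mono (P : Measure Ω) [IsFiniteMeasure P] {A B : Set E} (h : A ⊆ B) (t : ℕ) :
    expCount P I A t ≤ expCount P I B t :=
  Finset.sum_le_sum fun _ _ => measureReal_mono (Set.preimage_mono h)

/-- The sum of the `η_s`, `1 ≤ s ≤ t`, over those times with `I_s ∈ B`. -/
noncomputable def hitSum (I : ℕ → Ω → E) (B : Set E) (η : ℕ → Ω → ℝ) (t : ℕ) (ω : Ω) : ℝ :=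
  ∑ s ∈ Finset.Icc 1 t, hit I B s ω * η s ω

lemma hitSum_zero (B : Set E) (η : ℕ → Ω → ℝ) (ω : Ω) : hitSum I B η 0 ω = 0 := by
  simp [hitSum]

lemma hitSum_succ (B : Set E) (η : ℕ → Ω → ℝ) (t : ℕ) (ω : Ω) :
    hitSum I B η (t + 1) ω = hitSum I B η t ω + hit I B (t + 1) ω * η (t + 1) ω :=
  Finset.sum_Icc_succ_top (by omega) _

lemma measurable_hitSum {m : MeasurableSpace Ω} {B : Set E} (hB : MeasurableSet B)
    {η : ℕ → Ω → ℝ} {t : ℕ} (hI : ∀ s, 1 ≤ s → s ≤ t → Measurable[m] (I s))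
    (hη : ∀ s, 1 ≤ s → s ≤ t → Measurable[m] (η s)) : Measurable[m] (hitSum I B η t) := by
  unfold hitSum
  refine Finset.measurable_fun_sum _ fun s hs => ?_
  rw [Finset.mem_Icc] at hs
  exact (measurable_hit hB (hI s hs.1 hs.2)).mul (hη s hs.1 hs.2)

lemma abs_hitSum_sub_le {B : Set E} {η : ℕ → Ω → ℝ} {c : ℝ} (hη : ∀ t ω, |η t ω| ≤ c)
    {s : ℕ} (k : ℕ) (ω : Ω) :
    |hitSum I B η (s + k) ω - hitSum I B η s ω| ≤ k * c := by
  induction k with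
  | zero => simp
  | succ k ih =>
    rw [← add_assoc, hitSum_succ]
    have h1 : |hit I B (s + k + 1) ω * η (s + k + 1) ω| ≤ c := by
      rw [abs_mul]
      calc _ ≤ 1 * |η (s + k + 1) ω| :=
            mul_le_mul_of_nonneg_right (abs_hit_le_one _ _ _) (abs_nonneg _)
        _ ≤ c := by rw [one_mul]; exact hη _ _
    calc _ = |(hitSum I B η (s + k) ω - hitSum I B η s ω) +
          hit I B (s + k + 1) ω * η (s + k + 1) ω| := by ring_nf
      _ ≤ _ := abs_add_le _ _
      _ ≤ k * c + c := add_le_add ih h1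
      _ = _ := by push_cast; ring

lemma abs_hitSum_le {B : Set E} {η : ℕ → Ω → ℝ} {c : ℝ} (hη : ∀ t ω, |η t ω| ≤ c)
    (t : ℕ) (ω : Ω) : |hitSum I B η t ω| ≤ t * c := by
  simpa [hitSum_zero] using abs_hitSum_sub_le (I := I) (B := B) hη (s := 0) t ω

/-- A set `B` of covariate values whose conditional probabilities given the lagged past are at
most `C` times the unconditional ones. -/
structure LagBound (P : Measure Ω) (n d : ℕ) (I : ℕ → Ω → E) (ε : ℕ → Ω → ℝ) (C : ℝ)
    (B : Set E) : Prop where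
  meas : MeasurableSet B
  nonneg : 0 ≤ C
  le : ∀ t, 1 ≤ t → t ≤ n → ∀ Z : Ω → ℝ, Measurable[laggedSigma d I ε t] Z → (∀ ω, 0 ≤ Z ω) →
    (∃ b, ∀ ω, |Z ω| ≤ b) →
    ∫ ω, Z ω * hit I B t ω ∂P ≤ C * P.real (I t ⁻¹' B) * ∫ ω, Z ω ∂P

/-- A bounded martingale difference array with conditional variances at most `v`. -/
structure IsBoundedMDS (P : Measure Ω) (n d : ℕ) (I : ℕ → Ω → E) (ε : ℕ → Ω → ℝ) (v c : ℝ)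
    (η : ℕ → Ω → ℝ) : Prop where
  meas_past : ∀ s t, 1 ≤ s → s < t → Measurable[pastSigma I ε t] (η s)
  meas_lagged : ∀ s t, 1 ≤ s → s + d ≤ t → Measurable[laggedSigma d I ε t] (η s)
  bound : ∀ t ω, |η t ω| ≤ c
  orth : ∀ t, 1 ≤ t → t ≤ n → ∀ Z : Ω → ℝ, Measurable[pastSigma I ε t] Z →
    (∃ b, ∀ ω, |Z ω| ≤ b) → ∫ ω, Z ω * η t ω ∂P = 0
  var : ∀ t, 1 ≤ t → t ≤ n → ∀ Z : Ω → ℝ, Measurable[pastSigma I ε t] Z → (∀ ω, 0 ≤ Z ω) →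
    (∃ b, ∀ ω, |Z ω| ≤ b) → ∫ ω, Z ω * η t ω ^ 2 ∂P ≤ v * ∫ ω, Z ω ∂P

lemma integrable_of_abs_le {P : Measure Ω} [IsFiniteMeasure P] {f : Ω → ℝ} (hf : Measurable f)
    {b : ℝ} (h : ∀ ω, |f ω| ≤ b) : Integrable f P :=
  Integrable.of_bound hf.aestronglyMeasurable b (Eventually.of_forall h)

lemma integral_add_add {P : Measure Ω} {f g h : Ω → ℝ} (hf : Integrable f P)
    (hg : Integrable g P) (hh : Integrable h P) :
    ∫ ω, (f ω + g ω + h ω) ∂P = ∫ ω, f ω ∂P + ∫ ω, g ω ∂P + ∫ ω, h ω ∂P := by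
  rw [← integral_add hf hg]
  exact integral_add (hf.add hg) hh

section BoundedMDS

variable {P : Measure Ω} [IsProbabilityMeasure P] {n d : ℕ} {v c C : ℝ} {η : ℕ → Ω → ℝ}
  {B : Set E}

lemma IsBoundedMDS.measurable (h : IsBoundedMDS P n d I ε v c η) (hI : ∀ t, Measurable (I t))
    (hε : ∀ t, Measurable (ε t)) {t : ℕ} (ht : 1 ≤ t) : Measurable (η t) :=
  (h.meas_past t (t + 1) ht (by omega)).mono (pastSigma_le hI hε _) le_rfl

lemma IsBoundedMDS.measurable_hitSum (h : IsBoundedMDS P n d I ε v c η)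
    (hI : ∀ t, Measurable (I t)) (hε : ∀ t, Measurable (ε t)) (hB : MeasurableSet B) (t : ℕ) :
    Measurable (hitSum I B η t) :=
  IsoReg.measurable_hitSum hB (fun s _ _ => hI s) fun _ hs _ => h.measurable hI hε hs

/-- The sum so far and the next hit are measurable with respect to the past, so the cross term of
the square has mean zero and each time adds at most `v` times the probability of a hit. -/
lemma IsBoundedMDS.integral_sq_le (h : IsBoundedMDS P n d I ε v c η)
    (hI : ∀ t, Measurable (I t)) (hε : ∀ t, Measurable (ε t)) (hB : MeasurableSet B)
    {t : ℕ} (ht : t ≤ n) :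
    ∫ ω, hitSum I B η t ω ^ 2 ∂P ≤ v * expCount P I B t := by
  induction t with
  | zero => simp [hitSum_zero, expCount]
  | succ t ih =>
    set S := hitSum I B η t with hS
    set b := hit I B (t + 1) with hb
    have hc : 0 ≤ c := (abs_nonneg _).trans (h.bound 0 (Classical.choice P.nonempty_of_neZero))
    have mS : Measurable[pastSigma I ε (t + 1)] S := IsoReg.measurable_hitSum hB
      (fun s h1 h2 => measurable_past_covariate h1 (by omega))
      (fun s h1 h2 => h.meas_past s _ h1 (by omega))
    have mb : Measurable[pastSigma I ε (t + 1)] b :=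
      measurable_hit hB (measurable_past_covariate (by omega) le_rfl)
    have mη := h.measurable hI hε (t := t + 1) (by omega)
    have hle := pastSigma_le hI hε (t + 1)
    have bS : ∀ ω, |S ω| ≤ t * c := abs_hitSum_le h.bound t
    have bb : ∀ ω, |b ω| ≤ 1 := abs_hit_le_one B _
    have bη := h.bound (t + 1)
    have mS' := mS.mono hle le_rfl
    have mb' := mb.mono hle le_rfl
    have e1 : ∫ ω, 2 * (S ω * b ω) * η (t + 1) ω ∂P = 0 := by
      refine h.orth _ (by omega) ht _ ((mS.mul mb).const_mul 2) ⟨2 * (t * c * 1), fun ω => ?_⟩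
      rw [abs_mul, abs_mul, abs_two]
      have := bS ω; have := bb ω
      gcongr
    have e2 : ∫ ω, b ω * η (t + 1) ω ^ 2 ∂P ≤ v * ∫ ω, b ω ∂P :=
      h.var _ (by omega) ht _ mb (hit_nonneg B _) ⟨1, bb⟩
    rw [integral_hit P hB (hI _)] at e2
    have i1 : Integrable (fun ω => S ω ^ 2) P := by
      refine integrable_of_abs_le (mS'.pow_const 2) (b := (t * c) ^ 2) fun ω => ?_
      rw [abs_pow]; gcongr; exact bS ω
    have i2 : Integrable (fun ω => 2 * (S ω * b ω) * η (t + 1) ω) P := by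
      refine integrable_of_abs_le (((mS'.mul mb').const_mul 2).mul mη)
        (b := 2 * (t * c * 1) * c) fun ω => ?_
      rw [abs_mul, abs_mul, abs_mul, abs_two]
      have := bS ω; have := bb ω; have := bη ω
      gcongr
    have i3 : Integrable (fun ω => b ω * η (t + 1) ω ^ 2) P := by
      refine integrable_of_abs_le (mb'.mul (mη.pow_const 2)) (b := 1 * c ^ 2) fun ω => ?_
      rw [abs_mul, abs_pow]
      have := bb ω; have := bη ω
      gcongr
    have e3 : ∀ ω, hitSum I B η (t + 1) ω ^ 2 =
        S ω ^ 2 + 2 * (S ω * b ω) * η (t + 1) ω + b ω * η (t + 1) ω ^ 2 := fun ω => by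
      rw [hitSum_succ]
      rcases hit_cases (I := I) B (t + 1) ω with h0 | h0 <;> simp only [hb, h0, hS] <;> ring
    simp_rw [e3]
    rw [integral_add_add i1 i2 i3, e1, expCount_succ]
    have := ih (by omega)
    linarith

/-- Fourth moment bound for a martingale difference array restricted to the hits of `B`. -/
lemma IsBoundedMDS.integral_pow_four_le (h : IsBoundedMDS P n d I ε v c η)
    (hI : ∀ t, Measurable (I t)) (hε : ∀ t, Measurable (ε t)) (hd : 1 ≤ d) (hv : 0 ≤ v)
    (hB : LagBound P n d I ε C B) {t : ℕ} (ht : t ≤ n) :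
    ∫ ω, hitSum I B η t ω ^ 4 ∂P ≤
      (v * (16 * C * v * expCount P I B n + 16 * d ^ 2 * c ^ 2 + 3 * c ^ 2)) *
        expCount P I B t := by
  induction t with
  | zero => simp [hitSum_zero, expCount]
  | succ t ih =>
    set S := hitSum I B η t with hS
    set b := hit I B (t + 1) with hb
    -- A hit at time `t + 1` is controlled only given the past up to `t + 1 - d`. The sum so far is
    -- therefore compared with `U`, from which it differs by at most `d * c`; for `t + 1 < d` the
    -- truncated subtraction gives `U = 0`.
    set U := hitSum I B η (t + 1 - d) with hU
    have hc : 0 ≤ c := (abs_nonneg _).trans (h.bound 0 (Classical.choice P.nonempty_of_neZero))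
    have mS : Measurable[pastSigma I ε (t + 1)] S := IsoReg.measurable_hitSum hB.meas
      (fun s h1 h2 => measurable_past_covariate h1 (by omega))
      (fun s h1 h2 => h.meas_past s _ h1 (by omega))
    have mU : Measurable[laggedSigma d I ε (t + 1)] U := IsoReg.measurable_hitSum hB.meas
      (fun s h1 h2 => measurable_lagged_covariate h1 (by omega))
      (fun s h1 h2 => h.meas_lagged s _ h1 (by omega))
    have mb : Measurable[pastSigma I ε (t + 1)] b :=
      measurable_hit hB.meas (measurable_past_covariate (by omega) le_rfl)
    have mη := h.measurable hI hε (t := t + 1) (by omega)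
    have hle := pastSigma_le hI hε (t + 1)
    have bS : ∀ ω, |S ω| ≤ t * c := abs_hitSum_le h.bound t
    have bU : ∀ ω, |U ω| ≤ (t + 1 - d : ℕ) * c := abs_hitSum_le h.bound _
    have bb : ∀ ω, |b ω| ≤ 1 := abs_hit_le_one B _
    have bη := h.bound (t + 1)
    have mS' := mS.mono hle le_rfl
    have mb' := mb.mono hle le_rfl
    have mU' := mU.mono (laggedSigma_le hI hε d _) le_rfl
    have bSU : ∀ ω, |S ω - U ω| ≤ d * c := fun ω => by
      have := abs_hitSum_sub_le (I := I) (B := B) h.bound (s := t + 1 - d) (t - (t + 1 - d)) ω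
      rw [show t + 1 - d + (t - (t + 1 - d)) = t by omega] at this
      refine this.trans (mul_le_mul_of_nonneg_right ?_ hc)
      exact_mod_cast (by omega : t - (t + 1 - d) ≤ d)
    -- the four pieces of the increment
    have e1 : ∫ ω, 4 * (S ω ^ 3 * b ω) * η (t + 1) ω ∂P = 0 := by
      refine h.orth _ (by omega) ht _ (((mS.pow_const 3).mul mb).const_mul 4)
        ⟨4 * ((t * c) ^ 3 * 1), fun ω => ?_⟩
      rw [abs_mul, abs_mul, abs_pow]
      have := bS ω; have := bb ω
      have h4 : |(4 : ℝ)| = 4 := by norm_num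
      rw [h4]; gcongr
    have e2 : ∫ ω, (8 * (S ω ^ 2 * b ω) + 3 * c ^ 2 * b ω) * η (t + 1) ω ^ 2 ∂P ≤
        v * ∫ ω, (8 * (S ω ^ 2 * b ω) + 3 * c ^ 2 * b ω) ∂P := by
      refine h.var _ (by omega) ht _
        ((((mS.pow_const 2).mul mb).const_mul 8).add (mb.const_mul _)) (fun ω => ?_)
        ⟨8 * ((t * c) ^ 2 * 1) + 3 * c ^ 2 * 1, fun ω => ?_⟩
      · have := hit_nonneg (I := I) B (t + 1) ω
        positivity
      · have := bS ω; have := bb ω; have := hit_nonneg (I := I) B (t + 1) ω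
        rw [abs_of_nonneg (by positivity), ← sq_abs (S ω)]
        have : b ω ≤ 1 := hit_le_one B _ ω
        gcongr
    have e3 : ∫ ω, (8 * (S ω ^ 2 * b ω) + 3 * c ^ 2 * b ω) ∂P ≤
        (16 * C * v * expCount P I B n + 16 * d ^ 2 * c ^ 2 + 3 * c ^ 2) *
          P.real (I (t + 1) ⁻¹' B) := by
      have j1 : ∫ ω, U ω ^ 2 * b ω ∂P ≤ C * P.real (I (t + 1) ⁻¹' B) * ∫ ω, U ω ^ 2 ∂P :=
        hB.le (t + 1) (by omega) ht _ (mU.pow_const 2) (fun ω => sq_nonneg _)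
          ⟨((t + 1 - d : ℕ) * c) ^ 2, fun ω => by rw [abs_pow]; gcongr; exact bU ω⟩
      have j2 : ∫ ω, U ω ^ 2 ∂P ≤ v * expCount P I B n :=
        (h.integral_sq_le hI hε hB.meas (by omega)).trans
          (mul_le_mul_of_nonneg_left (expCount_mono_time P B (by omega)) hv)
      have k1 : Integrable (fun ω => U ω ^ 2 * b ω) P := by
        refine integrable_of_abs_le ((mU'.pow_const 2).mul mb')
          (b := ((t + 1 - d : ℕ) * c) ^ 2 * 1) fun ω => ?_
        rw [abs_mul, abs_pow]
        have := bU ω; have := bb ω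
        gcongr
      have k2 : Integrable b P := integrable_of_abs_le mb' bb
      have k3 : ∫ ω, (8 * (S ω ^ 2 * b ω) + 3 * c ^ 2 * b ω) ∂P ≤
          ∫ ω, (16 * (U ω ^ 2 * b ω) + (16 * d ^ 2 * c ^ 2 + 3 * c ^ 2) * b ω) ∂P := by
        refine integral_mono_of_nonneg (Eventually.of_forall fun ω => ?_)
          ((k1.const_mul 16).add (k2.const_mul _)) (Eventually.of_forall fun ω => ?_)
        · have := hit_nonneg (I := I) B (t + 1) ω
          show 0 ≤ 8 * (S ω ^ 2 * b ω) + 3 * c ^ 2 * b ω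
          positivity
        · have h0 := hit_nonneg (I := I) B (t + 1) ω
          have h1 : (S ω - U ω) ^ 2 ≤ (d * c) ^ 2 := sq_le_sq' (by
            have := neg_le_of_abs_le (bSU ω); linarith) (le_of_abs_le (bSU ω))
          have h2 : S ω ^ 2 ≤ 2 * U ω ^ 2 + 2 * (d * c) ^ 2 := by
            nlinarith [sq_nonneg (S ω - 2 * U ω)]
          show 8 * (S ω ^ 2 * b ω) + 3 * c ^ 2 * b ω ≤
            16 * (U ω ^ 2 * b ω) + (16 * d ^ 2 * c ^ 2 + 3 * c ^ 2) * b ω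
          have := mul_le_mul_of_nonneg_right h2 h0
          nlinarith
      refine k3.trans ?_
      rw [integral_add (k1.const_mul 16) (k2.const_mul _), integral_const_mul, integral_const_mul,
        integral_hit P hB.meas (hI _)]
      have := mul_le_mul_of_nonneg_left j2
        (mul_nonneg hB.nonneg (measureReal_nonneg (μ := P) (s := I (t + 1) ⁻¹' B)))
      nlinarith
    have i1 : Integrable (fun ω => S ω ^ 4) P := by
      refine integrable_of_abs_le (mS'.pow_const 4) (b := (t * c) ^ 4) fun ω => ?_
      rw [abs_pow]; gcongr; exact bS ω
    have i2 : Integrable (fun ω => 4 * (S ω ^ 3 * b ω) * η (t + 1) ω) P := by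
      refine integrable_of_abs_le ((((mS'.pow_const 3).mul mb').const_mul 4).mul mη)
        (b := 4 * ((t * c) ^ 3 * 1) * c) fun ω => ?_
      rw [abs_mul, abs_mul, abs_mul, abs_pow]
      have := bS ω; have := bb ω; have := bη ω
      have h4 : |(4 : ℝ)| = 4 := by norm_num
      rw [h4]; gcongr
    have i3 : Integrable (fun ω => (8 * (S ω ^ 2 * b ω) + 3 * c ^ 2 * b ω) *
        η (t + 1) ω ^ 2) P := by
      refine integrable_of_abs_le (((((mS'.pow_const 2).mul mb').const_mul 8).add
        (mb'.const_mul _)).mul (mη.pow_const 2))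
        (b := (8 * ((t * c) ^ 2 * 1) + 3 * c ^ 2 * 1) * c ^ 2) fun ω => ?_
      have := bS ω; have := bη ω; have := hit_nonneg (I := I) B (t + 1) ω
      rw [abs_of_nonneg (by positivity), ← sq_abs (S ω), ← sq_abs (η (t + 1) ω)]
      have : b ω ≤ 1 := hit_le_one B _ ω
      gcongr
    have e4 : ∫ ω, hitSum I B η (t + 1) ω ^ 4 ∂P ≤
        ∫ ω, (S ω ^ 4 + 4 * (S ω ^ 3 * b ω) * η (t + 1) ω +
          (8 * (S ω ^ 2 * b ω) + 3 * c ^ 2 * b ω) * η (t + 1) ω ^ 2) ∂P := by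
      refine integral_mono_of_nonneg (Eventually.of_forall fun ω => by positivity)
        ((i1.add i2).add i3) (Eventually.of_forall fun ω => ?_)
      show hitSum I B η (t + 1) ω ^ 4 ≤ S ω ^ 4 + 4 * (S ω ^ 3 * b ω) * η (t + 1) ω +
          (8 * (S ω ^ 2 * b ω) + 3 * c ^ 2 * b ω) * η (t + 1) ω ^ 2
      rw [hitSum_succ]
      rcases hit_cases (I := I) B (t + 1) ω with h0 | h0
      · simp only [hb, h0, hS]; ring_nf; exact le_rfl
      · simp only [hb, h0, ← hS]
        have h1 : η (t + 1) ω ^ 2 ≤ c ^ 2 := sq_le_sq' (by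
            have := neg_le_of_abs_le (bη ω); linarith) (le_of_abs_le (bη ω))
        have h2 := mul_le_mul_of_nonneg_right h1 (sq_nonneg (η (t + 1) ω))
        -- The hint is `4 S η³ ≤ 2 S² η² + 2 η⁴`. Of the resulting `3 η⁴` one factor `η²` is bounded
        -- by `c²`, so that a past-measurable factor times `η²` remains.
        nlinarith [sq_nonneg (η (t + 1) ω * (S ω - η (t + 1) ω))]
    refine e4.trans ?_
    rw [integral_add_add i1 i2 i3, e1, expCount_succ]
    have h1 := ih (by omega)
    have h2 := mul_le_mul_of_nonneg_left e3 hv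
    nlinarith

/-- Second moment bound for the number of hits of `B`. -/
lemma integral_hitCount_sq_le (hI : ∀ t, Measurable (I t)) (hd : 1 ≤ d) (hB : LagBound P n d I ε C B) {t : ℕ} (ht : t ≤ n) :
    Integrable (fun ω => hitSum I B (fun _ _ => 1) t ω ^ 2) P ∧
    ∫ ω, hitSum I B (fun _ _ => 1) t ω ^ 2 ∂P ≤
      (1 + 2 * d + 2 * C * expCount P I B n) * expCount P I B t := by
  have hb1 : ∀ (t : ℕ) (ω : Ω), |(fun (_ : ℕ) (_ : Ω) => (1 : ℝ)) t ω| ≤ 1 := by simp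
  have int2 : ∀ t, Integrable (fun ω => hitSum I B (fun _ _ => 1) t ω ^ 2) P := fun t => by
    refine integrable_of_abs_le ((measurable_hitSum hB.meas (fun s _ _ => hI s)
      fun _ _ _ => measurable_const).pow_const 2) (b := (t * 1) ^ 2) fun ω => ?_
    rw [abs_pow]; gcongr; exact abs_hitSum_le hb1 t ω
  have int1 : ∀ t, Integrable (fun ω => hitSum I B (fun _ _ => 1) t ω) P := fun t =>
    integrable_of_abs_le (measurable_hitSum hB.meas (fun s _ _ => hI s)
      fun _ _ _ => measurable_const) (abs_hitSum_le hb1 t)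
  have inth : ∀ t, Integrable (hit I B t) P := fun t =>
    integrable_of_abs_le (measurable_hit hB.meas (hI t)) (abs_hit_le_one B t)
  have nn : ∀ t ω, 0 ≤ hitSum I B (fun _ _ => 1) t ω := fun t ω =>
    Finset.sum_nonneg fun _ _ => mul_nonneg (hit_nonneg _ _ _) zero_le_one
  have first : ∀ t, ∫ ω, hitSum I B (fun _ _ => 1) t ω ∂P = expCount P I B t := fun t => by
    unfold hitSum expCount
    simp only [mul_one]
    rw [integral_finsetSum _ fun s _ => inth s]
    exact Finset.sum_congr rfl fun s _ => integral_hit P hB.meas (hI s)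
  refine ⟨int2 t, ?_⟩
  induction t with
  | zero => simp [hitSum_zero, expCount]
  | succ t ih =>
    set S := hitSum I B (fun _ _ => (1 : ℝ)) t with hS
    set b := hit I B (t + 1) with hb
    set U := hitSum I B (fun _ _ => (1 : ℝ)) (t + 1 - d) with hU
    have mU : Measurable[laggedSigma d I ε (t + 1)] U := IsoReg.measurable_hitSum hB.meas
      (fun s h1 h2 => measurable_lagged_covariate h1 (by omega))
      (fun s h1 h2 => measurable_const)
    have bSU : ∀ ω, S ω ≤ U ω + d := fun ω => by
      have := abs_hitSum_sub_le (I := I) (B := B) hb1 (s := t + 1 - d) (t - (t + 1 - d)) ω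
      rw [show t + 1 - d + (t - (t + 1 - d)) = t by omega] at this
      have h2 : ((t - (t + 1 - d) : ℕ) : ℝ) ≤ d := by
        exact_mod_cast (by omega : t - (t + 1 - d) ≤ d)
      have := le_of_abs_le this
      linarith
    have j1 : ∫ ω, U ω * b ω ∂P ≤ C * P.real (I (t + 1) ⁻¹' B) * ∫ ω, U ω ∂P :=
      hB.le (t + 1) (by omega) ht _ mU (fun ω => nn _ ω) ⟨_, abs_hitSum_le hb1 _⟩
    have j2 : ∫ ω, U ω ∂P ≤ expCount P I B n := by
      rw [first]; exact expCount_mono_time P B (by omega)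
    have k1 : Integrable (fun ω => U ω * b ω) P := by
      have := (int1 (t + 1 - d)).bdd_mul (c := 1)
        (measurable_hit hB.meas (hI (t + 1))).aestronglyMeasurable
        (Eventually.of_forall (abs_hit_le_one B (t + 1)))
      simpa only [mul_comm] using this
    have e4 : ∫ ω, hitSum I B (fun _ _ => 1) (t + 1) ω ^ 2 ∂P ≤
        ∫ ω, (S ω ^ 2 + 2 * (U ω * b ω) + (1 + 2 * d) * b ω) ∂P := by
      refine integral_mono (int2 _) (((int2 t).add (k1.const_mul 2)).add ((inth _).const_mul _))
        fun ω => ?_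
      show hitSum I B (fun _ _ => 1) (t + 1) ω ^ 2 ≤
        S ω ^ 2 + 2 * (U ω * b ω) + (1 + 2 * d) * b ω
      rw [hitSum_succ]
      have := bSU ω
      rcases hit_cases (I := I) B (t + 1) ω with h0 | h0
      · simp only [hb, h0, hS]; ring_nf; exact le_rfl
      · simp only [hb, h0, ← hS]; nlinarith
    refine e4.trans ?_
    rw [integral_add_add (int2 t) (k1.const_mul 2) ((inth (t + 1)).const_mul _), integral_const_mul,
      integral_const_mul, expCount_succ, integral_hit P hB.meas (hI _)]
    have h1 := ih (by omega)
    have := mul_le_mul_of_nonneg_left j2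
        (mul_nonneg hB.nonneg (measureReal_nonneg (μ := P) (s := I (t + 1) ⁻¹' B)))
    nlinarith

end BoundedMDS

end Moments


lemma integral_mul_condExp {Ω : Type*} {m mΩ : MeasurableSpace Ω} {P : Measure Ω}
    [IsProbabilityMeasure P] (hm : m ≤ mΩ) {Z f : Ω → ℝ}
    (hZ : Measurable[m] Z) (hb : ∃ b, ∀ ω, |Z ω| ≤ b) (hf : Integrable f P) :
    ∫ ω, Z ω * (P[f | m]) ω ∂P = ∫ ω, Z ω * f ω ∂P := by
  obtain ⟨b, hb⟩ := hb
  have hint : Integrable (Z * f) P :=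
    hf.bdd_mul (hZ.mono hm le_rfl).aestronglyMeasurable (Eventually.of_forall hb)
  rw [← integral_condExp hm (f := fun ω => Z ω * f ω)]
  exact (integral_congr_ae
    (condExp_mul_of_stronglyMeasurable_left hZ.stronglyMeasurable hint hf)).symm

/-- Test-function form of a conditional bound, as used in `LagBound` and `IsBoundedMDS`. -/
lemma integral_mul_le_of_condExp_le {Ω : Type*} {m mΩ : MeasurableSpace Ω} {P : Measure Ω}
    [IsProbabilityMeasure P] (hm : m ≤ mΩ) {Z f : Ω → ℝ}
    (hZ : Measurable[m] Z) (hb : ∃ b, ∀ ω, |Z ω| ≤ b) (h0 : ∀ ω, 0 ≤ Z ω) (hf : Integrable f P)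
    {a : ℝ} (ha : ∀ᵐ ω ∂P, (P[f | m]) ω ≤ a) :
    ∫ ω, Z ω * f ω ∂P ≤ a * ∫ ω, Z ω ∂P := by
  rw [← integral_mul_condExp hm hZ hb hf, ← integral_const_mul]
  obtain ⟨b, hb⟩ := hb
  refine integral_mono_ae ?_ ?_ ?_
  · exact integrable_condExp.bdd_mul (hZ.mono hm le_rfl).aestronglyMeasurable
      (Eventually.of_forall hb)
  · exact (integrable_of_abs_le (hZ.mono hm le_rfl) hb).const_mul a
  · filter_upwards [ha] with ω hω
    show Z ω * (P[f | m]) ω ≤ a * Z ω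
    rw [mul_comm a]
    exact mul_le_mul_of_nonneg_left hω (h0 ω)

/-! ### Bounded functions of the errors, centring, and maxima over finitely many sets. -/

section Maximal

variable {Ω E : Type*} [mΩ : MeasurableSpace Ω] [MeasurableSpace E]
  {P : Measure Ω} [IsProbabilityMeasure P]

/-- Errors with conditional mean zero and conditional variances at most `v`. -/
structure ErrorModel (P : Measure Ω) (n : ℕ) (I : ℕ → Ω → E) (ε : ℕ → Ω → ℝ) (v : ℝ) :
    Prop where
  meas_cov : ∀ t, Measurable (I t)
  meas_err : ∀ t, Measurable (ε t)
  nonneg : 0 ≤ v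
  memLp : ∀ t, 1 ≤ t → t ≤ n → MemLp (ε t) 2 P
  mean : ∀ t, 1 ≤ t → t ≤ n → P[ε t | pastSigma I ε t] =ᵐ[P] 0
  var : ∀ t, 1 ≤ t → t ≤ n → ∀ᵐ ω ∂P, (P[fun ω => ε t ω ^ 2 | pastSigma I ε t]) ω ≤ v

variable {I : ℕ → Ω → E} {ε : ℕ → Ω → ℝ} {n d : ℕ} {v c C : ℝ}

/-- The conditional mean of `φ (ε_t)` given the past, clipped to `[-c, c]`. -/
noncomputable def condMean (P : Measure Ω) (I : ℕ → Ω → E) (ε : ℕ → Ω → ℝ) (φ : ℝ → ℝ) (c : ℝ)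
    (t : ℕ) (ω : Ω) : ℝ :=
  max (-c) (min c ((P[fun ω => φ (ε t ω) | pastSigma I ε t]) ω))

lemma measurable_condMean (φ : ℝ → ℝ) (c : ℝ) (t : ℕ) :
    Measurable[pastSigma I ε t] (condMean P I ε φ c t) :=
  (@measurable_const _ _ _ (pastSigma I ε t) _).max
    ((@measurable_const _ _ _ (pastSigma I ε t) _).min stronglyMeasurable_condExp.measurable)

lemma abs_condMean_le (hc : 0 ≤ c) (φ : ℝ → ℝ) (t : ℕ) (ω : Ω) :
    |condMean P I ε φ c t ω| ≤ c :=
  abs_le.2 ⟨le_max_left _ _, max_le (by linarith) (min_le_left _ _)⟩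

namespace ErrorModel

variable (h : ErrorModel P n I ε v)
include h

omit [IsProbabilityMeasure P] in
lemma past_le (t : ℕ) : pastSigma I ε t ≤ mΩ := pastSigma_le h.meas_cov h.meas_err t

variable {φ : ℝ → ℝ}

omit [IsProbabilityMeasure P] in
lemma measurable_comp (hφ : Measurable φ) (t : ℕ) : Measurable fun ω => φ (ε t ω) :=
  hφ.comp (h.meas_err t)

/-- The clipping is invisible almost surely; it serves to make the bound hold at every `ω`, as
`IsBoundedMDS` demands. -/
lemma condMean_ae_eq (hφ : Measurable φ) (hφc : ∀ x, |φ x| ≤ c) (t : ℕ) :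
    condMean P I ε φ c t =ᵐ[P] P[fun ω => φ (ε t ω) | pastSigma I ε t] := by
  have hint : Integrable (fun ω => φ (ε t ω)) P :=
    integrable_of_abs_le (h.measurable_comp hφ t) fun ω => hφc _
  have h1 : P[fun ω => φ (ε t ω) | pastSigma I ε t] ≤ᵐ[P] fun _ => c := by
    have := condExp_mono (m := pastSigma I ε t) hint (integrable_const c)
      (Eventually.of_forall fun ω => le_of_abs_le (hφc (ε t ω)))
    rwa [condExp_const (h.past_le t)] at this
  have h2 : (fun _ => -c) ≤ᵐ[P] P[fun ω => φ (ε t ω) | pastSigma I ε t] := by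
    have := condExp_mono (m := pastSigma I ε t) (integrable_const (-c)) hint
      (Eventually.of_forall fun ω => neg_le_of_abs_le (hφc (ε t ω)))
    rwa [condExp_const (h.past_le t)] at this
  filter_upwards [h1, h2] with ω a b
  unfold condMean
  rw [min_eq_right a, max_eq_right b]

lemma integral_mul_condMean (hφ : Measurable φ) (hφc : ∀ x, |φ x| ≤ c) (t : ℕ) {Z : Ω → ℝ}
    (hZ : Measurable[pastSigma I ε t] Z) (hb : ∃ b, ∀ ω, |Z ω| ≤ b) :
    ∫ ω, Z ω * condMean P I ε φ c t ω ∂P = ∫ ω, Z ω * φ (ε t ω) ∂P := by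
  rw [← integral_mul_condExp (h.past_le t) hZ hb
    (integrable_of_abs_le (h.measurable_comp hφ t) fun ω => hφc _)]
  refine integral_congr_ae ?_
  filter_upwards [h.condMean_ae_eq hφ hφc t] with ω hω
  simp only [hω]

/-- Centring does not increase second moments: with the conditional mean `M`, `E[Z (φ - M)²] = E[Z
φ²] - E[Z M²]`, and `φ(ε)² ≤ ε²`. So the variance bound `v` survives whatever the truncation. -/
lemma isBoundedMDS (hφ : Measurable φ) (hφc : ∀ x, |φ x| ≤ c)
    (hφx : ∀ x, |φ x| ≤ |x|) :
    IsBoundedMDS P n d I ε v (2 * c) fun t ω => φ (ε t ω) - condMean P I ε φ c t ω := by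
  have hc : 0 ≤ c := (abs_nonneg _).trans (hφc 0)
  have mM := fun t => (measurable_condMean (P := P) (I := I) (ε := ε) φ c t)
  refine ⟨fun s t hs hst => ?_, fun s t hs hst => ?_, fun t ω => ?_, fun t h1 h2 Z hZ hb => ?_,
    fun t h1 h2 Z hZ h0 hb => ?_⟩
  · exact (hφ.comp (measurable_past_error hs hst)).sub
      ((mM s).mono (pastSigma_mono hst.le) le_rfl)
  · exact (hφ.comp (measurable_lagged_error hs hst)).sub
      ((mM s).mono (pastSigma_le_laggedSigma hst) le_rfl)
  · calc _ ≤ |φ (ε t ω)| + |condMean P I ε φ c t ω| := abs_sub _ _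
      _ ≤ c + c := add_le_add (hφc _) (abs_condMean_le hc φ t ω)
      _ = 2 * c := by ring
  · obtain ⟨b, hb'⟩ := hb
    have mZ := hZ.mono (h.past_le t) le_rfl
    have i1 : Integrable (fun ω => Z ω * φ (ε t ω)) P :=
      (integrable_of_abs_le (h.measurable_comp hφ t) fun ω => hφc _).bdd_mul
        mZ.aestronglyMeasurable (Eventually.of_forall hb')
    have i2 : Integrable (fun ω => Z ω * condMean P I ε φ c t ω) P :=
      (integrable_of_abs_le ((mM t).mono (h.past_le t) le_rfl)
        fun ω => abs_condMean_le hc φ t ω).bdd_mul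
        mZ.aestronglyMeasurable (Eventually.of_forall hb')
    simp_rw [mul_sub]
    rw [integral_sub i1 i2, h.integral_mul_condMean hφ hφc t hZ ⟨b, hb'⟩, sub_self]
  · obtain ⟨b, hb'⟩ := hb
    have hb0 : 0 ≤ b := (abs_nonneg _).trans (hb' (Classical.choice P.nonempty_of_neZero))
    have mZ := hZ.mono (h.past_le t) le_rfl
    have mM' := (mM t).mono (h.past_le t) le_rfl
    have mφ := h.measurable_comp hφ t
    have bM := fun ω => abs_condMean_le (P := P) (I := I) (ε := ε) hc φ t ω
    set M := condMean P I ε φ c t with hM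
    have e1 : ∫ ω, (Z ω * M ω) * M ω ∂P = ∫ ω, (Z ω * M ω) * φ (ε t ω) ∂P :=
      h.integral_mul_condMean hφ hφc t (hZ.mul (mM t)) ⟨b * c, fun ω => by
        rw [abs_mul]; have := hb' ω; have := bM ω; gcongr⟩
    have i1 : Integrable (fun ω => Z ω * φ (ε t ω) ^ 2) P := by
      refine integrable_of_abs_le (mZ.mul (mφ.pow_const 2)) (b := b * c ^ 2) fun ω => ?_
      rw [abs_mul, abs_pow]; have := hb' ω; have := hφc (ε t ω); gcongr
    have i2 : Integrable (fun ω => (Z ω * M ω) * φ (ε t ω)) P := by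
      refine integrable_of_abs_le ((mZ.mul mM').mul mφ) (b := b * c * c) fun ω => ?_
      rw [abs_mul, abs_mul]; have := hb' ω; have := hφc (ε t ω); have := bM ω; gcongr
    have i3 : Integrable (fun ω => (Z ω * M ω) * M ω) P := by
      refine integrable_of_abs_le ((mZ.mul mM').mul mM') (b := b * c * c) fun ω => ?_
      rw [abs_mul, abs_mul]; have := hb' ω; have := bM ω; gcongr
    have i4 : Integrable (fun ω => ε t ω ^ 2) P := (h.memLp t h1 h2).integrable_sq
    have i5 : Integrable (fun ω => Z ω * ε t ω ^ 2) P :=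
      i4.bdd_mul mZ.aestronglyMeasurable (Eventually.of_forall hb')
    have e2 : ∀ ω, Z ω * (φ (ε t ω) - M ω) ^ 2 =
        Z ω * φ (ε t ω) ^ 2 + (-2) * ((Z ω * M ω) * φ (ε t ω)) + (Z ω * M ω) * M ω :=
      fun ω => by ring
    simp_rw [e2]
    rw [integral_add_add i1 (i2.const_mul _) i3, integral_const_mul, e1]
    have e3 : 0 ≤ ∫ ω, (Z ω * M ω) * φ (ε t ω) ∂P := by
      rw [← e1]
      exact integral_nonneg fun ω => by
        show 0 ≤ Z ω * M ω * M ω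
        rw [mul_assoc]; exact mul_nonneg (h0 ω) (mul_self_nonneg _)
    have e4 : ∫ ω, Z ω * φ (ε t ω) ^ 2 ∂P ≤ ∫ ω, Z ω * ε t ω ^ 2 ∂P :=
      integral_mono i1 i5 fun ω => mul_le_mul_of_nonneg_left (sq_le_sq.2 (hφx _)) (h0 ω)
    have e5 := integral_mul_le_of_condExp_le (h.past_le t) hZ ⟨b, hb'⟩ h0 i4 (h.var t h1 h2)
    linarith

/-- As the errors have conditional mean zero, `φ(ε)` and `φ(ε) - β ε` have the same conditional
mean, and the latter is dominated by `γ ε² + δ`. Truncations use `β = 1`, layers `β = 0`. -/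
lemma abs_condMean_ae_le (hφ : Measurable φ) (hφc : ∀ x, |φ x| ≤ c) {β γ δ : ℝ} (hγ : 0 ≤ γ)
    (hφ' : ∀ x, |φ x - β * x| ≤ γ * x ^ 2 + δ) {t : ℕ} (h1 : 1 ≤ t) (h2 : t ≤ n) :
    ∀ᵐ ω ∂P, |condMean P I ε φ c t ω| ≤ γ * v + δ := by
  have i1 : Integrable (ε t) P := (h.memLp t h1 h2).integrable one_le_two
  have i2 : Integrable (fun ω => ε t ω ^ 2) P := (h.memLp t h1 h2).integrable_sq
  have i3 : Integrable (fun ω => φ (ε t ω)) P :=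
    integrable_of_abs_le (h.measurable_comp hφ t) fun ω => hφc _
  have up : P[fun ω => φ (ε t ω) | pastSigma I ε t] ≤ᵐ[P]
      P[β • ε t + (γ • (fun ω => ε t ω ^ 2) + fun _ => δ) | pastSigma I ε t] := by
    refine condExp_mono i3 ((i1.smul β).add ((i2.smul γ).add (integrable_const δ)))
      (Eventually.of_forall fun ω => ?_)
    have := le_of_abs_le (hφ' (ε t ω))
    simp only [Pi.add_apply, Pi.smul_apply, smul_eq_mul]
    linarith
  have lo : P[β • ε t + ((-γ) • (fun ω => ε t ω ^ 2) + fun _ => -δ) | pastSigma I ε t] ≤ᵐ[P]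
      P[fun ω => φ (ε t ω) | pastSigma I ε t] := by
    refine condExp_mono ((i1.smul β).add ((i2.smul (-γ)).add (integrable_const (-δ)))) i3
      (Eventually.of_forall fun ω => ?_)
    have := neg_le_of_abs_le (hφ' (ε t ω))
    simp only [Pi.add_apply, Pi.smul_apply, smul_eq_mul]
    linarith
  have key : ∀ a b : ℝ, P[β • ε t + (a • (fun ω => ε t ω ^ 2) + fun _ => b) | pastSigma I ε t]
      =ᵐ[P] fun ω => a * (P[fun ω => ε t ω ^ 2 | pastSigma I ε t]) ω + b := fun a b => by
    have q1 := condExp_add (i1.smul β) ((i2.smul a).add (integrable_const b)) (pastSigma I ε t)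
    have q2 := condExp_add (i2.smul a) (integrable_const (μ := P) b) (pastSigma I ε t)
    have q3 := condExp_smul (μ := P) β (ε t) (pastSigma I ε t)
    have q4 := condExp_smul (μ := P) a (fun ω => ε t ω ^ 2) (pastSigma I ε t)
    filter_upwards [q1, q2, q3, q4, h.mean t h1 h2] with ω a1 a2 a3 a4 a5
    rw [a1, Pi.add_apply, a2, Pi.add_apply, a3, a4, condExp_const (h.past_le t)]
    simp [a5]
  filter_upwards [up, lo, key γ δ, key (-γ) (-δ), h.condMean_ae_eq hφ hφc t, h.var t h1 h2]
    with ω a1 a2 a3 a4 a5 a6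
  rw [a5]
  rw [a3] at a1; rw [a4] at a2
  have := mul_le_mul_of_nonneg_left a6 hγ
  rw [abs_le]; constructor <;> linarith

/-- Maximal inequality over finitely many disjoint sets for sums of bounded functions of the
errors. -/
lemma integral_iSup_le (hd : 1 ≤ d) (hφ : Measurable φ) (hφc : ∀ x, |φ x| ≤ c)
    (hφx : ∀ x, |φ x| ≤ |x|) {β γ δ : ℝ} (hγ : 0 ≤ γ) (hδ : 0 ≤ δ)
    (hφ' : ∀ x, |φ x - β * x| ≤ γ * x ^ 2 + δ) {S : Type*} [Fintype S] [Nonempty S] {B : S → Set E}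
    (hC : 0 ≤ C) (hB : ∀ s, LagBound P n d I ε C (B s)) {q V lam κ : ℝ}
    (hV : ∑ s, expCount P I (B s) n ≤ V) (hq : ∀ s, expCount P I (B s) n ≤ q * V)
    (hqV : 1 ≤ q * V) (hlam : 0 < lam) (hκ : 0 < κ) :
    Integrable (fun ω => ⨆ s, |hitSum I (B s) (fun t ω => φ (ε t ω)) n ω|) P ∧
    ∫ ω, ⨆ s, |hitSum I (B s) (fun t ω => φ (ε t ω)) n ω| ∂P ≤
      lam + v * (16 * C * v * (q * V) + (64 * d ^ 2 + 12) * c ^ 2) * V / lam ^ 3 +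
        (γ * v + δ) * (κ + (1 + 2 * d + 2 * C) * (q * V) * V / κ) := by
  have hv := h.nonneg
  have hc : 0 ≤ c := (abs_nonneg _).trans (hφc 0)
  set η := fun t ω => φ (ε t ω) - condMean P I ε φ c t ω with hη
  have mds := h.isBoundedMDS (d := d) hφ hφc hφx
  set τ := γ * v + δ with hτ
  have hτ0 : 0 ≤ τ := by positivity
  have four := fun s => mds.integral_pow_four_le h.meas_cov h.meas_err hd hv (hB s) le_rfl
  have two := fun s => integral_hitCount_sq_le h.meas_cov hd (hB s) (le_refl n)
  have hm0 := fun s => expCount_nonneg (I := I) P (B s) n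
  have int4 : ∀ s, Integrable (fun ω => hitSum I (B s) η n ω ^ 4) P := fun s => by
    refine integrable_of_abs_le ((mds.measurable_hitSum h.meas_cov h.meas_err
      (hB s).meas n).pow_const 4) (b := (n * (2 * c)) ^ 4) fun ω => ?_
    rw [abs_pow]; gcongr; exact abs_hitSum_le mds.bound n ω
  have mT : ∀ s, Measurable (hitSum I (B s) (fun t ω => φ (ε t ω)) n) := fun s =>
    measurable_hitSum (hB s).meas (fun t _ _ => h.meas_cov t) fun t _ _ => h.measurable_comp hφ t
  have bT : ∀ s ω, |hitSum I (B s) (fun t ω => φ (ε t ω)) n ω| ≤ n * c := fun s ω =>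
    abs_hitSum_le (fun t ω => hφc _) n ω
  have intS : Integrable (fun ω => ⨆ s, |hitSum I (B s) (fun t ω => φ (ε t ω)) n ω|) P := by
    refine integrable_of_abs_le (Measurable.iSup fun s => (mT s).abs) (b := n * c) fun ω => ?_
    rw [abs_of_nonneg (Real.iSup_nonneg fun s => abs_nonneg _)]
    exact ciSup_le fun s => bT s ω
  refine ⟨intS, ?_⟩
  have iA : Integrable (fun ω => lam + (∑ s, hitSum I (B s) η n ω ^ 4) / lam ^ 3) P :=
    (integrable_const _).add ((integrable_finsetSum _ fun s _ => int4 s).div_const _)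
  have iB : Integrable (fun ω => τ * (κ + (∑ s, hitSum I (B s) (fun _ _ => 1) n ω ^ 2) / κ)) P :=
    ((integrable_const _).add
      ((integrable_finsetSum _ fun s _ => (two s).1).div_const _)).const_mul _
  have dom : ∀ᵐ ω ∂P, ⨆ s, |hitSum I (B s) (fun t ω => φ (ε t ω)) n ω| ≤
      (lam + (∑ s, hitSum I (B s) η n ω ^ 4) / lam ^ 3) +
      τ * (κ + (∑ s, hitSum I (B s) (fun _ _ => 1) n ω ^ 2) / κ) := by
    have hall : ∀ᵐ ω ∂P, ∀ t ∈ Finset.Icc 1 n, |condMean P I ε φ c t ω| ≤ τ := by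
      rw [Filter.eventually_all_finset]
      intro t ht
      rw [Finset.mem_Icc] at ht
      exact h.abs_condMean_ae_le hφ hφc hγ hφ' ht.1 ht.2
    filter_upwards [hall] with ω hω
    refine ciSup_le fun s => ?_
    set N := hitSum I (B s) (fun _ _ => (1 : ℝ)) n ω with hN
    have split : hitSum I (B s) (fun t ω => φ (ε t ω)) n ω =
        hitSum I (B s) η n ω + hitSum I (B s) (condMean P I ε φ c) n ω := by
      unfold hitSum
      rw [← Finset.sum_add_distrib]
      exact Finset.sum_congr rfl fun t _ => by simp only [hη]; ring
    have comp : |hitSum I (B s) (condMean P I ε φ c) n ω| ≤ τ * N := by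
      rw [hN]
      unfold hitSum
      rw [Finset.mul_sum]
      refine (Finset.abs_sum_le_sum_abs _ _).trans (Finset.sum_le_sum fun t ht => ?_)
      rw [abs_mul, abs_of_nonneg (hit_nonneg _ _ _), mul_one, mul_comm τ]
      exact mul_le_mul_of_nonneg_left (hω t ht) (hit_nonneg _ _ _)
    -- From `x ≤ lam + x⁴ / lam³`, with the maximum of the fourth powers replaced by their sum. The
    -- same device with squares treats the counts below.
    have c1 : |hitSum I (B s) η n ω| ≤ lam + (∑ s, hitSum I (B s) η n ω ^ 4) / lam ^ 3 := by
      have a1 : hitSum I (B s) η n ω ^ 4 ≤ ∑ s, hitSum I (B s) η n ω ^ 4 :=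
        Finset.single_le_sum (f := fun s => hitSum I (B s) η n ω ^ 4)
          (fun s _ => by positivity) (Finset.mem_univ s)
      set x := |hitSum I (B s) η n ω| with hx
      have a2 : hitSum I (B s) η n ω ^ 4 = x ^ 4 := by
        rw [hx, ← abs_pow, abs_of_nonneg (by positivity)]
      have a3 : x ≤ lam + x ^ 4 / lam ^ 3 := by
        have hx0 : 0 ≤ x := abs_nonneg _
        rcases le_total x lam with hl | hl
        · have : 0 ≤ x ^ 4 / lam ^ 3 := by positivity
          linarith
        · have : x ≤ x ^ 4 / lam ^ 3 := by
            rw [le_div_iff₀ (by positivity)]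
            calc x * lam ^ 3 ≤ x * x ^ 3 := by gcongr
              _ = x ^ 4 := by ring
          linarith
      refine a3.trans ?_
      rw [← a2]
      gcongr
    have c2 : N ≤ κ + (∑ s, hitSum I (B s) (fun _ _ => 1) n ω ^ 2) / κ := by
      have a1 : N ^ 2 ≤ ∑ s, hitSum I (B s) (fun _ _ => 1) n ω ^ 2 :=
        Finset.single_le_sum (f := fun s => hitSum I (B s) (fun _ _ => (1 : ℝ)) n ω ^ 2)
          (fun s _ => by positivity) (Finset.mem_univ s)
      have a3 : N ≤ κ + N ^ 2 / κ := by
        rcases le_total N κ with hl | hl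
        · have : 0 ≤ N ^ 2 / κ := by positivity
          linarith
        · have : N ≤ N ^ 2 / κ := by
            rw [le_div_iff₀ hκ]; nlinarith
          linarith
      refine a3.trans ?_
      gcongr
    rw [split]
    refine (abs_add_le _ _).trans (add_le_add c1 (comp.trans ?_))
    exact mul_le_mul_of_nonneg_left c2 hτ0
  refine (integral_mono_ae intS (iA.add iB) dom).trans ?_
  have eA : ∫ ω, (lam + (∑ s, hitSum I (B s) η n ω ^ 4) / lam ^ 3) ∂P =
      lam + (∑ s, ∫ ω, hitSum I (B s) η n ω ^ 4 ∂P) / lam ^ 3 := by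
    rw [integral_add (integrable_const _)
      ((integrable_finsetSum _ fun s _ => int4 s).div_const _), integral_div,
      integral_finsetSum _ fun s _ => int4 s]
    simp
  have eB : ∫ ω, τ * (κ + (∑ s, hitSum I (B s) (fun _ _ => 1) n ω ^ 2) / κ) ∂P =
      τ * (κ + (∑ s, ∫ ω, hitSum I (B s) (fun _ _ => 1) n ω ^ 2 ∂P) / κ) := by
    rw [integral_const_mul, integral_add (integrable_const _)
      ((integrable_finsetSum _ fun s _ => (two s).1).div_const _), integral_div,
      integral_finsetSum _ fun s _ => (two s).1]
    simp
  show ∫ ω, ((lam + (∑ s, hitSum I (B s) η n ω ^ 4) / lam ^ 3) +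
      τ * (κ + (∑ s, hitSum I (B s) (fun _ _ => 1) n ω ^ 2) / κ)) ∂P ≤ _
  rw [integral_add iA iB, eA, eB]
  -- In the quadratic part one expected count is bounded by `q * V` and the other is summed to `V`,
  -- so the number of sets does not enter. The centred variables are bounded by `2 * c`, whence `64
  -- d² + 12 = 4 (16 d² + 3)`.
  have s4 : ∑ s, ∫ ω, hitSum I (B s) η n ω ^ 4 ∂P ≤
      v * (16 * C * v * (q * V) + (64 * d ^ 2 + 12) * c ^ 2) * V := by
    calc _ ≤ ∑ s, (v * (16 * C * v * (q * V) + (64 * d ^ 2 + 12) * c ^ 2)) *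
          expCount P I (B s) n := by
          refine Finset.sum_le_sum fun s _ => (four s).trans ?_
          refine mul_le_mul_of_nonneg_right (mul_le_mul_of_nonneg_left ?_ hv) (hm0 s)
          have := mul_le_mul_of_nonneg_left (hq s) (by positivity : 0 ≤ 16 * C * v)
          nlinarith
      _ ≤ _ := by
          rw [← Finset.mul_sum]
          exact mul_le_mul_of_nonneg_left hV (by positivity)
  have s2 : ∑ s, ∫ ω, hitSum I (B s) (fun _ _ => 1) n ω ^ 2 ∂P ≤
      (1 + 2 * d + 2 * C) * (q * V) * V := by
    calc _ ≤ ∑ s, ((1 + 2 * d + 2 * C) * (q * V)) * expCount P I (B s) n := by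
          refine Finset.sum_le_sum fun s _ => (two s).2.trans ?_
          refine mul_le_mul_of_nonneg_right ?_ (hm0 s)
          have := mul_le_mul_of_nonneg_left (hq s) (by positivity : 0 ≤ 2 * C)
          have := mul_le_mul_of_nonneg_left hqV (by positivity : (0 : ℝ) ≤ 1 + 2 * d)
          linarith
      _ ≤ _ := by
          rw [← Finset.mul_sum]
          exact mul_le_mul_of_nonneg_left hV (by positivity)
  have hlam3 : 0 < lam ^ 3 := by positivity
  gcongr

end ErrorModel

lemma LagBound.of_condExp (hI : ∀ t, Measurable (I t)) (hε : ∀ t, Measurable (ε t))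
    (hC : 0 ≤ C) {B : Set E} (hB : MeasurableSet B)
    (hle : ∀ t, 1 ≤ t → t ≤ n → ∀ᵐ ω ∂P,
      (P[(I t ⁻¹' B).indicator (fun _ => (1 : ℝ)) | laggedSigma d I ε t]) ω ≤
        C * P.real (I t ⁻¹' B)) : LagBound P n d I ε C B :=
  ⟨hB, hC, fun t h1 h2 _ hZ h0 hb =>
    integral_mul_le_of_condExp_le (laggedSigma_le hI hε d t) hZ hb h0
      ((integrable_const (1 : ℝ)).indicator (hI t hB)) (hle t h1 h2)⟩

end Maximal


/-! ### Dyadic partition of the line according to a finite measure. -/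

section Grid1D

/-- The index of the dyadic interval of level `r` that contains `ρ (-∞, z) / V`. -/
noncomputable def gridIdx (ρ : Measure ℝ) (V : ℝ) (r : ℕ) (z : ℝ) : ℕ :=
  ⌊2 ^ r * (ρ.real (Set.Iio z) / V)⌋₊

/-- The points with index `s` at level `r` which are not the largest such point. -/
def gridSlab (ρ : Measure ℝ) (V : ℝ) (r s : ℕ) : Set ℝ :=
  {z | gridIdx ρ V r z = s ∧ ∃ e, z < e ∧ gridIdx ρ V r e = s}

/-- The points which lie below the dyadic interval `s` of level `r + 1` and in the same interval
of level `r`. -/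
def gridCell (ρ : Measure ℝ) (V : ℝ) (r s : ℕ) : Set ℝ :=
  {z | gridIdx ρ V (r + 1) z < s ∧ gridIdx ρ V r z = s / 2 ∧ ∃ e, gridIdx ρ V (r + 1) e = s}

variable {ρ : Measure ℝ} [IsFiniteMeasure ρ] {V : ℝ}

lemma gridIdx_mono (hV : 0 < V) (r : ℕ) : Monotone (gridIdx ρ V r) := fun x y hxy => by
  unfold gridIdx
  have : ρ.real (Set.Iio x) ≤ ρ.real (Set.Iio y) := measureReal_mono (Set.Iio_subset_Iio hxy)
  gcongr

lemma gridIdx_succ_div_two (r : ℕ) (z : ℝ) : gridIdx ρ V (r + 1) z / 2 = gridIdx ρ V r z := by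
  unfold gridIdx
  rw [← Nat.floor_div_ofNat]
  congr 1
  rw [pow_succ]; ring

lemma gridIdx_lt (hV : ρ.real Set.univ < V) (r : ℕ) (z : ℝ) : gridIdx ρ V r z < 2 ^ r := by
  have hV0 : 0 < V := lt_of_le_of_lt measureReal_nonneg hV
  unfold gridIdx
  have h1 : ρ.real (Set.Iio z) / V < 1 := by
    rw [div_lt_one hV0]
    exact lt_of_le_of_lt (measureReal_mono (Set.subset_univ _)) hV
  have h0 : 0 ≤ ρ.real (Set.Iio z) / V := div_nonneg measureReal_nonneg hV0.le
  rw [Nat.floor_lt (by positivity)]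
  push_cast
  nlinarith [pow_pos (two_pos (α := ℝ)) r]

lemma gridIdx_zero (hV : ρ.real Set.univ < V) (z : ℝ) : gridIdx ρ V 0 z = 0 := by
  have := gridIdx_lt hV 0 z
  omega

/-- Inner regularity: a compact subset of `T` lies between its minimum and its maximum, which belong
to `T`. -/
lemma measureReal_le_of_Icc {T : Set ℝ} (hT : MeasurableSet T) {β : ℝ} (hβ : 0 ≤ β)
    (h : ∀ x ∈ T, ∀ y ∈ T, x ≤ y → ρ.real (Set.Icc x y) ≤ β) : ρ.real T ≤ β := by
  refine ENNReal.toReal_le_of_le_ofReal hβ ?_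
  rw [hT.measure_eq_iSup_isCompact]
  refine iSup_le fun K => iSup₂_le fun hKT hK => ?_
  rcases K.eq_empty_or_nonempty with rfl | hne
  · simp
  · have hx := hK.sInf_mem hne
    have hy := hK.sSup_mem hne
    have hsub : K ⊆ Set.Icc (sInf K) (sSup K) := fun z hz =>
      ⟨csInf_le hK.bddBelow hz, le_csSup hK.bddAbove hz⟩
    refine (measure_mono hsub).trans ?_
    rw [← ENNReal.ofReal_toReal (measure_ne_top ρ (Set.Icc (sInf K) (sSup K)))]
    exact ENNReal.ofReal_le_ofReal (h _ (hKT hx) _ (hKT hy) (hsub hx).2)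

lemma measureReal_Ico_le (hV : 0 < V) {r : ℕ} {z e : ℝ} (hze : z ≤ e)
    (h : gridIdx ρ V r z = gridIdx ρ V r e) : ρ.real (Set.Ico z e) ≤ V / 2 ^ r := by
  have e1 : ρ.real (Set.Ico z e) = ρ.real (Set.Iio e) - ρ.real (Set.Iio z) := by
    rw [← measureReal_sdiff (Set.Iio_subset_Iio hze) measurableSet_Iio]
    congr 1
    ext x; simp
  have h2 : (0 : ℝ) < 2 ^ r := by positivity
  have a1 := Nat.lt_floor_add_one (2 ^ r * (ρ.real (Set.Iio e) / V))
  have a2 := Nat.floor_le (a := 2 ^ r * (ρ.real (Set.Iio z) / V)) (by positivity)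
  unfold gridIdx at h
  rw [← h] at a1
  have a3 : 2 ^ r * (ρ.real (Set.Iio e) / V) - 2 ^ r * (ρ.real (Set.Iio z) / V) ≤ 1 := by
    linarith
  rw [e1, le_div_iff₀ h2]
  have a4 : 2 ^ r * (ρ.real (Set.Iio e) / V) - 2 ^ r * (ρ.real (Set.Iio z) / V) =
      (ρ.real (Set.Iio e) - ρ.real (Set.Iio z)) * 2 ^ r / V := by ring
  rw [a4, div_le_one hV] at a3
  exact a3

lemma ordConnected_gridSlab (hV : 0 < V) (r s : ℕ) : (gridSlab ρ V r s).OrdConnected := by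
  refine Set.ordConnected_of_Ioo fun x hx y hy _ z hz => ?_
  obtain ⟨hy1, e, hye, he⟩ := hy
  refine ⟨le_antisymm ?_ ?_, e, hz.2.trans hye, he⟩
  · rw [← hy1]; exact gridIdx_mono hV r hz.2.le
  · rw [← hx.1]; exact gridIdx_mono hV r hz.1.le

lemma ordConnected_gridCell (hV : 0 < V) (r s : ℕ) : (gridCell ρ V r s).OrdConnected := by
  refine Set.ordConnected_of_Ioo fun x hx y hy _ z hz => ?_
  refine ⟨(gridIdx_mono hV _ hz.2.le).trans_lt hy.1, le_antisymm ?_ ?_, hx.2.2⟩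
  · rw [← hy.2.1]; exact gridIdx_mono hV r hz.2.le
  · rw [← hx.2.1]; exact gridIdx_mono hV r hz.1.le

/-- This is why the largest point is excluded from a slab. An atom heavier than `V / 2 ^ r` is
always the largest point of its level set; without it, `[x, y]` stays inside some `[x, e)` with
equal indices at both ends. Discrete or deterministic coordinates thus need no special treatment. -/
lemma measureReal_gridSlab_le (hV : 0 < V) (r s : ℕ) :
    ρ.real (gridSlab ρ V r s) ≤ V / 2 ^ r := by
  refine measureReal_le_of_Icc (ordConnected_gridSlab hV r s).measurableSet (by positivity) ?_
  rintro x ⟨hx, -⟩ y ⟨-, e, hye, he⟩ hxy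
  exact (measureReal_mono (show Set.Icc x y ⊆ Set.Ico x e from
    fun z hz => ⟨hz.1, hz.2.trans_lt hye⟩)).trans
    (measureReal_Ico_le hV (hxy.trans hye.le) (hx.trans he.symm))

/-- The point `e` of index `s` at level `r + 1` lies above `z` and shares its index at level `r`. -/
lemma gridCell_subset_gridSlab (hV : 0 < V) (r s : ℕ) :
    gridCell ρ V r s ⊆ gridSlab ρ V r (s / 2) := by
  rintro z ⟨h1, h2, e, he⟩
  refine ⟨h2, e, ?_, ?_⟩
  · by_contra hlt
    have := gridIdx_mono (ρ := ρ) hV (r + 1) (not_lt.1 hlt)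
    omega
  · rw [← gridIdx_succ_div_two, he]

/-- The two halves of one dyadic interval are consecutive, and `z` is in the lower one. Hence cells
with different `s` are disjoint. -/
lemma gridCell_index_eq {r s : ℕ} {z : ℝ} (h : z ∈ gridCell ρ V r s) :
    s = gridIdx ρ V (r + 1) z + 1 := by
  obtain ⟨h1, h2, -⟩ := h
  rw [← gridIdx_succ_div_two] at h2
  omega

-- Two indices that differ at level `i` separate at exactly one earlier step, where the parents
-- agree and the children differ; the summand detects this step.
open Classical in
lemma sum_gridCell_indicator (hV : ρ.real Set.univ < V) (z e : ℝ) (i : ℕ) :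
    ∑ j ∈ Finset.range i, (if z ∈ gridCell ρ V j (gridIdx ρ V (j + 1) e) then (1 : ℝ) else 0) =
      if gridIdx ρ V i z < gridIdx ρ V i e then 1 else 0 := by
  induction i with
  | zero => simp [gridIdx_zero hV]
  | succ i ih =>
    rw [Finset.sum_range_succ, ih]
    have h1 := gridIdx_succ_div_two (ρ := ρ) (V := V) i z
    have h2 := gridIdx_succ_div_two (ρ := ρ) (V := V) i e
    have h3 : z ∈ gridCell ρ V i (gridIdx ρ V (i + 1) e) ↔
        gridIdx ρ V (i + 1) z < gridIdx ρ V (i + 1) e ∧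
          gridIdx ρ V i z = gridIdx ρ V (i + 1) e / 2 :=
      ⟨fun h => ⟨h.1, h.2.1⟩, fun h => ⟨h.1, h.2, e, rfl⟩⟩
    simp only [h3]
    split_ifs <;> first | omega | norm_num

end Grid1D

/-! ### Truncation and the pathwise chaining decomposition. -/

section Chaining

/-- Truncation of a real number at level `c`. -/
noncomputable def trunc (c x : ℝ) : ℝ := if |x| ≤ c then x else 0

/-- The absolute value of `x` if it lies in `(a, b]`, and `0` otherwise. -/
noncomputable def layer (a b x : ℝ) : ℝ := if a < |x| ∧ |x| ≤ b then |x| else 0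

lemma measurable_trunc (c : ℝ) : Measurable (trunc c) :=
  Measurable.ite (measurableSet_le measurable_id.abs measurable_const) measurable_id
    measurable_const

lemma measurable_layer (a b : ℝ) : Measurable (layer a b) :=
  Measurable.ite ((measurableSet_lt measurable_const measurable_id.abs).inter
    (measurableSet_le measurable_id.abs measurable_const)) measurable_id.abs measurable_const

lemma abs_trunc_le {c : ℝ} (hc : 0 ≤ c) (x : ℝ) : |trunc c x| ≤ c := by
  unfold trunc; split_ifs with h
  · exact h
  · simpa using hc

lemma abs_trunc_le_abs (c x : ℝ) : |trunc c x| ≤ |x| := by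
  unfold trunc; split_ifs with h
  · exact le_rfl
  · simp

/-- Where truncation acts, `|x| ≤ x² / c`. -/
lemma abs_trunc_sub_le {c : ℝ} (hc : 0 < c) (x : ℝ) :
    |trunc c x - 1 * x| ≤ 1 / c * x ^ 2 + 0 := by
  unfold trunc; split_ifs with h
  · simp; positivity
  · rw [zero_sub, one_mul, abs_neg, add_zero, div_mul_eq_mul_div, one_mul, le_div_iff₀ hc,
      ← sq_abs]
    nlinarith [abs_nonneg x]

lemma layer_nonneg (a b x : ℝ) : 0 ≤ layer a b x := by
  unfold layer; split_ifs
  · exact abs_nonneg _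
  · exact le_rfl

lemma abs_layer_le {a b : ℝ} (hb : 0 ≤ b) (x : ℝ) : |layer a b x| ≤ b := by
  unfold layer; split_ifs with h
  · rw [abs_abs]; exact h.2
  · simpa using hb

lemma abs_layer_le_abs (a b x : ℝ) : |layer a b x| ≤ |x| := by
  unfold layer; split_ifs with h
  · rw [abs_abs]
  · simp

lemma abs_layer_sub_le {a : ℝ} (ha : 0 < a) (b x : ℝ) :
    |layer a b x - 0 * x| ≤ 1 / a * x ^ 2 + 0 := by
  unfold layer; split_ifs with h
  · rw [zero_mul, sub_zero, abs_abs, add_zero, div_mul_eq_mul_div, one_mul, le_div_iff₀ ha,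
      ← sq_abs]
    nlinarith [abs_nonneg x]
  · simp; positivity

/-- For the finest level, where the layer has no positive lower threshold to divide by. -/
lemma abs_layer_sub_le' (a b x : ℝ) : |layer a b x - 0 * x| ≤ 1 * x ^ 2 + 1 := by
  rw [zero_mul, sub_zero]
  refine (abs_layer_le_abs a b x).trans ?_
  rw [← sq_abs]
  nlinarith [sq_nonneg (|x| - 1)]

variable {ι : Type*} [Fintype ι] [Nonempty ι]

open Classical in
/-- Dyadic chaining of the indicator of an orthant, with truncation levels adapted to the scale:
`x` is truncated at `τ r` on the cells of level `r`. -/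
lemma abs_chaining_le {ρ : ι → Measure ℝ} [∀ k, IsFiniteMeasure (ρ k)] {V : ℝ}
    (hV : ∀ k, (ρ k).real Set.univ < V) {τ : ℕ → ℝ} (hτ : Antitone τ) {J : ℕ} (hJ : 1 ≤ J)
    (x : ℝ) (z e : ι → ℝ) :
    |(if ∀ k, z k < e k then x else 0) -
      ∑ j ∈ Fintype.piFinset fun _ : ι => Finset.range J,
        if ∀ k, z k ∈ gridCell (ρ k) V (j k) (gridIdx (ρ k) V (j k + 1) (e k))
          then trunc (τ (Finset.univ.sup j)) x else 0| ≤
    (if τ 0 < |x| then |x| else 0) +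
      ∑ i ∈ Finset.Icc 1 J, ∑ k, if z k ∈ gridSlab (ρ k) V i (gridIdx (ρ k) V i (e k))
        then layer (if i = J then -1 else τ i) (τ (i - 1)) x else 0 := by
  have hV0 : 0 < V := lt_of_le_of_lt measureReal_nonneg (hV (Classical.arbitrary ι))
  have hex : ∃ i, i = J ∨ τ i < |x| := ⟨J, Or.inl rfl⟩
  -- The level at which the chain stops for this `x`: the first threshold exceeded by `|x|`, or `J`.
  set L := Nat.find hex with hL
  have hLJ : L ≤ J := Nat.find_min' hex (Or.inl rfl)
  have hlt : ∀ i < J, (i < L ↔ |x| ≤ τ i) := fun i hi => by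
    constructor
    · intro h
      have := Nat.find_min hex h
      push Not at this
      exact this.2
    · intro h
      by_contra hc
      rcases Nat.find_spec hex with h1 | h1
      · omega
      · have := hτ (not_lt.1 hc)
        linarith
  -- A product of cells keeps `x` exactly when all its levels are below `L`. Hence the sum factors
  -- into one-dimensional telescoping sums stopped at `L`, and equals the orthant at resolution `L`.
  have hsum : ∑ j ∈ Fintype.piFinset fun _ : ι => Finset.range J,
        (if ∀ k, z k ∈ gridCell (ρ k) V (j k) (gridIdx (ρ k) V (j k + 1) (e k))
          then trunc (τ (Finset.univ.sup j)) x else 0) =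
      if ∀ k, gridIdx (ρ k) V L (z k) < gridIdx (ρ k) V L (e k) then x else 0 := by
    have h1 : ∀ k, (if gridIdx (ρ k) V L (z k) < gridIdx (ρ k) V L (e k) then (1 : ℝ) else 0) =
        ∑ j ∈ Finset.range J, if j < L ∧ z k ∈ gridCell (ρ k) V j (gridIdx (ρ k) V (j + 1) (e k))
          then (1 : ℝ) else 0 := fun k => by
      rw [← sum_gridCell_indicator (hV k), ← Finset.sum_subset
        (Finset.range_subset_range.2 hLJ)]
      · refine Finset.sum_congr rfl fun j hj => ?_
        simp [Finset.mem_range.1 hj]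
      · intro j _ hj
        rw [Finset.mem_range] at hj
        simp [hj]
    have h2 : (if ∀ k, gridIdx (ρ k) V L (z k) < gridIdx (ρ k) V L (e k) then (1 : ℝ) else 0) =
        ∏ k, if gridIdx (ρ k) V L (z k) < gridIdx (ρ k) V L (e k) then (1 : ℝ) else 0 := by
      rw [Finset.prod_boole]; simp
    have h3 : (if ∀ k, gridIdx (ρ k) V L (z k) < gridIdx (ρ k) V L (e k) then x else 0) =
        (if ∀ k, gridIdx (ρ k) V L (z k) < gridIdx (ρ k) V L (e k) then (1 : ℝ) else 0) * x := by
      split_ifs <;> simp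
    rw [h3, h2, Finset.prod_congr rfl fun k _ => h1 k, Finset.prod_univ_sum, Finset.sum_mul]
    refine Finset.sum_congr rfl fun j hj => ?_
    rw [Finset.prod_boole]
    rw [Fintype.mem_piFinset] at hj
    have hsup : Finset.univ.sup j < J := by
      rw [Finset.sup_lt_iff (by simp; omega)]
      exact fun k _ => Finset.mem_range.1 (hj k)
    have h4 : |x| ≤ τ (Finset.univ.sup j) ↔ ∀ k, j k < L := by
      rw [← hlt _ hsup]
      constructor
      · exact fun h k => (Finset.le_sup (f := j) (Finset.mem_univ k)).trans_lt h
      · intro h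
        have : (⊥ : ℕ) < L := lt_of_le_of_lt bot_le (h (Classical.arbitrary ι))
        rw [Finset.sup_lt_iff this]
        exact fun k _ => h k
    unfold trunc
    simp only [Finset.mem_univ, true_implies, forall_and, h4]
    by_cases ha : ∀ k, j k < L <;>
      by_cases hb : ∀ k, z k ∈ gridCell (ρ k) V (j k) (gridIdx (ρ k) V (j k + 1) (e k)) <;>
      simp [ha, hb]
  rw [hsum]
  have nnA : 0 ≤ (if τ 0 < |x| then |x| else 0) := by split_ifs <;> simp
  have nnS : ∀ i k, 0 ≤ (if z k ∈ gridSlab (ρ k) V i (gridIdx (ρ k) V i (e k))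
        then layer (if i = J then -1 else τ i) (τ (i - 1)) x else 0) := fun i k => by
    by_cases hm : z k ∈ gridSlab (ρ k) V i (gridIdx (ρ k) V i (e k))
    · rw [if_pos hm]; exact layer_nonneg _ _ _
    · rw [if_neg hm]
  have nnT : 0 ≤ ∑ i ∈ Finset.Icc 1 J, ∑ k,
      if z k ∈ gridSlab (ρ k) V i (gridIdx (ρ k) V i (e k))
        then layer (if i = J then -1 else τ i) (τ (i - 1)) x else 0 :=
    Finset.sum_nonneg fun i _ => Finset.sum_nonneg fun k _ => nnS i k
  have himp : (∀ k, gridIdx (ρ k) V L (z k) < gridIdx (ρ k) V L (e k)) → ∀ k, z k < e k :=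
    fun h k => by
      by_contra hc
      have := gridIdx_mono (ρ := ρ k) hV0 L (not_lt.1 hc)
      have := h k
      omega
  by_cases hA : ∀ k, gridIdx (ρ k) V L (z k) < gridIdx (ρ k) V L (e k)
  · rw [if_pos hA, if_pos (himp hA), sub_self, abs_zero]
    exact add_nonneg nnA nnT
  rw [if_neg hA, sub_zero]
  by_cases hz : ∀ k, z k < e k
  swap
  · rw [if_neg hz, abs_zero]
    exact add_nonneg nnA nnT
  rw [if_pos hz]
  rcases Nat.eq_zero_or_pos L with h0 | h0
  · have : τ 0 < |x| := by
      by_contra hc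
      have := (hlt 0 (by omega)).2 (not_lt.1 hc)
      omega
    rw [if_pos this]
    linarith
  -- The point is in the orthant but not in its version at level `L`. Some coordinate then has the
  -- same index as the vertex `e`, so it lies in a slab, and `L` was chosen so that `|x|` falls in
  -- the matching layer.
  push Not at hA
  obtain ⟨k, hk⟩ := hA
  have hkeq : gridIdx (ρ k) V L (z k) = gridIdx (ρ k) V L (e k) :=
    le_antisymm (gridIdx_mono hV0 L (hz k).le) hk
  have hmem : z k ∈ gridSlab (ρ k) V L (gridIdx (ρ k) V L (e k)) := ⟨hkeq, e k, hz k, rfl⟩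
  have hlay : layer (if L = J then -1 else τ L) (τ (L - 1)) x = |x| := by
    unfold layer
    rw [if_pos]
    refine ⟨?_, (hlt (L - 1) (by omega)).1 (by omega)⟩
    split_ifs with hLJ'
    · linarith [abs_nonneg x]
    · exact (Nat.find_spec hex).resolve_left hLJ'
  have hterm : |x| ≤ ∑ i ∈ Finset.Icc 1 J, ∑ k,
      if z k ∈ gridSlab (ρ k) V i (gridIdx (ρ k) V i (e k))
        then layer (if i = J then -1 else τ i) (τ (i - 1)) x else 0 := by
    calc |x| = (if z k ∈ gridSlab (ρ k) V L (gridIdx (ρ k) V L (e k))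
          then layer (if L = J then -1 else τ L) (τ (L - 1)) x else 0) := by
          rw [if_pos hmem, hlay]
      _ ≤ ∑ k, if z k ∈ gridSlab (ρ k) V L (gridIdx (ρ k) V L (e k))
          then layer (if L = J then -1 else τ L) (τ (L - 1)) x else 0 :=
          Finset.single_le_sum (f := fun k =>
            if z k ∈ gridSlab (ρ k) V L (gridIdx (ρ k) V L (e k))
              then layer (if L = J then -1 else τ L) (τ (L - 1)) x else 0)
            (fun k _ => nnS L k) (Finset.mem_univ k)
      _ ≤ _ := Finset.single_le_sum (f := fun i => ∑ k,
            if z k ∈ gridSlab (ρ k) V i (gridIdx (ρ k) V i (e k))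
              then layer (if i = J then -1 else τ i) (τ (i - 1)) x else 0)
            (fun i _ => Finset.sum_nonneg fun k _ => nnS i k)
            (Finset.mem_Icc.2 ⟨h0, hLJ⟩)
  linarith

end Chaining


/-! ### Summation over the levels: the maximal inequality over orthants. -/

/-- The eighth root of `1 / 2`. -/
noncomputable def decay : ℝ := (1 / 2 : ℝ) ^ (1 / 8 : ℝ)

lemma decay_pos : 0 < decay := Real.rpow_pos_of_pos (by norm_num) _

lemma decay_lt_one : decay < 1 := Real.rpow_lt_one (by norm_num) (by norm_num) (by norm_num)

lemma decay_pow_eight : decay ^ 8 = 1 / 2 := by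
  unfold decay
  rw [← Real.rpow_natCast, ← Real.rpow_mul (by norm_num)]
  norm_num

lemma decay_pow_eight_mul (r : ℕ) : decay ^ (8 * r) = 1 / 2 ^ r := by
  rw [pow_mul, decay_pow_eight, div_pow, one_pow]

/-- Consecutive thresholds `√V * decay ^ (2 * r)` differ by a factor of at most two, which is the
factor allowed for `φ` in `integral_iSup_level_le`. -/
lemma one_le_two_mul_decay_sq : 1 ≤ 2 * decay ^ 2 := by
  have h1 := decay_pow_eight
  have h2 : decay ^ 8 ≤ decay ^ 2 :=
    pow_le_pow_of_le_one decay_pos.le decay_lt_one.le (by norm_num)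
  linarith

section Maximal

variable {Ω E : Type*} [mΩ : MeasurableSpace Ω] [MeasurableSpace E]
  {P : Measure Ω} [IsProbabilityMeasure P]
  {I : ℕ → Ω → E} {ε : ℕ → Ω → ℝ} {n d : ℕ} {v C : ℝ}

/-- Constant of the maximal inequality on one level of the chaining: fluctuation part. -/
noncomputable def levelConst (d : ℕ) (v C : ℝ) : ℝ :=
  1 + v * (16 * C * v + (64 * d ^ 2 + 12) * 4)

/-- Constant of the maximal inequality on one level of the chaining: drift part. -/
noncomputable def driftConst (d : ℕ) (C : ℝ) : ℝ := 1 + (1 + 2 * d + 2 * C)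

lemma levelConst_nonneg (hv : 0 ≤ v) (hC : 0 ≤ C) : 0 ≤ levelConst d v C := by
  unfold levelConst; positivity

lemma driftConst_nonneg (hC : 0 ≤ C) : 0 ≤ driftConst d C := by
  unfold driftConst; positivity

namespace ErrorModel

/-- Here `q = 2⁻ʳ = decay ^ (8 r)`, `lam = √V decay ^ r`, `κ = V decay ^ (4 r)`. With `c` of order
`√V decay ^ (2 r)` the term `c² V / lam³` is of the order of `lam`, the term in `q` is smaller
still, and `κ` balances `q V² / κ`. -/
lemma integral_iSup_level_le (h : ErrorModel P n I ε v) (hd : 1 ≤ d) {V : ℝ} {r : ℕ}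
    (hr : 2 ^ r ≤ V) {φ : ℝ → ℝ} (hφ : Measurable φ)
    (hφc : ∀ x, |φ x| ≤ 2 * (√V * decay ^ (2 * r)))
    (hφx : ∀ x, |φ x| ≤ |x|) {β γ δ : ℝ} (hγ : 0 ≤ γ) (hδ : 0 ≤ δ)
    (hφ' : ∀ x, |φ x - β * x| ≤ γ * x ^ 2 + δ) {S : Type*} [Fintype S] [Nonempty S] {B : S → Set E}
    (hC : 0 ≤ C) (hB : ∀ s, LagBound P n d I ε C (B s))
    (hV : ∑ s, expCount P I (B s) n ≤ V) (hq : ∀ s, expCount P I (B s) n ≤ V / 2 ^ r) :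
    Integrable (fun ω => ⨆ s, |hitSum I (B s) (fun t ω => φ (ε t ω)) n ω|) P ∧
    ∫ ω, ⨆ s, |hitSum I (B s) (fun t ω => φ (ε t ω)) n ω| ∂P ≤
      levelConst d v C * (√V * decay ^ r) +
        (γ * v + δ) * (driftConst d C * (V * decay ^ (4 * r))) := by
  have hv := h.nonneg
  have hw := decay_pos
  have h2r : (0 : ℝ) < 2 ^ r := by positivity
  have hV0 : 0 < V := h2r.trans_le hr
  have hsV : 0 < √V := Real.sqrt_pos.2 hV0
  have hsq : √V ^ 2 = V := Real.sq_sqrt hV0.le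
  have hqV : decay ^ (8 * r) * V = V / 2 ^ r := by rw [decay_pow_eight_mul]; ring
  have hle : decay ^ (8 * r) ≤ decay ^ (4 * r) :=
    pow_le_pow_of_le_one hw.le decay_lt_one.le (by omega)
  have hlam : 0 < √V * decay ^ r := by positivity
  have hκ : 0 < V * decay ^ (4 * r) := by positivity
  obtain ⟨h1, h2⟩ := h.integral_iSup_le hd hφ hφc hφx hγ hδ hφ' hC hB (q := decay ^ (8 * r)) hV
    (fun s => by rw [hqV]; exact hq s) (by rw [hqV, one_le_div h2r]; exact hr)
    hlam hκ
  refine ⟨h1, h2.trans ?_⟩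
  unfold levelConst driftConst
  have e1 : v * (16 * C * v * (decay ^ (8 * r) * V) +
      (64 * d ^ 2 + 12) * (2 * (√V * decay ^ (2 * r))) ^ 2) * V / (√V * decay ^ r) ^ 3 ≤
      v * (16 * C * v + (64 * d ^ 2 + 12) * 4) * (√V * decay ^ r) := by
    rw [div_le_iff₀ (by positivity)]
    have a1 : √V * decay ^ r * (√V * decay ^ r) ^ 3 = V * V * decay ^ (4 * r) := by
      rw [show √V * decay ^ r * (√V * decay ^ r) ^ 3 = √V ^ 2 * √V ^ 2 * (decay ^ r) ^ 4 by ring,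
        hsq, ← pow_mul, mul_comm r]
    have a2 : (2 * (√V * decay ^ (2 * r))) ^ 2 = 4 * V * decay ^ (4 * r) := by
      rw [show (2 * (√V * decay ^ (2 * r))) ^ 2 = 4 * √V ^ 2 * (decay ^ (2 * r)) ^ 2 by ring,
        hsq, ← pow_mul]
      ring_nf
    rw [mul_assoc _ (√V * decay ^ r), a1, a2]
    have a3 : v * (16 * C * v * (decay ^ (8 * r) * V) +
        (64 * d ^ 2 + 12) * (4 * V * decay ^ (4 * r))) * V ≤
        v * (16 * C * v * (decay ^ (4 * r) * V) +
        (64 * d ^ 2 + 12) * (4 * V * decay ^ (4 * r))) * V := by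
      gcongr
    refine a3.trans (le_of_eq ?_)
    ring
  have e2 : (1 + 2 * d + 2 * C) * (decay ^ (8 * r) * V) * V / (V * decay ^ (4 * r)) =
      (1 + 2 * d + 2 * C) * (V * decay ^ (4 * r)) := by
    rw [div_eq_iff hκ.ne', show 8 * r = 4 * r + 4 * r by ring, pow_add]
    ring
  rw [e2]
  nlinarith

end ErrorModel

lemma sum_expCount_le {S : Type*} [Fintype S] (hI : ∀ t, Measurable (I t)) {B : S → Set E} {R : Set E}
    (hB : ∀ s, MeasurableSet (B s)) (hdisj : Pairwise (Function.onFun Disjoint B))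
    (hsub : ∀ s, B s ⊆ R) (n : ℕ) :
    ∑ s, expCount P I (B s) n ≤ expCount P I R n := by
  unfold expCount
  rw [Finset.sum_comm]
  refine Finset.sum_le_sum fun t _ => ?_
  rw [← measureReal_biUnion_finset]
  · exact measureReal_mono (Set.iUnion₂_subset fun s _ => Set.preimage_mono (hsub s))
  · intro s _ s' _ hss'
    exact (hdisj hss').preimage _
  · exact fun s _ => hI t (hB s)

variable {ι : Type*}

/-- The points all of whose coordinates lie in given sets. -/
def box (coord : E → ι → ℝ) (T : ι → Set ℝ) : Set E := {y | ∀ k, coord y k ∈ T k}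

lemma box_mono {coord : E → ι → ℝ} {T U : ι → Set ℝ} (h : ∀ k, T k ⊆ U k) :
    box coord T ⊆ box coord U := fun _ hy k => h k (hy k)

lemma mem_box_update [DecidableEq ι] {coord : E → ι → ℝ} {R : ι → Set ℝ} {k : ι} {T : Set ℝ} {y : E} :
    y ∈ box coord (Function.update R k (R k ∩ T)) ↔ y ∈ box coord R ∧ coord y k ∈ T := by
  constructor
  · intro h
    refine ⟨fun k' => ?_, ?_⟩
    · have := h k'
      by_cases hk : k' = k
      · subst hk; rw [Function.update_self] at this; exact this.1
      · rwa [Function.update_of_ne hk] at this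
    · have := h k
      rw [Function.update_self] at this; exact this.2
  · rintro ⟨h1, h2⟩ k'
    by_cases hk : k' = k
    · subst hk; rw [Function.update_self]; exact ⟨h1 _, h2⟩
    · rw [Function.update_of_ne hk]; exact h1 _

lemma hit_mul_ite {R B : Set E} {t : ℕ} {ω : Ω} {p : Prop} [Decidable p]
    (h : I t ω ∈ B ↔ I t ω ∈ R ∧ p) (a : ℝ) :
    hit I R t ω * (if p then a else 0) = hit I B t ω * a := by
  simp only [hit, Set.indicator, Set.mem_preimage]
  by_cases h1 : I t ω ∈ R <;> by_cases h2 : p <;> simp [h1, h2, h]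

/-- The expected number of observations in `R` whose `k`-th coordinate lies in a given set. -/
noncomputable def margMeasure (P : Measure Ω) (I : ℕ → Ω → E) (coord : E → ι → ℝ) (R : Set E) (n : ℕ)
    (k : ι) : Measure ℝ :=
  ∑ t ∈ Finset.Icc 1 n, (P.restrict (I t ⁻¹' R)).map (fun ω => coord (I t ω) k)

instance (coord : E → ι → ℝ) (R : Set E) (k : ι) :
    IsFiniteMeasure (margMeasure P I coord R n k) := by
  unfold margMeasure; infer_instance

lemma margMeasure_real (hI : ∀ t, Measurable (I t)) {coord : E → ι → ℝ}
    (hcoord : ∀ k, Measurable fun y => coord y k) {R : Set E} {k : ι} {T : Set ℝ}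
    (hT : MeasurableSet T) :
    (margMeasure P I coord R n k).real T = expCount P I {y | y ∈ R ∧ coord y k ∈ T} n := by
  unfold margMeasure expCount
  rw [Measure.real, Measure.finsetSum_apply, ENNReal.toReal_sum fun _ _ => measure_ne_top _ _]
  refine Finset.sum_congr rfl fun t _ => ?_
  have hm : Measurable fun ω => coord (I t ω) k := (hcoord k).comp (hI t)
  rw [← Measure.real, map_measureReal_apply hm hT, measureReal_restrict_apply (hm hT)]
  congr 1
  ext ω
  simp [and_comm]

/-- Markov's argument: `|ε| ≤ ε² / a` where `|ε| > a`. It disposes of the errors above the coarsest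
threshold, which are never chained. -/
lemma ErrorModel.integral_large_le (h : ErrorModel P n I ε v) {R : Set E} (hR : MeasurableSet R)
    {a : ℝ} (ha : 0 < a) :
    Integrable (fun ω => ∑ t ∈ Finset.Icc 1 n,
      hit I R t ω * (if a < |ε t ω| then |ε t ω| else 0)) P ∧
    ∫ ω, ∑ t ∈ Finset.Icc 1 n, hit I R t ω * (if a < |ε t ω| then |ε t ω| else 0) ∂P ≤
      v * expCount P I R n / a := by
  have mh : ∀ t, Measurable (hit I R t) := fun t => measurable_hit hR (h.meas_cov t)
  have m0 : ∀ t, Measurable fun ω => if a < |ε t ω| then |ε t ω| else 0 := fun t =>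
    Measurable.ite (measurableSet_lt measurable_const (h.meas_err t).abs) (h.meas_err t).abs
      measurable_const
  have i1 : ∀ t ∈ Finset.Icc 1 n,
      Integrable (fun ω => hit I R t ω * (if a < |ε t ω| then |ε t ω| else 0)) P := fun t ht => by
    rw [Finset.mem_Icc] at ht
    have : Integrable (fun ω => if a < |ε t ω| then |ε t ω| else 0) P := by
      refine ((h.memLp t ht.1 ht.2).integrable one_le_two).abs.mono'
        (m0 t).aestronglyMeasurable (Eventually.of_forall fun ω => ?_)
      split_ifs <;> simp
    exact this.bdd_mul (mh t).aestronglyMeasurable (Eventually.of_forall (abs_hit_le_one R t))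
  refine ⟨integrable_finsetSum _ i1, ?_⟩
  rw [integral_finsetSum _ i1]
  unfold expCount
  rw [Finset.mul_sum, Finset.sum_div]
  refine Finset.sum_le_sum fun t ht => ?_
  have hint := i1 t ht
  rw [Finset.mem_Icc] at ht
  have i2 : Integrable (fun ω => ε t ω ^ 2) P := (h.memLp t ht.1 ht.2).integrable_sq
  have e1 := integral_mul_le_of_condExp_le (h.past_le t)
    (measurable_hit hR (measurable_past_covariate (I := I) (ε := ε) ht.1 le_rfl))
    ⟨1, abs_hit_le_one R t⟩ (hit_nonneg R t) i2 (h.var t ht.1 ht.2)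
  rw [integral_hit P hR (h.meas_cov t)] at e1
  rw [le_div_iff₀ ha, ← integral_mul_const]
  refine (integral_mono (hint.mul_const a) (i2.bdd_mul (mh t).aestronglyMeasurable
    (Eventually.of_forall (abs_hit_le_one R t))) fun ω => ?_).trans e1
  show hit I R t ω * (if a < |ε t ω| then |ε t ω| else 0) * a ≤ hit I R t ω * ε t ω ^ 2
  rw [mul_assoc]
  refine mul_le_mul_of_nonneg_left ?_ (hit_nonneg R t ω)
  split_ifs with hlt
  · rw [← sq_abs]; nlinarith
  · rw [zero_mul]; positivity

/-- The sum of `decay ^ max j` over all multi-indices is bounded by this constant. -/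
noncomputable def chainConst (D : ℕ) : ℝ := (1 / (1 - decay ^ (1 / (D : ℝ)))) ^ D

/-- With `θ = decay ^ (1/D)`, the maximum is at least the mean of the `j k`, so `decay ^ max j ≤ ∏ θ
^ j k`, and the sum factors into geometric series. -/
lemma sum_decay_pow_sup_le [Fintype ι] [DecidableEq ι] [Nonempty ι] (J : ℕ) :
    ∑ j ∈ Fintype.piFinset fun _ : ι => Finset.range J, decay ^ (Finset.univ.sup j) ≤
      chainConst (Fintype.card ι) := by
  set D := Fintype.card ι with hD
  have hD0 : 0 < D := Fintype.card_pos
  have hD0' : (0 : ℝ) < D := by exact_mod_cast hD0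
  set θ := decay ^ (1 / (D : ℝ)) with hθ
  have hθ0 : 0 < θ := Real.rpow_pos_of_pos decay_pos _
  have hθ1 : θ < 1 := Real.rpow_lt_one decay_pos.le decay_lt_one (by positivity)
  have hθD : θ ^ D = decay := by
    rw [hθ, ← Real.rpow_natCast, ← Real.rpow_mul decay_pos.le, one_div,
      inv_mul_cancel₀ hD0'.ne', Real.rpow_one]
  have hgeo : ∑ i ∈ Finset.range J, θ ^ i ≤ 1 / (1 - θ) := by
    rw [one_div, ← tsum_geometric_of_lt_one hθ0.le hθ1]
    exact (summable_geometric_of_lt_one hθ0.le hθ1).sum_le_tsum _ fun i _ => by positivity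
  calc _ ≤ ∑ j ∈ Fintype.piFinset fun _ : ι => Finset.range J, ∏ k, θ ^ (j k) := by
        refine Finset.sum_le_sum fun j _ => ?_
        rw [← hθD, ← pow_mul, mul_comm, pow_mul, hD, ← Finset.card_univ, ← Finset.prod_const]
        refine Finset.prod_le_prod (fun _ _ => by positivity) fun k hk => ?_
        exact pow_le_pow_of_le_one hθ0.le hθ1.le (Finset.le_sup hk)
    _ = (∑ i ∈ Finset.range J, θ ^ i) ^ D := by
        rw [← Finset.prod_univ_sum, Finset.prod_const, Finset.card_univ]
    _ ≤ _ := by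
        unfold chainConst
        have : 0 ≤ ∑ i ∈ Finset.range J, θ ^ i := Finset.sum_nonneg fun i _ => by positivity
        gcongr

/-- The constant of the maximal inequality. -/
noncomputable def maxConst (D d : ℕ) (v C : ℝ) : ℝ :=
  (levelConst d v C + v * driftConst d C) * chainConst D +
    (D * ((levelConst d v C + v * driftConst d C) * (1 / (1 - decay))) +
      D * (levelConst d v C + 2 * (v + 1) * driftConst d C)) + v

lemma maxConst_nonneg (D d : ℕ) (hv : 0 ≤ v) (hC : 0 ≤ C) : 0 ≤ maxConst D d v C := by
  have := levelConst_nonneg (d := d) hv hC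
  have := driftConst_nonneg (d := d) hC
  have h1 : 0 ≤ 1 / (1 - decay) := by
    have := decay_lt_one
    exact div_nonneg zero_le_one (by linarith)
  have h2 : 0 ≤ chainConst D := by
    unfold chainConst
    have := Real.rpow_le_one (z := 1 / (D : ℝ)) decay_pos.le decay_lt_one.le (by positivity)
    exact pow_nonneg (div_nonneg zero_le_one (by linarith)) _
  unfold maxConst
  positivity

set_option maxHeartbeats 1000000 in
open Classical in
/-- Maximal inequality: the sums of the errors over all orthants, restricted to a hyperrectangle
with expected number of observations less than `V`, are of the order `√V` in `L¹`, uniformly. -/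
theorem ErrorModel.exists_orthant_bound [Fintype ι] [Nonempty ι] (h : ErrorModel P n I ε v)
    (hd : 1 ≤ d) (hC : 0 ≤ C) {coord : E → ι → ℝ} (hcoord : ∀ k, Measurable fun y => coord y k)
    (hbox : ∀ T : ι → Set ℝ, (∀ k, (T k).OrdConnected) → LagBound P n d I ε C (box coord T))
    {R : ι → Set ℝ} (hR : ∀ k, (R k).OrdConnected) {V : ℝ} (hV2 : 2 ≤ V)
    (hV : expCount P I (box coord R) n < V) :
    ∃ W : Ω → ℝ, Integrable W P ∧
      (∀ ω (e : ι → ℝ), |∑ t ∈ Finset.Icc 1 n, hit I (box coord R) t ω *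
        (if ∀ k, coord (I t ω) k < e k then ε t ω else 0)| ≤ W ω) ∧
      ∫ ω, W ω ∂P ≤ maxConst (Fintype.card ι) d v C * √V := by
  have hv := h.nonneg
  have hw := decay_pos
  have hV0 : 0 < V := by linarith
  have hsV : 0 < √V := Real.sqrt_pos.2 hV0
  have hsq : √V * √V = V := Real.mul_self_sqrt hV0.le
  -- Chaining stops when slabs have expected count below two: `2 ^ J ≤ V < 2 ^ (J + 1)`.
  obtain ⟨J, hJ1, hJ2⟩ := exists_nat_pow_near (by linarith : (1 : ℝ) ≤ V) (one_lt_two)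
  have hJ : 1 ≤ J := by
    by_contra hc
    have : J = 0 := by omega
    subst this
    norm_num at hJ2
    linarith
  set τ : ℕ → ℝ := fun r => √V * decay ^ (2 * r) with hτ
  have hτpos : ∀ r, 0 < τ r := fun r => by positivity
  have hτanti : Antitone τ := fun a b hab =>
    mul_le_mul_of_nonneg_left
      (pow_le_pow_of_le_one hw.le decay_lt_one.le (by omega)) hsV.le
  set ρ := margMeasure P I coord (box coord R) n with hρ
  have hρV : ∀ k, (ρ k).real Set.univ < V := fun k => by
    rw [hρ, margMeasure_real h.meas_cov hcoord MeasurableSet.univ]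
    simpa using hV
  have hpow : ∀ r, r ≤ J → (2 : ℝ) ^ r ≤ V := fun r hr =>
    (pow_le_pow_right₀ one_le_two hr).trans hJ1
  -- cells
  set Bc : (ι → ℕ) → (ι → Fin (2 ^ J)) → Set E := fun j s =>
    box coord fun k => R k ∩ gridCell (ρ k) V (j k) (s k) with hBc
  have hBcLag : ∀ j s, LagBound P n d I ε C (Bc j s) := fun j s =>
    hbox _ fun k => (hR k).inter (ordConnected_gridCell hV0 _ _)
  have hBcsub : ∀ j s, Bc j s ⊆ box coord R := fun j s =>
    box_mono fun k => Set.inter_subset_left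
  have hBcdisj : ∀ j, Pairwise (Function.onFun Disjoint (Bc j)) := fun j s s' hss' => by
    rw [Function.onFun, Set.disjoint_left]
    intro y hy hy'
    apply hss'
    ext k
    rw [gridCell_index_eq (hy k).2, gridCell_index_eq (hy' k).2]
  -- The coordinate of the finest level alone gives the bound.
  have hBcq : ∀ j s, expCount P I (Bc j s) n ≤ V / 2 ^ (Finset.univ.sup j) := fun j s => by
    obtain ⟨k, -, hk⟩ := Finset.exists_mem_eq_sup Finset.univ Finset.univ_nonempty j
    rw [hk]
    refine le_trans (expCount_mono P (B := {y | y ∈ box coord R ∧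
      coord y k ∈ gridCell (ρ k) V (j k) (s k)}) (fun y hy => ⟨hBcsub j s hy, (hy k).2⟩) n) ?_
    rw [← margMeasure_real h.meas_cov hcoord (ordConnected_gridCell hV0 _ _).measurableSet]
    exact (measureReal_mono (gridCell_subset_gridSlab hV0 _ _)).trans
      (measureReal_gridSlab_le hV0 _ _)
  -- slabs
  set Bs : ℕ → ι → Fin (2 ^ J) → Set E := fun i k s =>
    box coord (Function.update R k (R k ∩ gridSlab (ρ k) V i s)) with hBs
  have hBsLag : ∀ i k s, LagBound P n d I ε C (Bs i k s) := fun i k s => by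
    refine hbox _ fun k' => ?_
    by_cases hk : k' = k
    · subst hk; rw [Function.update_self]; exact (hR k').inter (ordConnected_gridSlab hV0 _ _)
    · rw [Function.update_of_ne hk]; exact hR k'
  have hBssub : ∀ i k s, Bs i k s ⊆ box coord R := fun i k s y hy => (mem_box_update.1 hy).1
  have hBsdisj : ∀ i k, Pairwise (Function.onFun Disjoint (Bs i k)) := fun i k s s' hss' => by
    rw [Function.onFun, Set.disjoint_left]
    intro y hy hy'
    apply hss'
    ext
    rw [← (mem_box_update.1 hy).2.1, ← (mem_box_update.1 hy').2.1]
  have hBsq : ∀ i k s, expCount P I (Bs i k s) n ≤ V / 2 ^ i := fun i k s => by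
    refine le_trans (expCount_mono P (B := {y | y ∈ box coord R ∧
      coord y k ∈ gridSlab (ρ k) V i s}) (fun y hy => mem_box_update.1 hy) n) ?_
    rw [← margMeasure_real h.meas_cov hcoord (ordConnected_gridSlab hV0 _ _).measurableSet]
    exact measureReal_gridSlab_le hV0 _ _
  have : Nonempty (Fin (2 ^ J)) := ⟨⟨0, by positivity⟩⟩
  set lay : ℕ → ℝ → ℝ := fun i => layer (if i = J then -1 else τ i) (τ (i - 1)) with hlay
  set Wc : (ι → ℕ) → Ω → ℝ := fun j ω =>
    ⨆ s, |hitSum I (Bc j s) (fun t ω => trunc (τ (Finset.univ.sup j)) (ε t ω)) n ω| with hWc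
  set Ws : ℕ → ι → Ω → ℝ := fun i k ω =>
    ⨆ s, |hitSum I (Bs i k s) (fun t ω => lay i (ε t ω)) n ω| with hWs
  set W0 : Ω → ℝ := fun ω => ∑ t ∈ Finset.Icc 1 n,
    hit I (box coord R) t ω * (if τ 0 < |ε t ω| then |ε t ω| else 0) with hW0
  set K := levelConst d v C + v * driftConst d C with hK
  have hL0 := levelConst_nonneg (d := d) hv hC
  have hD0 := driftConst_nonneg (d := d) hC
  -- The drift caused by truncating at `τ r` is of order `√V decay ^ (2 r)`, hence summable over the
  -- levels.
  have hdrift : ∀ r, 1 / τ r * v * (driftConst d C * (V * decay ^ (4 * r))) ≤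
      v * driftConst d C * (√V * decay ^ r) := fun r => by
    have e1 : 1 / τ r * v * (driftConst d C * (V * decay ^ (4 * r))) =
        v * driftConst d C * (√V * decay ^ (2 * r)) := by
      have := (hτpos r).ne'
      field_simp
      rw [hτ, show 4 * r = 2 * r + 2 * r by ring, pow_add]
      linear_combination (-(v * driftConst d C * decay ^ (2 * r) * decay ^ (2 * r))) * hsq
    rw [e1]
    have : decay ^ (2 * r) ≤ decay ^ r :=
      pow_le_pow_of_le_one hw.le decay_lt_one.le (by omega)
    gcongr
  have hc : ∀ j ∈ Fintype.piFinset fun _ : ι => Finset.range J,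
      Integrable (Wc j) P ∧ ∫ ω, Wc j ω ∂P ≤ K * √V * decay ^ (Finset.univ.sup j) := by
    intro j hj
    set r := Finset.univ.sup j with hr
    have hrJ : r ≤ J := Finset.sup_le fun k _ =>
      (Finset.mem_range.1 (Fintype.mem_piFinset.1 hj k)).le
    obtain ⟨a1, a2⟩ := h.integral_iSup_level_le hd (hpow r hrJ) (measurable_trunc (τ r))
      (fun x => (abs_trunc_le (hτpos r).le x).trans (by have := hτpos r; simp only [hτ] at this ⊢; linarith))
      (abs_trunc_le_abs _) (by have := hτpos r; positivity) le_rfl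
      (abs_trunc_sub_le (hτpos r)) hC (hBcLag j)
      ((sum_expCount_le h.meas_cov (fun s => (hBcLag j s).meas) (hBcdisj j) (hBcsub j) n).trans
        hV.le) (hBcq j)
    refine ⟨a1, a2.trans ?_⟩
    rw [add_zero]
    have := hdrift r
    rw [hK]
    linarith
  have hs : ∀ i ∈ Finset.Icc 1 J, ∀ k, Integrable (Ws i k) P ∧ ∫ ω, Ws i k ω ∂P ≤
      (if i = J then (levelConst d v C + 2 * (v + 1) * driftConst d C) * √V else 0) +
        K * √V * decay ^ i := by
    intro i hi k
    rw [Finset.mem_Icc] at hi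
    have hbound : ∀ x, |lay i x| ≤ 2 * (√V * decay ^ (2 * i)) := fun x => by
      refine (abs_layer_le (hτpos _).le x).trans ?_
      have e1 : √V * decay ^ (2 * i) = τ (i - 1) * decay ^ 2 := by
        simp only [hτ]
        rw [mul_assoc, ← pow_add]
        congr 2; omega
      rw [e1]
      have := one_le_two_mul_decay_sq
      nlinarith [hτpos (i - 1)]
    have hsum := (sum_expCount_le h.meas_cov (fun s => (hBsLag i k s).meas) (hBsdisj i k)
      (hBssub i k) n).trans hV.le
    -- At the last level the drift bound is `γ = δ = 1`. It is affordable because `V decay ^ (4 J) =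
    -- V / 2 ^ (J/2)` and `V < 2 ^ (J + 1)`.
    by_cases hiJ : i = J
    · obtain ⟨a1, a2⟩ := h.integral_iSup_level_le hd (hpow i hi.2) (measurable_layer _ _)
        hbound (abs_layer_le_abs _ _) zero_le_one zero_le_one (abs_layer_sub_le' _ _) hC
        (hBsLag i k) hsum (hBsq i k)
      refine ⟨a1, a2.trans ?_⟩
      rw [if_pos hiJ]
      have b1 : V * decay ^ (4 * i) ≤ 2 * √V := by
        refine le_of_sq_le_sq ?_ (by positivity)
        have : (V * decay ^ (4 * i)) ^ 2 = V * V / 2 ^ i := by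
          rw [mul_pow, ← pow_mul, show 4 * i * 2 = 8 * i by ring, decay_pow_eight_mul]; ring
        rw [this, div_le_iff₀ (by positivity), mul_pow, Real.sq_sqrt hV0.le]
        rw [← hiJ, pow_succ] at hJ2
        nlinarith
      have b2 : √V * decay ^ i ≤ √V :=
        mul_le_of_le_one_right hsV.le (pow_le_one₀ hw.le decay_lt_one.le)
      have b3 : 0 ≤ K * √V * decay ^ i := by positivity
      have b4 := mul_le_mul_of_nonneg_left b1 (by positivity : 0 ≤ (v + 1) * driftConst d C)
      have b5 := mul_le_mul_of_nonneg_left b2 hL0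
      linarith
    · have hpos := hτpos i
      obtain ⟨a1, a2⟩ := h.integral_iSup_level_le hd (hpow i hi.2) (measurable_layer _ _)
        hbound (abs_layer_le_abs _ _) (β := 0) (γ := 1 / τ i) (δ := 0) (by positivity) le_rfl
        (fun x => by
          simp only [if_neg hiJ]
          exact abs_layer_sub_le hpos _ x) hC
        (hBsLag i k) hsum (hBsq i k)
      refine ⟨a1, a2.trans ?_⟩
      rw [if_neg hiJ, add_zero, zero_add]
      have := hdrift i
      rw [hK]
      linarith
  obtain ⟨h01, h02⟩ := h.integral_large_le (hbox R hR).meas (hτpos 0)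
  have iC : Integrable (fun ω => ∑ j ∈ Fintype.piFinset fun _ : ι => Finset.range J, Wc j ω) P :=
    integrable_finsetSum _ fun j hj => (hc j hj).1
  have iS : Integrable (fun ω => ∑ i ∈ Finset.Icc 1 J, ∑ k, Ws i k ω) P :=
    integrable_finsetSum _ fun i hi => integrable_finsetSum _ fun k _ => (hs i hi k).1
  refine ⟨fun ω => ∑ j ∈ Fintype.piFinset (fun _ : ι => Finset.range J), Wc j ω +
    ∑ i ∈ Finset.Icc 1 J, ∑ k, Ws i k ω + W0 ω, (iC.add iS).add h01, fun ω e => ?_, ?_⟩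
  · have hidx : ∀ k, ∀ r ≤ J, gridIdx (ρ k) V r (e k) < 2 ^ J := fun k r hr =>
      (gridIdx_lt (hρV k) r _).trans_le (Nat.pow_le_pow_right two_pos hr)
    set q : ℕ → (ι → ℕ) → ℝ := fun t j =>
      if ∀ k, coord (I t ω) k ∈ gridCell (ρ k) V (j k) (gridIdx (ρ k) V (j k + 1) (e k))
          then trunc (τ (Finset.univ.sup j)) (ε t ω) else 0 with hq
    set p : ℕ → ℕ → ι → ℝ := fun t i k =>
      if coord (I t ω) k ∈ gridSlab (ρ k) V i (gridIdx (ρ k) V i (e k))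
        then lay i (ε t ω) else 0 with hp
    have main : ∀ t, |(if ∀ k, coord (I t ω) k < e k then ε t ω else 0) -
        ∑ j ∈ Fintype.piFinset fun _ : ι => Finset.range J, q t j| ≤
        (if τ 0 < |ε t ω| then |ε t ω| else 0) + ∑ i ∈ Finset.Icc 1 J, ∑ k, p t i k :=
      fun t => abs_chaining_le hρV hτanti hJ (ε t ω) (coord (I t ω)) e
    -- For given levels the vertex `e` selects one product of cells; passing to the supremum over
    -- all of them removes the dependence on `e`.
    have hcell : ∀ j ∈ Fintype.piFinset fun _ : ι => Finset.range J,
        |∑ t ∈ Finset.Icc 1 n, hit I (box coord R) t ω * q t j| ≤ Wc j ω := fun j hj => by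
      set s : ι → Fin (2 ^ J) := fun k => ⟨gridIdx (ρ k) V (j k + 1) (e k), hidx k _
        (Finset.mem_range.1 (Fintype.mem_piFinset.1 hj k))⟩ with hs'
      refine le_trans (le_of_eq ?_) (le_ciSup (Set.finite_range _).bddAbove s)
      unfold hitSum
      congr 1
      refine Finset.sum_congr rfl fun t _ => ?_
      have hm : I t ω ∈ Bc j s ↔ I t ω ∈ box coord R ∧
          ∀ k, coord (I t ω) k ∈ gridCell (ρ k) V (j k) (gridIdx (ρ k) V (j k + 1) (e k)) :=
        forall_and (p := fun k => coord (I t ω) k ∈ R k)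
      exact hit_mul_ite hm _
    have hslab : ∀ i ∈ Finset.Icc 1 J, ∀ k,
        ∑ t ∈ Finset.Icc 1 n, hit I (box coord R) t ω * p t i k ≤ Ws i k ω := fun i hi k => by
      set s : Fin (2 ^ J) := ⟨gridIdx (ρ k) V i (e k), hidx k _ (Finset.mem_Icc.1 hi).2⟩ with hs'
      refine le_trans (le_trans (le_of_eq ?_) (le_abs_self _))
        (le_ciSup (f := fun s => |hitSum I (Bs i k s) (fun t ω => lay i (ε t ω)) n ω|)
          (Set.finite_range _).bddAbove s)
      unfold hitSum
      refine Finset.sum_congr rfl fun t _ => ?_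
      have hm : I t ω ∈ Bs i k s ↔ I t ω ∈ box coord R ∧
        coord (I t ω) k ∈ gridSlab (ρ k) V i (gridIdx (ρ k) V i (e k)) := mem_box_update
      exact hit_mul_ite hm _
    have hdec : ∑ t ∈ Finset.Icc 1 n, hit I (box coord R) t ω *
        (if ∀ k, coord (I t ω) k < e k then ε t ω else 0) =
        ∑ j ∈ Fintype.piFinset fun _ : ι => Finset.range J,
          ∑ t ∈ Finset.Icc 1 n, hit I (box coord R) t ω * q t j +
        ∑ t ∈ Finset.Icc 1 n, hit I (box coord R) t ω *
          ((if ∀ k, coord (I t ω) k < e k then ε t ω else 0) -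
            ∑ j ∈ Fintype.piFinset fun _ : ι => Finset.range J, q t j) := by
      rw [Finset.sum_comm, ← Finset.sum_add_distrib]
      refine Finset.sum_congr rfl fun t _ => ?_
      rw [← Finset.mul_sum]; ring
    rw [hdec]
    have b1 : |∑ j ∈ Fintype.piFinset fun _ : ι => Finset.range J,
          ∑ t ∈ Finset.Icc 1 n, hit I (box coord R) t ω * q t j| ≤
        ∑ j ∈ Fintype.piFinset fun _ : ι => Finset.range J, Wc j ω :=
      (Finset.abs_sum_le_sum_abs _ _).trans (Finset.sum_le_sum hcell)
    have b2 : |∑ t ∈ Finset.Icc 1 n, hit I (box coord R) t ω *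
          ((if ∀ k, coord (I t ω) k < e k then ε t ω else 0) -
            ∑ j ∈ Fintype.piFinset fun _ : ι => Finset.range J, q t j)| ≤
        ∑ t ∈ Finset.Icc 1 n, hit I (box coord R) t ω *
          ((if τ 0 < |ε t ω| then |ε t ω| else 0) + ∑ i ∈ Finset.Icc 1 J, ∑ k, p t i k) := by
      refine (Finset.abs_sum_le_sum_abs _ _).trans (Finset.sum_le_sum fun t _ => ?_)
      rw [abs_mul, abs_of_nonneg (hit_nonneg _ _ _)]
      exact mul_le_mul_of_nonneg_left (main t) (hit_nonneg _ _ _)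
    have b3 : ∑ t ∈ Finset.Icc 1 n, hit I (box coord R) t ω *
          ((if τ 0 < |ε t ω| then |ε t ω| else 0) + ∑ i ∈ Finset.Icc 1 J, ∑ k, p t i k) =
        W0 ω + ∑ i ∈ Finset.Icc 1 J, ∑ k,
          ∑ t ∈ Finset.Icc 1 n, hit I (box coord R) t ω * p t i k := by
      simp_rw [mul_add, Finset.sum_add_distrib, Finset.mul_sum]
      congr 1
      rw [Finset.sum_comm]
      refine Finset.sum_congr rfl fun i _ => ?_
      rw [Finset.sum_comm]
    have b4 : ∑ i ∈ Finset.Icc 1 J, ∑ k,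
          ∑ t ∈ Finset.Icc 1 n, hit I (box coord R) t ω * p t i k ≤
        ∑ i ∈ Finset.Icc 1 J, ∑ k, Ws i k ω :=
      Finset.sum_le_sum fun i hi => Finset.sum_le_sum fun k _ => hslab i hi k
    refine (abs_add_le _ _).trans ?_
    linarith
  · rw [integral_add_add iC iS h01, integral_finsetSum _ fun j hj => (hc j hj).1,
      integral_finsetSum _ fun i hi => integrable_finsetSum _ fun k _ => (hs i hi k).1]
    have hK0 : 0 ≤ K := by positivity
    have c1 : ∑ j ∈ Fintype.piFinset fun _ : ι => Finset.range J, ∫ ω, Wc j ω ∂P ≤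
        K * chainConst (Fintype.card ι) * √V := by
      refine (Finset.sum_le_sum fun j hj => (hc j hj).2).trans ?_
      rw [← Finset.mul_sum]
      have := mul_le_mul_of_nonneg_left (sum_decay_pow_sup_le (ι := ι) J)
        (by positivity : 0 ≤ K * √V)
      linarith
    have c2 : ∑ i ∈ Finset.Icc 1 J, ∫ ω, ∑ k, Ws i k ω ∂P ≤
        (Fintype.card ι * (K * (1 / (1 - decay))) +
      Fintype.card ι * (levelConst d v C + 2 * (v + 1) * driftConst d C)) * √V := by
      have hgeo : ∑ i ∈ Finset.Icc 1 J, decay ^ i ≤ 1 / (1 - decay) := by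
        rw [one_div, ← tsum_geometric_of_lt_one hw.le decay_lt_one]
        exact (summable_geometric_of_lt_one hw.le decay_lt_one).sum_le_tsum _
          fun i _ => by positivity
      calc _ ≤ ∑ i ∈ Finset.Icc 1 J, Fintype.card ι *
            ((if i = J then (levelConst d v C + 2 * (v + 1) * driftConst d C) * √V else 0) +
              K * √V * decay ^ i) := by
            refine Finset.sum_le_sum fun i hi => ?_
            rw [integral_finsetSum _ fun k _ => (hs i hi k).1]
            refine (Finset.sum_le_sum fun k _ => (hs i hi k).2).trans (le_of_eq ?_)
            rw [Finset.sum_const, Finset.card_univ, nsmul_eq_mul]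
        _ = Fintype.card ι * ((levelConst d v C + 2 * (v + 1) * driftConst d C) * √V +
              K * √V * ∑ i ∈ Finset.Icc 1 J, decay ^ i) := by
            rw [← Finset.mul_sum, Finset.sum_add_distrib, ← Finset.mul_sum,
              Finset.sum_ite_eq' , if_pos (Finset.mem_Icc.2 ⟨hJ, le_rfl⟩)]
        _ ≤ Fintype.card ι * ((levelConst d v C + 2 * (v + 1) * driftConst d C) * √V +
              K * √V * (1 / (1 - decay))) := by gcongr
        _ = _ := by ring
    have c3 : ∫ ω, W0 ω ∂P ≤ v * √V := by
      refine h02.trans ?_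
      have : τ 0 = √V := by simp [hτ]
      rw [this, div_le_iff₀ hsV, mul_assoc, hsq]
      exact mul_le_mul_of_nonneg_left hV.le hv
    unfold maxConst
    rw [← hK]
    linarith

end Maximal


/-! ### From orthants to closed rectangles. -/

section Rectangles

-- Inclusion–exclusion over the corners, two per coordinate.
open Classical in
lemma abs_sum_rectangle_le {ι : Type*} [Fintype ι] {s : Finset ℕ} {z : ℕ → ι → ℝ} {x : ℕ → ℝ}
    {w : ℝ} (h : ∀ e : ι → ℝ, |∑ t ∈ s, if ∀ k, z t k < e k then x t else 0| ≤ w)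
    (a b : ι → ℝ) :
    |∑ t ∈ s, if ∀ k, a k ≤ z t k ∧ z t k ≤ b k then x t else 0| ≤
      2 ^ Fintype.card ι * w := by
  -- The orthants are open above, so `b` is raised slightly without passing any sample coordinate.
  have hb : ∀ k, ∃ b' > b k, ∀ t ∈ s, z t k ≤ b k ∨ b' ≤ z t k := fun k => by
    have h1 : ∀ᶠ b' in nhdsWithin (b k) (Set.Ioi (b k)), ∀ t ∈ s, z t k ≤ b k ∨ b' ≤ z t k := by
      rw [Filter.eventually_all_finset]
      intro t _
      rcases le_or_gt (z t k) (b k) with h | h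
      · exact Eventually.of_forall fun _ => Or.inl h
      · filter_upwards [Ioo_mem_nhdsGT h] with b' hb'
        exact Or.inr hb'.2.le
    obtain ⟨b', h2, h3⟩ := (h1.and self_mem_nhdsWithin).exists
    exact ⟨b', h3, h2⟩
  choose b' hb1 hb2 using hb
  -- The minimum keeps the two half-lines nested, so their difference is empty, not negative, when
  -- `a k > b' k`.
  set e : (ι → Bool) → ι → ℝ := fun c k => if c k then b' k else min (a k) (b' k) with he
  set sg : Bool → ℝ := fun c => if c then 1 else -1 with hsg
  have key : ∀ t ∈ s, (if ∀ k, a k ≤ z t k ∧ z t k ≤ b k then x t else 0) =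
      ∑ c : ι → Bool, (∏ k, sg (c k)) * (if ∀ k, z t k < e c k then x t else 0) := fun t ht => by
    have h1 : ∀ k, (if a k ≤ z t k ∧ z t k ≤ b k then (1 : ℝ) else 0) =
        ∑ c : Bool, sg c * (if z t k < (if c then b' k else min (a k) (b' k)) then 1 else 0) := by
      intro k
      have h2 : z t k ≤ b k ↔ z t k < b' k :=
        ⟨fun h => h.trans_lt (hb1 k), fun h => (hb2 k t ht).resolve_right (not_le.2 h)⟩
      simp only [Fintype.sum_bool, hsg, h2, if_true]
      by_cases p : z t k < b' k <;> by_cases q : a k ≤ z t k <;> simp [p, q, not_lt.2, not_le.1]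
    have h3 : (if ∀ k, a k ≤ z t k ∧ z t k ≤ b k then x t else 0) =
        (∏ k, if a k ≤ z t k ∧ z t k ≤ b k then (1 : ℝ) else 0) * x t := by
      rw [Finset.prod_boole]; simp
    rw [h3, Finset.prod_congr rfl fun k _ => h1 k, Finset.prod_univ_sum, Fintype.piFinset_univ,
      Finset.sum_mul]
    refine Finset.sum_congr rfl fun c _ => ?_
    rw [Finset.prod_mul_distrib, mul_assoc, Finset.prod_boole]
    simp only [he, Finset.mem_univ, true_implies, ite_mul, one_mul, zero_mul]
  rw [Finset.sum_congr rfl key, Finset.sum_comm]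
  refine (Finset.abs_sum_le_sum_abs _ _).trans ?_
  calc _ ≤ ∑ c : ι → Bool, w := by
        refine Finset.sum_le_sum fun c _ => ?_
        rw [← Finset.mul_sum, abs_mul, Finset.abs_prod]
        have : ∏ k, |sg (c k)| = 1 := Finset.prod_eq_one fun k _ => by
          simp only [hsg]; split_ifs <;> simp
        rw [this, one_mul]
        exact h (e c)
    _ = _ := by simp

variable {Ω : Type*} [MeasurableSpace Ω] {d₁ d₂ : ℕ}

/-- All coordinates of a covariate value, as real numbers. -/
def coords (y : Covariate d₁ d₂) : Fin d₁ ⊕ Fin d₂ → ℝ := Sum.elim (fun i => (y.1 i : ℝ)) y.2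

lemma measurable_coords (k : Fin d₁ ⊕ Fin d₂) :
    Measurable fun y : Covariate d₁ d₂ => coords y k := by
  rcases k with i | j
  · exact (measurable_from_top (f := fun m : ℕ => (m : ℝ))).comp
      ((measurable_pi_apply i).comp measurable_fst)
  · exact (measurable_pi_apply j).comp measurable_snd

lemma le_iff_coords_le (a b : Covariate d₁ d₂) : a ≤ b ↔ ∀ k, coords a k ≤ coords b k := by
  rw [Prod.le_def, Pi.le_def, Pi.le_def, Sum.forall]
  simp [coords]

lemma isHyperrectangle_box {T : Fin d₁ ⊕ Fin d₂ → Set ℝ} (hT : ∀ k, (T k).OrdConnected) :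
    IsHyperrectangle (box (coords (d₁ := d₁) (d₂ := d₂)) T) := by
  refine ⟨fun i => {m | (m : ℝ) ∈ T (Sum.inl i)}, fun j => T (Sum.inr j), fun i => ?_,
    fun j => hT _, ?_⟩
  · exact ⟨fun x hx y hy z hz => (hT (Sum.inl i)).out hx hy
      ⟨by exact_mod_cast hz.1, by exact_mod_cast hz.2⟩⟩
  · ext y
    simp [box, coords]

lemma measurableSet_box {T : Fin d₁ ⊕ Fin d₂ → Set ℝ} (hT : ∀ k, (T k).OrdConnected) :
    MeasurableSet (box (coords (d₁ := d₁) (d₂ := d₂)) T) := by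
  have : box (coords (d₁ := d₁) (d₂ := d₂)) T = ⋂ k, (fun y => coords y k) ⁻¹' T k := by
    ext y; simp [box]
  rw [this]
  exact MeasurableSet.iInter fun k => measurable_coords k (hT k).measurableSet

/-- The set of covariate values whose continuous components lie in given sets. -/
def slice (d₁ : ℕ) {d₂ : ℕ} (T : Fin d₂ → Set ℝ) : Set (Covariate d₁ d₂) :=
  {y | ∀ j, y.2 j ∈ T j}

open Classical in
/-- Maximal inequality for sums of errors over closed hyperrectangles. -/
theorem exists_rectangle_bound {P : Measure Ω} [IsProbabilityMeasure P] (hd : 0 < d₁ + d₂)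
    {D : Set (Covariate d₁ d₂)} {f : Covariate d₁ d₂ → ℝ}
    {I : ℕ → ℕ → Ω → Covariate d₁ d₂} {ε : ℕ → ℕ → Ω → ℝ}
    (hI : ∀ n t, Measurable (I n t)) (hε : ∀ n t, Measurable (ε n t))
    {Q : Fin d₂ → Measure ℝ} (hA2 : AssumptionA2 P D f I ε) (hA3 : AssumptionA3 P Q I ε) :
    ∃ K : ℝ, 0 ≤ K ∧ ∀ (n : ℕ) (T : Fin d₂ → Set ℝ), (∀ j, (T j).OrdConnected) → ∀ V : ℝ, 2 ≤ V →
      expCount P (I n) (slice d₁ T) n < V →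
      ∃ W : Ω → ℝ, Integrable W P ∧
        (∀ ω (a b : Covariate d₁ d₂), |∑ t ∈ (Finset.Icc 1 n).filter
          (fun t => I n t ω ∈ slice d₁ T ∧ I n t ω ∈ Set.Icc a b), ε n t ω| ≤ W ω) ∧
        ∫ ω, W ω ∂P ≤ K * √V := by
  obtain ⟨σsq, hσ⟩ := hA2.condExp_sq_le
  obtain ⟨C₃, hC₃⟩ := hA3.condProb_le
  set v := max σsq 0
  set C := max C₃ 0
  have hv : 0 ≤ v := le_max_right _ _
  have hC : 0 ≤ C := le_max_right _ _
  set ι := Fin d₁ ⊕ Fin d₂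
  have hne : Nonempty ι := by
    rw [← Fintype.card_pos_iff]; simpa [ι] using hd
  have h2 : (0 : ℝ) ≤ 2 ^ Fintype.card ι := by positivity
  refine ⟨2 ^ Fintype.card ι * maxConst (Fintype.card ι) (d₁ + d₂) v C,
    mul_nonneg h2 (maxConst_nonneg _ _ hv hC), fun n T hT V hV2 hV => ?_⟩
  have model : ErrorModel P n (I n) (ε n) v :=
    ⟨hI n, hε n, hv, hA2.memLp n, hA2.condExp_eq_zero n, fun t h1 h2 => by
      filter_upwards [hσ n t h1 h2] with ω hω
      exact hω.trans (le_max_left _ _)⟩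
  have hbox : ∀ U : ι → Set ℝ, (∀ k, (U k).OrdConnected) →
      LagBound P n (d₁ + d₂) (I n) (ε n) C (box coords U) := fun U hU =>
    LagBound.of_condExp (hI n) (hε n) hC (measurableSet_box hU) fun t h1 h2 => by
      filter_upwards [hC₃ n t h1 h2 _ (isHyperrectangle_box hU)] with ω hω
      exact hω.trans (mul_le_mul_of_nonneg_right (le_max_left _ _) measureReal_nonneg)
  -- Discrete coordinates are left unrestricted, so the bound depends only on the continuous slice.
  set R : ι → Set ℝ := Sum.elim (fun _ => Set.univ) T with hR
  have hRoc : ∀ k, (R k).OrdConnected := by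
    rintro (i | j)
    · exact Set.ordConnected_univ
    · exact hT j
  have hRbox : box coords R = slice d₁ T := by
    ext y
    simp [box, slice, coords, hR]
  obtain ⟨W, hW1, hW2, hW3⟩ := model.exists_orthant_bound (by omega) hC measurable_coords hbox hRoc
    hV2 (by rw [hRbox]; exact hV)
  refine ⟨fun ω => 2 ^ Fintype.card ι * W ω, hW1.const_mul _, fun ω a b => ?_, ?_⟩
  · have hsum : ∀ (p : ℕ → Prop) [DecidablePred p],
        ∑ t ∈ Finset.Icc 1 n, hit (I n) (box coords R) t ω * (if p t then ε n t ω else 0) =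
        ∑ t ∈ (Finset.Icc 1 n).filter (fun t => I n t ω ∈ slice d₁ T),
          if p t then ε n t ω else 0 := fun p _ => by
      rw [Finset.sum_filter]
      refine Finset.sum_congr rfl fun t _ => ?_
      rw [hRbox]
      simp only [hit, Set.indicator, Set.mem_preimage]
      split_ifs <;> simp
    have := abs_sum_rectangle_le (s := (Finset.Icc 1 n).filter (fun t => I n t ω ∈ slice d₁ T))
      (z := fun t => coords (I n t ω)) (x := fun t => ε n t ω) (w := W ω)
      (fun e => by rw [← hsum fun t => ∀ k, coords (I n t ω) k < e k]; convert hW2 ω e) (coords a) (coords b)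
    refine le_trans (le_of_eq ?_) this
    congr 1
    rw [← Finset.filter_filter, Finset.sum_filter]
    refine Finset.sum_congr rfl fun t _ => ?_
    refine if_congr ?_ rfl rfl
    rw [Set.mem_Icc, le_iff_coords_le, le_iff_coords_le, ← forall_and]
  · rw [integral_const_mul, mul_assoc]
    exact mul_le_mul_of_nonneg_left hW3 h2

end Rectangles


/-! ### Deterministic bounds for the two envelopes on a cell. -/

section Pathwise

variable {d₁ d₂ n : ℕ} {I : ℕ → Covariate d₁ d₂} {Y ε : ℕ → ℝ}

lemma abs_avg_le (B : Set (Covariate d₁ d₂)) :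
    |avg n I Y B| ≤ ∑ t ∈ Finset.Icc 1 n, |Y t| := by
  classical
  unfold avg
  have h0 : 0 ≤ ∑ t ∈ Finset.Icc 1 n, |Y t| := Finset.sum_nonneg fun _ _ => abs_nonneg _
  have h1 : |∑ t ∈ (Finset.Icc 1 n).filter (fun t => I t ∈ B), Y t| ≤
      ∑ t ∈ Finset.Icc 1 n, |Y t| :=
    (Finset.abs_sum_le_sum_abs _ _).trans
      (Finset.sum_le_sum_of_subset_of_nonneg (Finset.filter_subset _ _) fun _ _ _ => abs_nonneg _)
  rw [abs_div, Nat.abs_cast]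
  rcases Nat.eq_zero_or_pos (obsCount n I B) with h | h
  · simp [h, h0]
  · have : (1 : ℝ) ≤ obsCount n I B := by exact_mod_cast h
    refine (div_le_self (abs_nonneg _) this).trans ?_
    convert h1

/-- The infimum is at most its value at the single corner `b`. All averages are bounded by `∑ |Y
t|`, which keeps the real `⨆` and `⨅` away from their default values. -/
lemma upperEst_le {D : Set (Covariate d₁ d₂)} {x b : Covariate d₁ d₂} (hx : x ∈ D) (hb : b ∈ D)
    (hxb : x ≤ b) {u : ℝ} (h : ∀ a ∈ D, a ≤ x → avg n I Y (Set.Icc a b) ≤ u) :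
    upperEst D n I Y x ≤ u := by
  have : Nonempty {a : Covariate d₁ d₂ // a ∈ D ∧ a ≤ x} := ⟨⟨x, hx, le_rfl⟩⟩
  have bdd : ∀ b : Covariate d₁ d₂, BddAbove (Set.range fun a : {a : Covariate d₁ d₂ // a ∈ D ∧
      a ≤ x} => avg n I Y (Set.Icc a.1 b)) := fun b => by
    refine ⟨∑ t ∈ Finset.Icc 1 n, |Y t|, ?_⟩
    rintro _ ⟨a, rfl⟩
    exact le_of_abs_le (abs_avg_le _)
  refine (ciInf_le ?_ (⟨b, hb, hxb⟩ : {b : Covariate d₁ d₂ // b ∈ D ∧ x ≤ b})).trans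
    (ciSup_le fun a => h a.1 a.2.1 a.2.2)
  refine ⟨-∑ t ∈ Finset.Icc 1 n, |Y t|, ?_⟩
  rintro _ ⟨b, rfl⟩
  exact (neg_le_of_abs_le (abs_avg_le _)).trans
    (le_ciSup (bdd b.1) (⟨x, hx, le_rfl⟩ : {a : Covariate d₁ d₂ // a ∈ D ∧ a ≤ x}))

lemma le_lowerEst {D : Set (Covariate d₁ d₂)} {x a : Covariate d₁ d₂} (hx : x ∈ D) (ha : a ∈ D)
    (hxa : a ≤ x) {u : ℝ} (h : ∀ b ∈ D, x ≤ b → u ≤ avg n I Y (Set.Icc a b)) :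
    u ≤ lowerEst D n I Y x := by
  have : Nonempty {b : Covariate d₁ d₂ // b ∈ D ∧ x ≤ b} := ⟨⟨x, hx, le_rfl⟩⟩
  have bdd : ∀ a : Covariate d₁ d₂, BddBelow (Set.range fun b : {b : Covariate d₁ d₂ // b ∈ D ∧
      x ≤ b} => avg n I Y (Set.Icc a b.1)) := fun a => by
    refine ⟨-∑ t ∈ Finset.Icc 1 n, |Y t|, ?_⟩
    rintro _ ⟨b, rfl⟩
    exact neg_le_of_abs_le (abs_avg_le _)
  refine (le_ciInf fun b : {b : Covariate d₁ d₂ // b ∈ D ∧ x ≤ b} => h b.1 b.2.1 b.2.2).trans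
    (le_ciSup (f := fun a : {a : Covariate d₁ d₂ // a ∈ D ∧ a ≤ x} =>
      ⨅ b : {b : Covariate d₁ d₂ // b ∈ D ∧ x ≤ b}, avg n I Y (Set.Icc a.1 b.1))
      ?_ ⟨a, ha, hxa⟩)
  refine ⟨∑ t ∈ Finset.Icc 1 n, |Y t|, ?_⟩
  rintro _ ⟨a, rfl⟩
  exact (ciInf_le (bdd a.1) (⟨x, hx, le_rfl⟩ : {b : Covariate d₁ d₂ // b ∈ D ∧ x ≤ b})).trans
    (le_of_abs_le (abs_avg_le _))

lemma avg_le_add {f : Covariate d₁ d₂ → ℝ} (hY : ∀ t, Y t = f (I t) + ε t)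
    {B : Set (Covariate d₁ d₂)} [DecidablePred fun t => I t ∈ B] {N c w : ℝ} (hN : 0 < N) (hcount : N ≤ obsCount n I B)
    (hf : ∀ t ∈ Finset.Icc 1 n, I t ∈ B → f (I t) ≤ c)
    (hw : |∑ t ∈ (Finset.Icc 1 n).filter (fun t => I t ∈ B), ε t| ≤ w) :
    avg n I Y B ≤ c + w / N := by
  have hpos : (0 : ℝ) < obsCount n I B := hN.trans_le hcount
  have hw0 : 0 ≤ w := (abs_nonneg _).trans hw
  unfold avg
  simp_rw [hY, Finset.sum_add_distrib]
  rw [add_div]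
  refine add_le_add ?_ ?_
  · rw [div_le_iff₀ hpos, mul_comm]
    unfold obsCount
    rw [← nsmul_eq_mul]
    refine Finset.sum_le_card_nsmul _ _ _ fun t ht => ?_
    simp only [Finset.mem_filter] at ht
    exact hf t ht.1 ht.2
  · refine (div_le_div_of_nonneg_right ((le_abs_self _).trans ?_) hpos.le).trans
      (div_le_div_of_nonneg_left hw0 hN hcount)
    exact le_of_eq_of_le (by congr!) hw

lemma sub_le_avg {f : Covariate d₁ d₂ → ℝ} (hY : ∀ t, Y t = f (I t) + ε t)
    {B : Set (Covariate d₁ d₂)} [DecidablePred fun t => I t ∈ B] {N c w : ℝ} (hN : 0 < N) (hcount : N ≤ obsCount n I B)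
    (hf : ∀ t ∈ Finset.Icc 1 n, I t ∈ B → c ≤ f (I t))
    (hw : |∑ t ∈ (Finset.Icc 1 n).filter (fun t => I t ∈ B), ε t| ≤ w) :
    c - w / N ≤ avg n I Y B := by
  have h := avg_le_add (Y := fun t => -Y t) (ε := fun t => -ε t) (f := fun y => -f y)
    (fun t => by rw [hY]; ring) (c := -c) hN hcount (fun t h1 h2 => neg_le_neg (hf t h1 h2))
    (w := w) (by rwa [Finset.sum_neg_distrib, abs_neg])
  have e : avg n I (fun t => -Y t) B = -avg n I Y B := by
    unfold avg; rw [Finset.sum_neg_distrib, neg_div]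
  rw [e] at h
  linarith

/-- The grid line `θ` may be infinite or outside `J`. The largest of `x` and the sample coordinates
below the line is an admissible corner that catches the same observations. -/
lemma exists_upper_corner {J : Set ℝ} {x : ℝ} (hx : x ∈ J) {θ : EReal} (hxθ : (x : EReal) ≤ θ)
    {s : Finset ℕ} {z : ℕ → ℝ} (hz : ∀ t ∈ s, z t ∈ J) :
    ∃ b ∈ J, x ≤ b ∧ (b : EReal) ≤ θ ∧ ∀ t ∈ s, (z t : EReal) ≤ θ → z t ≤ b := by
  classical
  induction s using Finset.induction_on with
  | empty => exact ⟨x, hx, le_rfl, hxθ, by simp⟩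
  | insert a s _ ih =>
    obtain ⟨b, h1, h2, h3, h4⟩ := ih fun t ht => hz t (Finset.mem_insert_of_mem ht)
    by_cases hc : (z a : EReal) ≤ θ ∧ b < z a
    · refine ⟨z a, hz a (Finset.mem_insert_self _ _), h2.trans hc.2.le, hc.1, fun t ht hθ => ?_⟩
      rcases Finset.mem_insert.1 ht with rfl | ht
      · exact le_rfl
      · exact (h4 t ht hθ).trans hc.2.le
    · refine ⟨b, h1, h2, h3, fun t ht hθ => ?_⟩
      rcases Finset.mem_insert.1 ht with rfl | ht
      · by_contra hlt; exact hc ⟨hθ, not_le.1 hlt⟩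
      · exact h4 t ht hθ

lemma exists_lower_corner {J : Set ℝ} {x : ℝ} (hx : x ∈ J) {θ : EReal} (hxθ : θ < (x : EReal))
    {s : Finset ℕ} {z : ℕ → ℝ} (hz : ∀ t ∈ s, z t ∈ J) :
    ∃ a ∈ J, a ≤ x ∧ θ < (a : EReal) ∧ ∀ t ∈ s, θ < (z t : EReal) → a ≤ z t := by
  classical
  induction s using Finset.induction_on with
  | empty => exact ⟨x, hx, le_rfl, hxθ, by simp⟩
  | insert c s _ ih =>
    obtain ⟨b, h1, h2, h3, h4⟩ := ih fun t ht => hz t (Finset.mem_insert_of_mem ht)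
    by_cases hc : θ < (z c : EReal) ∧ z c < b
    · refine ⟨z c, hz c (Finset.mem_insert_self _ _), hc.2.le.trans h2, hc.1, fun t ht hθ => ?_⟩
      rcases Finset.mem_insert.1 ht with rfl | ht
      · exact le_rfl
      · exact hc.2.le.trans (h4 t ht hθ)
    · refine ⟨b, h1, h2, h3, fun t ht hθ => ?_⟩
      rcases Finset.mem_insert.1 ht with rfl | ht
      · by_contra hlt; exact hc ⟨hθ, not_le.1 hlt⟩
      · exact h4 t ht hθ

/-- The covariate values with discrete part `k` whose continuous part lies between grid lines. -/
def gridBox (q : Fin d₂ → ℤ → EReal) (k : Fin d₁ → ℕ) (l u : Fin d₂ → ℤ) :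
    Set (Covariate d₁ d₂) :=
  {y | y.1 = k ∧ ∀ j, q j (l j) < (y.2 j : EReal) ∧ (y.2 j : EReal) ≤ q j (u j)}

/-- The interval between two grid lines. -/
def gridIoc (q : Fin d₂ → ℤ → EReal) (l u : Fin d₂ → ℤ) (j : Fin d₂) : Set ℝ :=
  {z | q j (l j) < (z : EReal) ∧ (z : EReal) ≤ q j (u j)}

variable {q : Fin d₂ → ℤ → EReal} {k : Fin d₁ → ℕ} {M : ℕ} {N₀ : ℝ}

/-- A set containing a block of cells contains many observations. -/
lemma mul_prod_le_obsCount (hq : ∀ j, Monotone (q j))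
    (hcell : ∀ l : Fin d₂ → ℕ, (∀ j, 1 ≤ l j ∧ l j ≤ M) →
      N₀ ≤ obsCount n I (gridBox q k (fun j => (l j : ℤ) - 1) (fun j => l j)))
    {lo m : Fin d₂ → ℕ} (hlo : ∀ j, 1 ≤ lo j) (hm : ∀ j, lo j + m j ≤ M + 1)
    {B : Set (Covariate d₁ d₂)}
    (hB : ∀ t ∈ Finset.Icc 1 n,
      I t ∈ gridBox q k (fun j => (lo j : ℤ) - 1) (fun j => (lo j : ℤ) + m j - 1) → I t ∈ B) :
    N₀ * ∏ j, (m j : ℝ) ≤ obsCount n I B := by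
  classical
  set S := Fintype.piFinset fun j => Finset.Ico (lo j) (lo j + m j) with hS
  have hmem : ∀ l ∈ S, ∀ j, lo j ≤ l j ∧ l j < lo j + m j := fun l hl j =>
    Finset.mem_Ico.1 (Fintype.mem_piFinset.1 hl j)
  have h1 : N₀ * ∏ j, (m j : ℝ) = ∑ l ∈ S, N₀ := by
    rw [Finset.sum_const, nsmul_eq_mul, hS, Fintype.card_piFinset, mul_comm]
    simp
  rw [h1]
  have h2 : ∑ l ∈ S, N₀ ≤ ∑ l ∈ S,
      (obsCount n I (gridBox q k (fun j => (l j : ℤ) - 1) (fun j => l j)) : ℝ) :=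
    Finset.sum_le_sum fun l hl => hcell l fun j => by
      have := hmem l hl j; have := hlo j; have := hm j; omega
  refine h2.trans ?_
  rw [← Nat.cast_sum]
  norm_cast
  unfold obsCount
  rw [← Finset.card_biUnion]
  · refine Finset.card_le_card fun t ht => ?_
    rw [Finset.mem_biUnion] at ht
    obtain ⟨l, hl, ht⟩ := ht
    rw [Finset.mem_filter] at ht ⊢
    refine ⟨ht.1, hB t ht.1 ⟨ht.2.1, fun j => ⟨?_, ?_⟩⟩⟩
    · have h3 : q j ((lo j : ℤ) - 1) ≤ q j ((l j : ℤ) - 1) :=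
        hq j (by have := hmem l hl j; omega)
      exact h3.trans_lt (ht.2.2 j).1
    · have h3 : q j (l j) ≤ q j ((lo j : ℤ) + m j - 1) :=
        hq j (by have := hmem l hl j; omega)
      exact (ht.2.2 j).2.trans h3
  · intro l _ l' _ hne
    rw [Function.onFun, Finset.disjoint_left]
    intro t ht ht'
    rw [Finset.mem_filter] at ht ht'
    apply hne
    funext j
    rcases lt_trichotomy (l j) (l' j) with h | h | h
    · have h3 : q j (l j) ≤ q j ((l' j : ℤ) - 1) := hq j (by omega)
      exact absurd ((ht.2.2 j).2.trans h3) (not_le.2 (ht'.2.2 j).1)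
    · exact h
    · have h3 : q j (l' j) ≤ q j ((l j : ℤ) - 1) := hq j (by omega)
      exact absurd ((ht'.2.2 j).2.trans h3) (not_le.2 (ht.2.2 j).1)

variable {J : Fin d₂ → Set ℝ} {f : Covariate d₁ d₂ → ℝ} {l : Fin d₂ → ℕ} {x : Covariate d₁ d₂}
  {W : (Fin d₂ → ℕ) → ℝ}

/-- The size `p` depends on the competing corner, over which the estimator optimizes; the sum over
all sizes bounds every case at once. -/
lemma div_le_sum_div (hN₀ : 0 < N₀) (hW : ∀ p, 0 ≤ W p) {p : Fin d₂ → ℕ} (hp : ∀ j, p j < M) :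
    W p / (N₀ * ∏ j, ((2 ^ p j : ℕ) : ℝ)) ≤
      ∑ p ∈ Fintype.piFinset fun _ : Fin d₂ => Finset.range M,
        W p / (N₀ * ∏ j, ((2 ^ p j : ℕ) : ℝ)) :=
  Finset.single_le_sum (f := fun p : Fin d₂ → ℕ => W p / (N₀ * ∏ j, ((2 ^ p j : ℕ) : ℝ)))
    (fun p _ => div_nonneg (hW p) (by positivity))
    (Fintype.mem_piFinset.2 fun j => Finset.mem_range.2 (hp j))

open Classical in
/-- Pathwise upper bound for the min-max estimator. -/
lemma upperEst_le_add_sum (hY : ∀ t, Y t = f (I t) + ε t) (hf : MonotoneOn f (domain d₁ J))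
    (hID : ∀ t ∈ Finset.Icc 1 n, I t ∈ domain d₁ J) (hq : ∀ j, Monotone (q j))
    (hq0 : ∀ j (i : ℤ), i ≤ 0 → q j i = ⊥) (hN₀ : 0 < N₀)
    (hcell : ∀ l : Fin d₂ → ℕ, (∀ j, 1 ≤ l j ∧ l j ≤ M) →
      N₀ ≤ obsCount n I (gridBox q k (fun j => (l j : ℤ) - 1) (fun j => l j)))
    (hl : ∀ j, 2 ≤ l j ∧ l j + 1 ≤ M) (hx : x ∈ domain d₁ J)
    (hxl : x ∈ gridBox q k (fun j => (l j : ℤ) - 1) (fun j => l j))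
    (hW : ∀ p (a b : Covariate d₁ d₂), |∑ t ∈ (Finset.Icc 1 n).filter
      (fun t => I t ∈ slice d₁ (gridIoc q (fun j => (l j : ℤ) + 1 - 2 ^ (p j + 1))
        (fun j => (l j : ℤ) + 1)) ∧ I t ∈ Set.Icc a b), ε t| ≤ W p)
    {F : ℝ} (hF : ∀ y ∈ domain d₁ J, y.1 = k → (∀ j, (y.2 j : EReal) ≤ q j ((l j : ℤ) + 1)) →
      f y ≤ F) :
    upperEst (domain d₁ J) n I Y x ≤ F + ∑ p ∈ Fintype.piFinset fun _ : Fin d₂ => Finset.range M,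
        W p / (N₀ * ∏ j, ((2 ^ p j : ℕ) : ℝ)) := by
  have hcorner : ∀ j, ∃ b ∈ J j, x.2 j ≤ b ∧ (b : EReal) ≤ q j ((l j : ℤ) + 1) ∧
      ∀ t ∈ Finset.Icc 1 n, ((I t).2 j : EReal) ≤ q j ((l j : ℤ) + 1) → (I t).2 j ≤ b := fun j =>
    exists_upper_corner (z := fun t => (I t).2 j) (hx j)
      ((hxl.2 j).2.trans (hq j (by beta_reduce; omega))) fun t ht => hID t ht j
  choose b hb1 hb2 hb3 hb4 using hcorner
  have hbD : ((x.1, b) : Covariate d₁ d₂) ∈ domain d₁ J := hb1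
  refine upperEst_le hx hbD ⟨le_rfl, hb2⟩ fun a ha hax => ?_
  -- In direction `j` the rectangle catches all observations in the `2 ^ p j` cells below the line
  -- `l j + 1` and stays within the block of twice that length. The size `2 ^ 0` always qualifies
  -- because `a ≤ x` lies below the line `l j`.
  have hp : ∀ j, ∃ p : ℕ, (a.2 j : EReal) ≤ q j ((l j : ℤ) + 1 - 2 ^ p) ∧
      q j ((l j : ℤ) + 1 - 2 ^ (p + 1)) < (a.2 j : EReal) := fun j => by
    have hbig : ∃ m : ℕ, q j ((l j : ℤ) + 1 - 2 ^ m) < (a.2 j : EReal) := by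
      refine ⟨l j + 1, ?_⟩
      rw [hq0]
      · exact EReal.bot_lt_coe _
      · have : l j + 1 < 2 ^ (l j + 1) := Nat.lt_two_pow_self
        zify at this; linarith
    have h0 : Nat.find hbig ≠ 0 := fun h => by
      have := Nat.find_spec hbig
      rw [h, pow_zero, add_sub_cancel_right] at this
      have h1 : (a.2 j : EReal) ≤ (x.2 j : EReal) := EReal.coe_le_coe_iff.2 (hax.2 j)
      exact absurd (h1.trans (hxl.2 j).2) (not_le.2 this)
    refine ⟨Nat.find hbig - 1, ?_, ?_⟩
    · exact not_lt.1 (Nat.find_min hbig (by omega))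
    · rw [Nat.sub_add_cancel (by omega)]; exact Nat.find_spec hbig
  choose p hp1 hp2 using hp
  -- Lines of nonpositive index are at `-∞`, so the counted cells belong to the grid and the cell
  -- bound applies to them.
  have hpl : ∀ j, 2 ^ p j ≤ l j := fun j => by
    by_contra hc
    have h1 := hp1 j
    rw [hq0 j] at h1
    · exact absurd h1 (not_le.2 (EReal.bot_lt_coe _))
    · have : l j + 1 ≤ 2 ^ p j := by omega
      zify at this; linarith
  have hpM : ∀ j, p j < M := fun j => by
    have h1 : p j < 2 ^ p j := Nat.lt_two_pow_self
    have := hpl j; have := hl j; omega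
  have hW0 : ∀ p, 0 ≤ W p := fun p => (abs_nonneg _).trans (hW p x x)
  refine (avg_le_add (N := N₀ * ∏ j, ((2 ^ p j : ℕ) : ℝ)) (c := F) (w := W p) hY
    (by positivity) ?_ ?_ ?_).trans (add_le_add le_rfl (div_le_sum_div hN₀ hW0 hpM))
  · refine mul_prod_le_obsCount hq hcell (lo := fun j => l j + 2 - 2 ^ p j)
      (fun j => by have := hpl j; omega)
      (fun j => by have := hpl j; have := hl j; omega) fun t ht hIt => ?_
    have hlo : ∀ j, ((l j + 2 - 2 ^ p j : ℕ) : ℤ) = (l j : ℤ) + 2 - 2 ^ p j := fun j => by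
      rw [Nat.cast_sub (by have := hpl j; omega)]; push_cast; ring
    refine ⟨⟨?_, fun j => ?_⟩, ⟨?_, fun j => ?_⟩⟩
    · rw [hIt.1, ← hxl.1]; exact hax.1
    · have h1 := (hIt.2 j).1
      simp only [hlo] at h1
      have h2 : (a.2 j : EReal) ≤ ((I t).2 j : EReal) :=
        (hp1 j).trans ((hq j (by omega)).trans h1.le)
      exact EReal.coe_le_coe_iff.1 h2
    · rw [hIt.1, ← hxl.1]
    · refine hb4 j t ht ((hIt.2 j).2.trans (hq j ?_))
      simp only [hlo]; push_cast; linarith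
  · intro t ht hIt
    refine (hf (hID t ht) hbD hIt.2).trans (hF _ hbD hxl.1 hb3)
  · refine le_trans (le_of_eq ?_) (hW p a (x.1, b))
    congr 1
    refine Finset.sum_congr ?_ fun _ _ => rfl
    ext t
    rw [Finset.mem_filter, Finset.mem_filter]
    refine and_congr_right fun ht => ⟨fun h => ⟨fun j => ⟨?_, ?_⟩, h⟩, fun h => h.2⟩
    · exact (hp2 j).trans_le (EReal.coe_le_coe_iff.2 (h.1.2 j))
    · exact (EReal.coe_le_coe_iff.2 (h.2.2 j)).trans (hb3 j)

open Classical in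
/-- Pathwise lower bound for the max-min estimator. -/
lemma sub_sum_le_lowerEst (hY : ∀ t, Y t = f (I t) + ε t) (hf : MonotoneOn f (domain d₁ J))
    (hID : ∀ t ∈ Finset.Icc 1 n, I t ∈ domain d₁ J) (hq : ∀ j, Monotone (q j))
    (hq1 : ∀ j (i : ℤ), M < i → q j i = ⊤) (hN₀ : 0 < N₀)
    (hcell : ∀ l : Fin d₂ → ℕ, (∀ j, 1 ≤ l j ∧ l j ≤ M) →
      N₀ ≤ obsCount n I (gridBox q k (fun j => (l j : ℤ) - 1) (fun j => l j)))
    (hl : ∀ j, 2 ≤ l j ∧ l j + 1 ≤ M) (hx : x ∈ domain d₁ J)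
    (hxl : x ∈ gridBox q k (fun j => (l j : ℤ) - 1) (fun j => l j))
    (hW : ∀ p (a b : Covariate d₁ d₂), |∑ t ∈ (Finset.Icc 1 n).filter
      (fun t => I t ∈ slice d₁ (gridIoc q (fun j => (l j : ℤ) - 2)
        (fun j => (l j : ℤ) - 2 + 2 ^ (p j + 1))) ∧ I t ∈ Set.Icc a b), ε t| ≤ W p)
    {F : ℝ} (hF : ∀ y ∈ domain d₁ J, y.1 = k → (∀ j, q j ((l j : ℤ) - 2) < (y.2 j : EReal)) →
      F ≤ f y) :
    F - ∑ p ∈ Fintype.piFinset (fun _ : Fin d₂ => Finset.range M),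
        W p / (N₀ * ∏ j, ((2 ^ p j : ℕ) : ℝ)) ≤ lowerEst (domain d₁ J) n I Y x := by
  have hcorner : ∀ j, ∃ a ∈ J j, a ≤ x.2 j ∧ q j ((l j : ℤ) - 2) < (a : EReal) ∧
      ∀ t ∈ Finset.Icc 1 n, q j ((l j : ℤ) - 2) < ((I t).2 j : EReal) → a ≤ (I t).2 j := fun j =>
    exists_lower_corner (z := fun t => (I t).2 j) (hx j)
      ((hq j (by beta_reduce; omega)).trans_lt (hxl.2 j).1) fun t ht => hID t ht j
  choose a ha1 ha2 ha3 ha4 using hcorner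
  have haD : ((x.1, a) : Covariate d₁ d₂) ∈ domain d₁ J := ha1
  refine le_lowerEst hx haD ⟨le_rfl, ha2⟩ fun b hb hxb => ?_
  -- Mirror image: the cells `l j - 1, …, l j - 2 + 2 ^ p j` are counted upwards from the line `l j
  -- - 2`, and lines beyond `M` are at `+∞`.
  have hp : ∀ j, ∃ p : ℕ, q j ((l j : ℤ) - 2 + 2 ^ p) ≤ (b.2 j : EReal) ∧
      (b.2 j : EReal) < q j ((l j : ℤ) - 2 + 2 ^ (p + 1)) := fun j => by
    have hbig : ∃ m : ℕ, (b.2 j : EReal) < q j ((l j : ℤ) - 2 + 2 ^ m) := by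
      refine ⟨M + 1, ?_⟩
      rw [hq1]
      · exact EReal.coe_lt_top _
      · have : M + 1 < 2 ^ (M + 1) := Nat.lt_two_pow_self
        have := (hl j).1
        zify at *; linarith
    have h0 : Nat.find hbig ≠ 0 := fun h => by
      have := Nat.find_spec hbig
      rw [h, pow_zero, show (l j : ℤ) - 2 + 1 = (l j : ℤ) - 1 by ring] at this
      have h1 : (x.2 j : EReal) ≤ (b.2 j : EReal) := EReal.coe_le_coe_iff.2 (hxb.2 j)
      exact absurd ((hxl.2 j).1.trans_le h1) (not_lt.2 this.le)
    refine ⟨Nat.find hbig - 1, ?_, ?_⟩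
    · exact not_lt.1 (Nat.find_min hbig (by omega))
    · rw [Nat.sub_add_cancel (by omega)]; exact Nat.find_spec hbig
  choose p hp1 hp2 using hp
  have hpl : ∀ j, l j + 2 ^ p j ≤ M + 2 := fun j => by
    by_contra hc
    have h1 := hp1 j
    rw [hq1 j] at h1
    · exact absurd h1 (not_le.2 (EReal.coe_lt_top _))
    · have : M + 3 ≤ l j + 2 ^ p j := by omega
      zify at this; linarith
  have hpM : ∀ j, p j < M := fun j => by
    have h1 : p j < 2 ^ p j := Nat.lt_two_pow_self
    have := hpl j; have := hl j; omega
  have hW0 : ∀ p, 0 ≤ W p := fun p => (abs_nonneg _).trans (hW p x x)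
  refine (sub_le_sub le_rfl (div_le_sum_div hN₀ hW0 hpM)).trans
    (sub_le_avg (N := N₀ * ∏ j, ((2 ^ p j : ℕ) : ℝ)) (c := F) (w := W p) hY
    (by positivity) ?_ ?_ ?_)
  · refine mul_prod_le_obsCount hq hcell (lo := fun j => l j - 1)
      (fun j => by have := hl j; omega)
      (fun j => by have := hpl j; have := hl j; omega) fun t ht hIt => ?_
    have hlo : ∀ j, ((l j - 1 : ℕ) : ℤ) = (l j : ℤ) - 1 := fun j => by
      rw [Nat.cast_sub (by have := hl j; omega)]; push_cast; ring
    refine ⟨⟨?_, fun j => ?_⟩, ⟨?_, fun j => ?_⟩⟩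
    · rw [hIt.1, ← hxl.1]
    · refine ha4 j t ht ((hq j ?_).trans_lt (hIt.2 j).1)
      simp only [hlo]; omega
    · rw [hIt.1, ← hxl.1]; exact hxb.1
    · have h1 := (hIt.2 j).2
      simp only [hlo] at h1
      have h2 : ((I t).2 j : EReal) ≤ (b.2 j : EReal) :=
        h1.trans ((hq j (by push_cast; linarith)).trans (hp1 j))
      exact EReal.coe_le_coe_iff.1 h2
  · intro t ht hIt
    exact (hF _ haD hxl.1 ha3).trans (hf haD (hID t ht) hIt.1)
  · refine le_trans (le_of_eq ?_) (hW p (x.1, a) b)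
    congr 1
    refine Finset.sum_congr ?_ fun _ _ => rfl
    ext t
    rw [Finset.mem_filter, Finset.mem_filter]
    refine and_congr_right fun ht => ⟨fun h => ⟨fun j => ⟨?_, ?_⟩, h⟩, fun h => h.2⟩
    · exact (ha3 j).trans_le (EReal.coe_le_coe_iff.2 (h.1.2 j))
    · exact (EReal.coe_le_coe_iff.2 (h.2.2 j)).trans (hp2 j).le

end Pathwise


/-! ### Quantiles of a continuous distribution function. -/

section Quantile

variable {μ : Measure ℝ}

lemma quantile_mono (μ : Measure ℝ) : Monotone (quantile μ) := fun _ _ h =>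
  sInf_le_sInf (Set.image_mono fun _ hx => h.trans hx)

lemma quantile_of_nonpos {u : ℝ} (hu : u ≤ 0) : quantile μ u = ⊥ := by
  refine (EReal.eq_bot_iff_forall_lt _).2 fun y => ?_
  refine lt_of_le_of_lt (sInf_le ⟨y - 1, hu.trans (cdf_nonneg _ _), rfl⟩) ?_
  exact EReal.coe_lt_coe_iff.2 (by linarith)

lemma quantile_of_one_lt {u : ℝ} (hu : 1 < u) : quantile μ u = ⊤ := by
  have : {x : ℝ | u ≤ cdf μ x} = ∅ := by
    ext x
    simpa using (cdf_le_one μ x).trans_lt hu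
  rw [quantile, this, Set.image_empty, sInf_empty]

lemma le_cdf_of_quantile_lt {u x : ℝ} (h : quantile μ u < x) : u ≤ cdf μ x := by
  obtain ⟨_, ⟨y, hy, rfl⟩, hyx⟩ := sInf_lt_iff.1 h
  exact le_trans hy (monotone_cdf μ (EReal.coe_lt_coe_iff.1 hyx).le)

lemma cdf_le_of_le_quantile (hc : Continuous (cdf μ)) {u x : ℝ} (h : (x : EReal) ≤ quantile μ u) :
    cdf μ x ≤ u := by
  have h1 : ∀ y < x, cdf μ y ≤ u := fun y hy => by
    by_contra hlt
    have := h.trans (sInf_le ⟨y, (not_le.1 hlt).le, rfl⟩)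
    exact absurd (EReal.coe_le_coe_iff.1 this) (not_le.2 hy)
  refine le_of_tendsto (hc.continuousAt.tendsto.mono_left nhdsWithin_le_nhds :
    Tendsto (cdf μ) (nhdsWithin x (Set.Iio x)) _) ?_
  filter_upwards [self_mem_nhdsWithin] with y hy using h1 y hy

/-- The points between two quantiles. -/
def quantileIoc (μ : Measure ℝ) (u v : ℝ) : Set ℝ :=
  {z | quantile μ u < (z : EReal) ∧ (z : EReal) ≤ quantile μ v}

lemma ordConnected_quantileIoc (μ : Measure ℝ) (u v : ℝ) : (quantileIoc μ u v).OrdConnected :=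
  Set.ordConnected_of_Ioo fun _ hx _ hy _ _ hz =>
    ⟨hx.1.trans (EReal.coe_lt_coe_iff.2 hz.1), (EReal.coe_le_coe_iff.2 hz.2.le).trans hy.2⟩

/-- The left end may itself be the lower quantile, so its bound comes by continuity from points to
its right. -/
lemma cdf_sub_le {u v a b : ℝ} (hc : Continuous (cdf μ)) (huv : u ≤ v) (hab : a ≤ b)
    (h : Set.Ioc a b ⊆ quantileIoc μ u v) : cdf μ b - cdf μ a ≤ v - u := by
  rcases hab.eq_or_lt with rfl | hlt
  · linarith
  have h1 : u ≤ cdf μ a := by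
    refine ge_of_tendsto (hc.continuousAt.tendsto.mono_left nhdsWithin_le_nhds :
      Tendsto (cdf μ) (nhdsWithin a (Set.Ioi a)) _) ?_
    filter_upwards [Ioc_mem_nhdsGT hlt] with y hy using le_cdf_of_quantile_lt (h hy).1
  have h2 := cdf_le_of_le_quantile hc (h ⟨hlt, le_rfl⟩).2
  linarith

/-- The design bounds concern real endpoints while quantiles may be infinite; cutting at `±N` makes
the interval admissible. -/
lemma exists_Ioc_eq (α β : EReal) (N : ℝ) :
    ∃ a b : ℝ, a ≤ b ∧ {z : ℝ | α < (z : EReal) ∧ (z : EReal) ≤ β} ∩ Set.Ioc (-N) N =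
      Set.Ioc a b := by
  suffices h : ∃ a b : ℝ, {z : ℝ | α < (z : EReal) ∧ (z : EReal) ≤ β} ∩ Set.Ioc (-N) N =
      Set.Ioc a b by
    obtain ⟨a, b, h⟩ := h
    refine ⟨a, max a b, le_max_left _ _, h.trans ?_⟩
    rcases le_total a b with hab | hab
    · rw [max_eq_right hab]
    · rw [max_eq_left hab, Set.Ioc_self, Set.Ioc_eq_empty (not_lt.2 hab)]
  have hα : ∃ a : ℝ, ∀ z ∈ Set.Ioc (-N) N, α < (z : EReal) ↔ a < z := by
    induction α with
    | bot => exact ⟨-N, fun z hz => by simp [hz.1, EReal.bot_lt_coe]⟩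
    | coe r => exact ⟨r, fun z _ => EReal.coe_lt_coe_iff⟩
    | top => exact ⟨N, fun z hz => by simp [hz.2]⟩
  have hβ : ∃ b : ℝ, ∀ z ∈ Set.Ioc (-N) N, (z : EReal) ≤ β ↔ z ≤ b := by
    induction β with
    | bot => exact ⟨-N, fun z hz => by simp [hz.1]⟩
    | coe r => exact ⟨r, fun z _ => EReal.coe_le_coe_iff⟩
    | top => exact ⟨N, fun z hz => by simp [hz.2]⟩
  obtain ⟨a, ha⟩ := hα
  obtain ⟨b, hb⟩ := hβ
  refine ⟨max a (-N), min b N, ?_⟩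
  ext z
  simp only [Set.mem_inter_iff, Set.mem_ofPred_eq, Set.mem_Ioc, max_lt_iff, le_min_iff]
  constructor
  · rintro ⟨⟨h1, h2⟩, h3⟩
    exact ⟨⟨(ha z h3).1 h1, h3.1⟩, (hb z h3).1 h2, h3.2⟩
  · rintro ⟨⟨h1, h2⟩, h3, h4⟩
    exact ⟨⟨(ha z ⟨h2, h4⟩).2 h1, (hb z ⟨h2, h4⟩).2 h3⟩, h2, h4⟩

variable [IsProbabilityMeasure μ]

lemma measureReal_Icc_eq (hc : Continuous (cdf μ)) {a b : ℝ} (h : a ≤ b) :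
    μ.real (Set.Icc a b) = cdf μ b - cdf μ a := by
  have : Function.leftLim (cdf μ) a = cdf μ a :=
    leftLim_eq_of_tendsto (hc.continuousAt.tendsto.mono_left nhdsWithin_le_nhds)
  rw [Measure.real]
  conv_lhs => rw [← measure_cdf μ]
  rw [StieltjesFunction.measure_Icc, this,
    ENNReal.toReal_ofReal (sub_nonneg.2 (monotone_cdf μ h))]

lemma measureReal_quantileIoc_le (hc : Continuous (cdf μ)) {u v : ℝ} (huv : u ≤ v) :
    μ.real (quantileIoc μ u v) ≤ v - u := by
  refine measureReal_le_of_Icc (ordConnected_quantileIoc μ u v).measurableSet (by linarith)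
    fun x hx y hy hxy => ?_
  rw [measureReal_Icc_eq hc hxy]
  refine cdf_sub_le hc huv hxy fun z hz => ?_
  exact (ordConnected_quantileIoc μ u v).out hx hy ⟨hz.1.le, hz.2⟩

end Quantile

/-! ### The quantile grid. -/

section GridLines

variable {d₁ d₂ n : ℕ}

/-- The grid lines in the `j`-th continuous coordinate. -/
noncomputable def gridLine (Q : Fin d₂ → Measure ℝ) (n : ℕ) (j : Fin d₂) (i : ℤ) : EReal :=
  quantile (Q j) ((i : ℝ) * gridH d₂ n)

lemma one_le_gridM (d₂ : ℕ) (hn : 1 ≤ n) : 1 ≤ gridM d₂ n := by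
  unfold gridM
  rw [Nat.one_le_floor_iff]
  exact Real.one_le_rpow (by exact_mod_cast hn) (by positivity)

lemma gridH_pos (hn : 1 ≤ n) : 0 < gridH d₂ n := by
  have := one_le_gridM d₂ hn
  unfold gridH
  positivity

lemma gridM_mul_gridH (hn : 1 ≤ n) : (gridM d₂ n : ℝ) * gridH d₂ n = 1 := by
  have := one_le_gridM d₂ hn
  unfold gridH
  field_simp

/-- Since `gridM ≥ 1`, rounding down loses at most a factor of two. -/
lemma gridH_le (hn : 1 ≤ n) : gridH d₂ n ≤ 2 * (n : ℝ) ^ (-(1 / ((d₂ : ℝ) + 2))) := by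
  have h1 := one_le_gridM d₂ hn
  have h2 := Nat.lt_floor_add_one ((n : ℝ) ^ (1 / ((d₂ : ℝ) + 2)))
  have h3 : (1 : ℝ) ≤ gridM d₂ n := by exact_mod_cast h1
  have hpos : (0 : ℝ) < (n : ℝ) ^ (1 / ((d₂ : ℝ) + 2)) :=
    Real.rpow_pos_of_pos (by exact_mod_cast hn) _
  rw [Real.rpow_neg (Nat.cast_nonneg n)]
  unfold gridH
  rw [← div_eq_mul_inv, div_le_div_iff₀ (by linarith) hpos]
  unfold gridM at h3 ⊢
  linarith

lemma gridLine_mono (Q : Fin d₂ → Measure ℝ) (n : ℕ) (j : Fin d₂) : Monotone (gridLine Q n j) :=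
  fun a b h => by
    refine quantile_mono _ (mul_le_mul_of_nonneg_right (by exact_mod_cast h) ?_)
    unfold gridH; positivity

lemma gridLine_of_nonpos (Q : Fin d₂ → Measure ℝ) (n : ℕ) (j : Fin d₂) {i : ℤ} (hi : i ≤ 0) :
    gridLine Q n j i = ⊥ := by
  refine quantile_of_nonpos (mul_nonpos_of_nonpos_of_nonneg (by exact_mod_cast hi) ?_)
  unfold gridH; positivity

lemma gridLine_of_gridM_lt (Q : Fin d₂ → Measure ℝ) (hn : 1 ≤ n) (j : Fin d₂) {i : ℤ}
    (hi : gridM d₂ n < i) : gridLine Q n j i = ⊤ := by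
  refine quantile_of_one_lt ?_
  rw [← gridM_mul_gridH (d₂ := d₂) hn]
  exact mul_lt_mul_of_pos_right (by exact_mod_cast hi) (gridH_pos hn)

lemma cell_eq_gridBox (Q : Fin d₂ → Measure ℝ) (n : ℕ) (k : Fin d₁ → ℕ) (l : Fin d₂ → ℕ) :
    cell Q n k l = gridBox (gridLine Q n) k (fun j => (l j : ℤ) - 1) (fun j => l j) := by
  unfold cell gridBox gridLine
  push_cast
  rfl

/-- Take the first grid line not below `x`. The margin of width `gridH` in the region leaves a
neighbouring cell on either side for the corners. -/
lemma exists_gridBox_of_mem_region {Q : Fin d₂ → Measure ℝ} (hn : 1 ≤ n) {K : ℕ}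
    {x : Covariate d₁ d₂} (hx : x ∈ region d₁ Q K n) :
    ∃ l : Fin d₂ → ℕ, (∀ j, 2 ≤ l j ∧ l j + 1 ≤ gridM d₂ n) ∧
      x ∈ gridBox (gridLine Q n) x.1 (fun j => (l j : ℤ) - 1) (fun j => l j) := by
  have hM := one_le_gridM d₂ hn
  have h : ∀ j, ∃ l : ℕ, (2 ≤ l ∧ l + 1 ≤ gridM d₂ n) ∧
      gridLine Q n j ((l : ℤ) - 1) < (x.2 j : EReal) ∧ (x.2 j : EReal) ≤ gridLine Q n j l := by
    intro j
    obtain ⟨h1, h2⟩ := hx.2 j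
    have e1 : gridLine Q n j ((1 : ℕ) : ℤ) = quantile (Q j) (gridH d₂ n) := by simp [gridLine]
    have e2 : gridLine Q n j ((gridM d₂ n - 1 : ℕ) : ℤ) = quantile (Q j) (1 - gridH d₂ n) := by
      unfold gridLine
      congr 1
      rw [Int.cast_natCast, Nat.cast_sub hM, sub_mul, gridM_mul_gridH hn]
      simp
    have hex : ∃ l : ℕ, (x.2 j : EReal) ≤ gridLine Q n j l := ⟨gridM d₂ n - 1, by rwa [e2]⟩
    have hle : Nat.find hex ≤ gridM d₂ n - 1 := Nat.find_min' hex (by rwa [e2])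
    have hspec := Nat.find_spec hex
    have hge : 2 ≤ Nat.find hex := by
      by_contra hc
      have h3 : gridLine Q n j (Nat.find hex : ℤ) ≤ gridLine Q n j ((1 : ℕ) : ℤ) :=
        gridLine_mono Q n j (by omega)
      rw [e1] at h3
      exact absurd (hspec.trans h3) (not_le.2 h1)
    refine ⟨Nat.find hex, ⟨hge, by omega⟩, ?_, hspec⟩
    have := Nat.find_min hex (show Nat.find hex - 1 < Nat.find hex by omega)
    rw [Nat.cast_sub (by omega)] at this
    exact not_le.1 this
  choose l hl1 hl2 using h
  exact ⟨l, hl1, rfl, hl2⟩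

end GridLines

/-! ### Consequences of the bounds on the design. -/

section Design

variable {Ω : Type*} [MeasurableSpace Ω] {d₁ d₂ : ℕ} {P : Measure Ω} [IsProbabilityMeasure P]
  {Q : Fin d₂ → Measure ℝ} [∀ j, IsProbabilityMeasure (Q j)]
  {I : ℕ → ℕ → Ω → Covariate d₁ d₂} {ε : ℕ → ℕ → Ω → ℝ}

/-- The expected number of observations between quantiles. -/
lemma exists_expCount_slice_le (hA3 : AssumptionA3 P Q I ε) :
    ∃ C₂ : ℝ, 0 ≤ C₂ ∧ ∀ n : ℕ, 1 ≤ n → ∀ u v : Fin d₂ → ℝ, (∀ j, u j ≤ v j) →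
      expCount P (I n) (slice d₁ fun j => quantileIoc (Q j) (u j) (v j)) n ≤
        C₂ * n * ∏ j, (v j - u j) + 1 := by
  -- `K = 0` suffices, as the upper bound concerns the continuous components only.
  obtain ⟨C₁, C₂, hC₁, hC₁₂, hb⟩ := hA3.average_bounds 0
  refine ⟨C₂, by linarith, fun n hn u v huv => ?_⟩
  have hn0 : (0 : ℝ) < n := by exact_mod_cast hn
  have hex := fun (N : ℕ) (j : Fin d₂) =>
    exists_Ioc_eq (quantile (Q j) (u j)) (quantile (Q j) (v j)) N
  choose a b hab heq using hex
  have hbound : ∀ N : ℕ, expCount P (I n) (slice d₁ fun j => Set.Ioc (a N j) (b N j)) n ≤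
      C₂ * n * ∏ j, (v j - u j) + 1 := fun N => by
    have h1 := (hb n hn 0 (fun _ => le_rfl) (a N) (b N) (hab N)).2.2
    have h2 : ∏ j, (cdf (Q j) (b N j) - cdf (Q j) (a N j)) ≤ ∏ j, (v j - u j) :=
      Finset.prod_le_prod (fun j _ => sub_nonneg.2 (monotone_cdf _ (hab N j))) fun j _ =>
        cdf_sub_le (hA3.continuous_cdf j) (huv j) (hab N j) fun z hz => by
          rw [← heq N j] at hz; exact hz.1
    have h3 := mul_le_mul_of_nonneg_left h2 (by linarith : 0 ≤ C₂)
    rw [one_div, inv_mul_le_iff₀ hn0] at h1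
    have h4 : (n : ℝ) * (C₂ * ∏ j, (cdf (Q j) (b N j) - cdf (Q j) (a N j)) + (n : ℝ)⁻¹) =
        n * (C₂ * ∏ j, (cdf (Q j) (b N j) - cdf (Q j) (a N j))) + 1 := by
      field_simp
    rw [h4] at h1
    refine h1.trans ?_
    nlinarith
  have hmono : Monotone fun N : ℕ => slice d₁ fun j => Set.Ioc (a N j) (b N j) := by
    intro N N' hNN' y hy j
    have h1 := hy j
    beta_reduce at h1 ⊢
    rw [← heq] at h1 ⊢
    have h2 : (N : ℝ) ≤ N' := by exact_mod_cast hNN'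
    exact ⟨h1.1, by linarith [h1.2.1], h1.2.2.trans h2⟩
  have hun : (slice d₁ fun j => quantileIoc (Q j) (u j) (v j)) =
      ⋃ N : ℕ, slice d₁ fun j => Set.Ioc (a N j) (b N j) := by
    ext y
    rw [Set.mem_iUnion]
    constructor
    · intro hy
      obtain ⟨N, hN⟩ := exists_nat_gt (∑ j, |y.2 j|)
      refine ⟨N, fun j => ?_⟩
      have h1 : |y.2 j| ≤ ∑ j, |y.2 j| :=
        Finset.single_le_sum (f := fun j => |y.2 j|) (fun _ _ => abs_nonneg _) (Finset.mem_univ j)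
      have h2 := abs_lt.1 (h1.trans_lt hN)
      beta_reduce
      rw [← heq]
      exact ⟨hy j, h2.1, h2.2.le⟩
    · rintro ⟨N, hN⟩ j
      have := hN j
      beta_reduce at this
      rw [← heq] at this
      exact this.1
  have hlim : Tendsto (fun N : ℕ => expCount P (I n) (slice d₁ fun j => Set.Ioc (a N j) (b N j)) n)
      atTop (nhds (expCount P (I n) (slice d₁ fun j => quantileIoc (Q j) (u j) (v j)) n)) := by
    unfold expCount
    refine tendsto_finsetSum _ fun t _ => ?_
    rw [hun, Set.preimage_iUnion]
    refine (ENNReal.tendsto_toReal (measure_ne_top _ _)).comp (tendsto_measure_iUnion_atTop ?_)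
    exact fun N N' h => Set.preimage_mono (hmono h)
  exact le_of_tendsto' hlim hbound

lemma nu_gridBox_le (hc : ∀ j, Continuous (cdf (Q j))) {n : ℕ} (hn : 1 ≤ n) (k : Fin d₁ → ℕ)
    (l : Fin d₂ → ℕ) :
    nu d₁ Q (gridBox (gridLine Q n) k (fun j => (l j : ℤ) - 1) (fun j => l j)) ≤
      ENNReal.ofReal (gridH d₂ n ^ d₂) := by
  have hbox : gridBox (gridLine Q n) k (fun j => (l j : ℤ) - 1) (fun j => l j) =
      {k} ×ˢ Set.univ.pi fun j => quantileIoc (Q j) ((((l j : ℤ) - 1 : ℤ) : ℝ) * gridH d₂ n)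
        (((l j : ℤ) : ℝ) * gridH d₂ n) := by
    ext y
    simp [gridBox, quantileIoc, gridLine, Set.mem_prod]
  rw [hbox, nu, Measure.prod_prod, Measure.count_singleton, one_mul, Measure.pi_pi]
  calc _ ≤ ∏ _j : Fin d₂, ENNReal.ofReal (gridH d₂ n) := by
        refine Finset.prod_le_prod' fun j _ => ?_
        have h0 := gridH_pos (d₂ := d₂) hn
        have h1 := measureReal_quantileIoc_le (hc j)
          (u := (((l j : ℤ) - 1 : ℤ) : ℝ) * gridH d₂ n) (v := ((l j : ℤ) : ℝ) * gridH d₂ n)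
          (by push_cast; linarith)
        rw [← ENNReal.ofReal_toReal (measure_ne_top (Q j) _)]
        refine ENNReal.ofReal_le_ofReal (h1.trans (le_of_eq ?_))
        push_cast; ring
    _ = _ := by
        rw [Finset.prod_const, Finset.card_univ, Fintype.card_fin,
          ENNReal.ofReal_pow (gridH_pos hn).le]

/-- Almost surely no observation has its `j`-th component in the interval. Taking sides of positive
mass in the other directions, the lower design bound forces `C₁ ∏ ≤ 1/n` for all `n`. -/
lemma cdf_sub_eq_zero_of_disjoint {J : Fin d₂ → Set ℝ}
    (hID : ∀ n t, 1 ≤ t → t ≤ n → ∀ᵐ ω ∂P, I n t ω ∈ domain d₁ J)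
    (hA3 : AssumptionA3 P Q I ε) (j : Fin d₂) {a b : ℝ} (hab : a ≤ b)
    (h : ∀ z ∈ Set.Ioc a b, z ∉ J j) : cdf (Q j) b - cdf (Q j) a ≤ 0 := by
  classical
  obtain ⟨C₁, C₂, hC₁, hC₁₂, hb⟩ := hA3.average_bounds 0
  have hN : ∃ N : ℕ, ∀ i, 0 < cdf (Q i) N - cdf (Q i) (-N) := by
    have h1 : ∀ i, ∀ᶠ N : ℕ in atTop, 0 < cdf (Q i) N - cdf (Q i) (-N) := fun i => by
      have h2 : Tendsto (fun N : ℕ => cdf (Q i) N - cdf (Q i) (-N)) atTop (nhds (1 - 0)) :=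
        ((tendsto_cdf_atTop _).comp tendsto_natCast_atTop_atTop).sub
          ((tendsto_cdf_atBot _).comp (tendsto_neg_atTop_atBot.comp tendsto_natCast_atTop_atTop))
      rw [sub_zero] at h2
      exact h2.eventually (lt_mem_nhds zero_lt_one)
    exact (eventually_all.2 h1).exists
  obtain ⟨N, hN⟩ := hN
  set α : Fin d₂ → ℝ := Function.update (fun _ => -(N : ℝ)) j a with hα
  set β : Fin d₂ → ℝ := Function.update (fun _ => (N : ℝ)) j b with hβ
  have hαj : α j = a := Function.update_self _ _ _
  have hβj : β j = b := Function.update_self _ _ _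
  have hαβ : ∀ i, α i ≤ β i := fun i => by
    by_cases hi : i = j
    · subst hi; rw [hαj, hβj]; exact hab
    · rw [hα, hβ, Function.update_of_ne hi, Function.update_of_ne hi]
      have : (0 : ℝ) ≤ N := Nat.cast_nonneg N
      linarith
  have key : ∀ n : ℕ, C₁ * ∏ i, (cdf (Q i) (β i) - cdf (Q i) (α i)) ≤ 1 / ((n : ℝ) + 1) := fun n => by
    have h1 := (hb (n + 1) (by omega) 0 (fun _ => le_rfl) α β hαβ).1
    rw [Finset.sum_eq_zero] at h1
    · push_cast at h1; linarith
    · intro t ht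
      rw [Finset.mem_Icc] at ht
      have h2 : P {ω | (I (n + 1) t ω).1 = 0 ∧ ∀ i, (I (n + 1) t ω).2 i ∈ Set.Ioc (α i) (β i)} = 0 := by
        have hsub : {ω | (I (n + 1) t ω).1 = 0 ∧ ∀ i, (I (n + 1) t ω).2 i ∈ Set.Ioc (α i) (β i)} ⊆
            {ω | ¬ I (n + 1) t ω ∈ domain d₁ J} := fun ω hω hd => by
          have h3 := hω.2 j
          rw [hαj, hβj] at h3
          exact h _ h3 (hd j)
        exact measure_mono_null hsub (ae_iff.1 (hID (n + 1) t ht.1 ht.2))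
      rw [Measure.real, h2, ENNReal.toReal_zero]
  have h0 : C₁ * ∏ i, (cdf (Q i) (β i) - cdf (Q i) (α i)) ≤ 0 :=
    ge_of_tendsto' tendsto_one_div_add_atTop_nhds_zero_nat key
  by_contra hlt
  rw [not_le] at hlt
  have : 0 < ∏ i, (cdf (Q i) (β i) - cdf (Q i) (α i)) := Finset.prod_pos fun i _ => by
    by_cases hi : i = j
    · subst hi; rw [hαj, hβj]; exact hlt
    · rw [hα, hβ, Function.update_of_ne hi, Function.update_of_ne hi]; exact hN i
  exact absurd h0 (not_le.2 (mul_pos hC₁ this))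

/-- Almost every point of the covariate space lies in the domain of the regression function. -/
lemma ae_mem_domain {J : Fin d₂ → Set ℝ} (hJ : ∀ j, (J j).OrdConnected)
    (hID : ∀ n t, 1 ≤ t → t ≤ n → ∀ᵐ ω ∂P, I n t ω ∈ domain d₁ J)
    (hA3 : AssumptionA3 P Q I ε) : ∀ᵐ x ∂(nu d₁ Q), x ∈ domain d₁ J := by
  have h1 : ∀ j, ∀ᵐ z ∂(Q j), z ∈ J j := fun j => by
    have hnull : ∀ T : Set ℝ, T.OrdConnected → (∀ z ∈ T, z ∉ J j) → Q j T = 0 := fun T hT hTJ => by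
      have := measureReal_le_of_Icc (ρ := Q j) hT.measurableSet le_rfl fun x hx y hy hxy => by
        rw [measureReal_Icc_eq (hA3.continuous_cdf j) hxy]
        exact cdf_sub_eq_zero_of_disjoint hID hA3 j hxy fun z hz =>
          hTJ z (hT.out hx hy ⟨hz.1.le, hz.2⟩)
      have h0 := le_antisymm this measureReal_nonneg
      exact (measureReal_eq_zero_iff).1 h0
    -- What lies outside an interval is below or above all of it, and both parts are
    -- order-connected.
    have hsub : {z | z ∉ J j} ⊆ {z | ∀ y ∈ J j, z < y} ∪ {z | ∀ y ∈ J j, y < z} := fun z hz => by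
      by_contra hc
      rw [Set.mem_union, not_or] at hc
      obtain ⟨hc1, hc2⟩ := hc
      simp only [Set.mem_ofPred_eq, not_forall, not_lt] at hc1 hc2
      obtain ⟨y, hy, hyz⟩ := hc1
      obtain ⟨y', hy', hyz'⟩ := hc2
      exact hz ((hJ j).out hy hy' ⟨hyz, hyz'⟩)
    refine measure_mono_null hsub (measure_union_null (hnull _ ?_ ?_) (hnull _ ?_ ?_))
    · exact ⟨fun x _ y hy z hz w hw => hz.2.trans_lt (hy w hw)⟩
    · exact fun z hz hzJ => lt_irrefl z (hz z hzJ)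
    · exact ⟨fun x hx y _ z hz w hw => (hx w hw).trans_le hz.1⟩
    · exact fun z hz hzJ => lt_irrefl z (hz z hzJ)
  have h2 : ∀ᵐ y ∂(Measure.pi Q), ∀ j, y j ∈ J j :=
    ae_all_iff.2 fun j => (Measure.quasiMeasurePreserving_eval Q j).ae (h1 j)
  exact (Measure.quasiMeasurePreserving_snd (μ := (Measure.count : Measure (Fin d₁ → ℕ)))
    (ν := Measure.pi Q)).ae h2

end Design

/-! ### Telescoping of the bias. -/

section Bias

open Classical in
/-- Telescoping along the diagonals of a grid. -/
lemma sum_diagonal_increment_le {d M : ℕ} {G : (Fin d → ℕ) → ℝ} {B : ℝ} (hG : ∀ m, |G m| ≤ B) :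
    ∑ l ∈ Fintype.piFinset (fun _ : Fin d => Finset.Icc 2 (M - 1)),
      (G (fun j => l j + 1) - G (fun j => l j - 2)) ≤ 6 * B * (d * (M : ℝ) ^ (d - 1)) := by
  have hB : 0 ≤ B := (abs_nonneg _).trans (hG 0)
  set S := Fintype.piFinset (fun _ : Fin d => Finset.Icc 2 (M - 1)) with hS
  have hmem : ∀ l, l ∈ S ↔ ∀ j, 2 ≤ l j ∧ l j ≤ M - 1 := fun l => by
    rw [hS, Fintype.mem_piFinset]; simp only [Finset.mem_Icc]
  set S₁ := S.image fun l j => l j + 1 with hS₁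
  set S₂ := S.image fun l j => l j - 2 with hS₂
  have e1 : ∑ l ∈ S, G (fun j => l j + 1) = ∑ m ∈ S₁, G m := by
    rw [hS₁, Finset.sum_image]
    intro l _ l' _ h
    funext j
    have := congrFun h j
    simpa using this
  have e2 : ∑ l ∈ S, G (fun j => l j - 2) = ∑ m ∈ S₂, G m := by
    rw [hS₂, Finset.sum_image]
    intro l hl l' hl' h
    funext j
    have := congrFun h j
    have := (hmem l).1 hl j; have := (hmem l').1 hl' j
    beta_reduce at *
    omega
  rw [Finset.sum_sub_distrib, e1, e2, ← Finset.sum_sdiff_sub_sum_sdiff]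
  -- The index sets are shifted by three against each other. What does not cancel has some
  -- coordinate among three extreme values.
  have hcard : ∀ (T : Finset (Fin d → ℕ)) (U V : Finset ℕ), U.card ≤ 3 → V.card ≤ M →
      (∀ m ∈ T, ∃ j, m j ∈ U ∧ ∀ i, m i ∈ V) → (T.card : ℝ) ≤ 3 * (d * (M : ℝ) ^ (d - 1)) := by
    intro T U V hU hV hT
    have hsub : T ⊆ Finset.univ.biUnion fun j : Fin d =>
        Fintype.piFinset (Function.update (fun _ => V) j U) := fun m hm => by
      obtain ⟨j, h1, h2⟩ := hT m hm
      refine Finset.mem_biUnion.2 ⟨j, Finset.mem_univ _, Fintype.mem_piFinset.2 fun i => ?_⟩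
      by_cases hi : i = j
      · subst hi; rwa [Function.update_self]
      · rw [Function.update_of_ne hi]; exact h2 i
    have h1 : T.card ≤ ∑ _j : Fin d, 3 * M ^ (d - 1) := by
      refine (Finset.card_le_card hsub).trans (Finset.card_biUnion_le.trans
        (Finset.sum_le_sum fun j _ => ?_))
      rw [Fintype.card_piFinset, ← Finset.mul_prod_erase _ _ (Finset.mem_univ j),
        Function.update_self]
      refine Nat.mul_le_mul hU ?_
      refine (Finset.prod_le_pow_card _ _ M fun i hi => ?_).trans (le_of_eq ?_)
      · rw [Function.update_of_ne (Finset.ne_of_mem_erase hi)]; exact hV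
      · rw [Finset.card_erase_of_mem (Finset.mem_univ _), Finset.card_univ, Fintype.card_fin]
    rw [Finset.sum_const, Finset.card_univ, Fintype.card_fin, smul_eq_mul] at h1
    have h2 : (T.card : ℝ) ≤ ((d * (3 * M ^ (d - 1)) : ℕ) : ℝ) := by exact_mod_cast h1
    push_cast at h2
    linarith
  have c1 : ((S₁ \ S₂).card : ℝ) ≤ 3 * (d * (M : ℝ) ^ (d - 1)) := by
    refine hcard _ (Finset.Icc (M - 2) M) (Finset.Icc 1 M) (by simp; omega) (by simp) fun m hm => ?_
    rw [Finset.mem_sdiff] at hm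
    obtain ⟨l, hl, rfl⟩ := Finset.mem_image.1 hm.1
    rw [hmem] at hl
    -- Otherwise `l + 3` is again an index of the sum, and `l + 1 = (l + 3) - 2` cancels.
    have : ∃ j, M - 2 ≤ l j + 1 := by
      by_contra hc
      push Not at hc
      refine hm.2 (Finset.mem_image.2 ⟨fun j => l j + 3, (hmem _).2 fun j => ?_, ?_⟩)
      · have := hl j; have := hc j; omega
      · funext j; simp
    obtain ⟨j, hj⟩ := this
    refine ⟨j, Finset.mem_Icc.2 ⟨hj, ?_⟩, fun i => Finset.mem_Icc.2 ?_⟩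
    · have := hl j; beta_reduce; omega
    · have := hl i; beta_reduce; omega
  have c2 : ((S₂ \ S₁).card : ℝ) ≤ 3 * (d * (M : ℝ) ^ (d - 1)) := by
    refine hcard _ (Finset.range 3) (Finset.range M) (by simp) (by simp) fun m hm => ?_
    rw [Finset.mem_sdiff] at hm
    obtain ⟨l, hl, rfl⟩ := Finset.mem_image.1 hm.1
    rw [hmem] at hl
    have : ∃ j, l j - 2 < 3 := by
      by_contra hc
      push Not at hc
      refine hm.2 (Finset.mem_image.2 ⟨fun j => l j - 3, (hmem _).2 fun j => ?_, ?_⟩)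
      · have := hl j; have := hc j; omega
      · funext j; have := hc j; beta_reduce; omega
    obtain ⟨j, hj⟩ := this
    refine ⟨j, Finset.mem_range.2 hj, fun i => Finset.mem_range.2 ?_⟩
    have := hl i; beta_reduce; omega
  have b1 : ∑ m ∈ S₁ \ S₂, G m ≤ (S₁ \ S₂).card * B := by
    rw [← nsmul_eq_mul]
    exact Finset.sum_le_card_nsmul _ _ _ fun m _ => le_of_abs_le (hG m)
  have b2 : -((S₂ \ S₁).card * B) ≤ ∑ m ∈ S₂ \ S₁, G m := by
    have := Finset.card_nsmul_le_sum (S₂ \ S₁) G (-B) fun m _ => neg_le_of_abs_le (hG m)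
    rw [nsmul_eq_mul] at this
    linarith
  nlinarith

variable {d₁ d₂ : ℕ}

/-- The supremum of `f` over the points of `D` with discrete part `k` below given grid lines
(at least `-B`). -/
noncomputable def supBelow (D : Set (Covariate d₁ d₂)) (f : Covariate d₁ d₂ → ℝ) (B : ℝ)
    (q : Fin d₂ → ℤ → EReal) (k : Fin d₁ → ℕ) (m : Fin d₂ → ℤ) : ℝ :=
  sSup (insert (-B) (f '' {y | y ∈ D ∧ y.1 = k ∧ ∀ j, (y.2 j : EReal) ≤ q j (m j)}))

variable {D : Set (Covariate d₁ d₂)} {f : Covariate d₁ d₂ → ℝ} {B : ℝ}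
  {q : Fin d₂ → ℤ → EReal} {k : Fin d₁ → ℕ} {m m' : Fin d₂ → ℤ}

lemma supBelow_le {c : ℝ} (hc : -B ≤ c) (h : ∀ y ∈ D, y.1 = k →
    (∀ j, (y.2 j : EReal) ≤ q j (m j)) → f y ≤ c) : supBelow D f B q k m ≤ c := by
  refine csSup_le (Set.insert_nonempty _ _) ?_
  rintro _ (rfl | ⟨y, ⟨h1, h2, h3⟩, rfl⟩)
  · exact hc
  · exact h y h1 h2 h3

lemma bddAbove_supBelow (hf : ∀ x ∈ D, |f x| ≤ B) (h0 : 0 ≤ B) : BddAbove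
    (insert (-B) (f '' {y | y ∈ D ∧ y.1 = k ∧ ∀ j, (y.2 j : EReal) ≤ q j (m j)})) := by
  refine ⟨B, ?_⟩
  rintro _ (rfl | ⟨y, ⟨h1, -, -⟩, rfl⟩)
  · linarith
  · exact le_of_abs_le (hf y h1)

lemma le_supBelow (hf : ∀ x ∈ D, |f x| ≤ B) (h0 : 0 ≤ B) {y : Covariate d₁ d₂} (hy : y ∈ D)
    (hk : y.1 = k) (hm : ∀ j, (y.2 j : EReal) ≤ q j (m j)) : f y ≤ supBelow D f B q k m :=
  le_csSup (bddAbove_supBelow hf h0) (Set.mem_insert_of_mem _ ⟨y, ⟨hy, hk, hm⟩, rfl⟩)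

lemma neg_le_supBelow (hf : ∀ x ∈ D, |f x| ≤ B) (h0 : 0 ≤ B) : -B ≤ supBelow D f B q k m :=
  le_csSup (bddAbove_supBelow hf h0) (Set.mem_insert _ _)

lemma abs_supBelow_le (hf : ∀ x ∈ D, |f x| ≤ B) (h0 : 0 ≤ B) : |supBelow D f B q k m| ≤ B :=
  abs_le.2 ⟨neg_le_supBelow hf h0,
    supBelow_le (by linarith) fun y hy _ _ => le_of_abs_le (hf y hy)⟩

lemma supBelow_mono (hf : ∀ x ∈ D, |f x| ≤ B) (h0 : 0 ≤ B) (hq : ∀ j, Monotone (q j))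
    (h : ∀ j, m j ≤ m' j) : supBelow D f B q k m ≤ supBelow D f B q k m' :=
  supBelow_le (neg_le_supBelow hf h0) fun _ hy hk hm =>
    le_supBelow hf h0 hy hk fun j => (hm j).trans (hq j (h j))

/-- One function of the grid index thus brackets `f` from both sides, which is what lets the
increments telescope. -/
lemma supBelow_le_of_lt (hf : ∀ x ∈ D, |f x| ≤ B) (hmono : MonotoneOn f D)
    {a : Covariate d₁ d₂} (ha : a ∈ D) (hk : a.1 = k) (hm : ∀ j, q j (m j) < (a.2 j : EReal)) :
    supBelow D f B q k m ≤ f a :=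
  supBelow_le (neg_le_of_abs_le (hf a ha)) fun _ hy hyk hym =>
    hmono hy ha ⟨(hyk.trans hk.symm).le, fun j =>
      EReal.coe_le_coe_iff.1 ((hym j).trans (hm j).le)⟩

end Bias


/-! ### The maximal inequality in units of cells. -/

section Noise

variable {Ω : Type*} [MeasurableSpace Ω] {d₁ d₂ : ℕ} {P : Measure Ω} [IsProbabilityMeasure P]
  {Q : Fin d₂ → Measure ℝ} [∀ j, IsProbabilityMeasure (Q j)]
  {I : ℕ → ℕ → Ω → Covariate d₁ d₂} {ε : ℕ → ℕ → Ω → ℝ}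

lemma rate_pow {n : ℕ} : ((n : ℝ) ^ (1 / ((d₂ : ℝ) + 2))) ^ (d₂ + 2) = n := by
  rw [← Real.rpow_natCast, ← Real.rpow_mul (Nat.cast_nonneg n)]
  push_cast
  rw [one_div, inv_mul_cancel₀ (by positivity), Real.rpow_one]

lemma rate_sq {n : ℕ} :
    (n : ℝ) ^ (2 / ((d₂ : ℝ) + 2)) = ((n : ℝ) ^ (1 / ((d₂ : ℝ) + 2))) ^ 2 := by
  rw [← Real.rpow_natCast, ← Real.rpow_mul (Nat.cast_nonneg n)]
  congr 1
  push_cast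
  ring

open Classical in
/-- The maximal inequality on blocks of cells, in terms of the number of cells of the block. -/
lemma exists_block_bound (hd : 0 < d₁ + d₂) {D : Set (Covariate d₁ d₂)} {f : Covariate d₁ d₂ → ℝ}
    (hI : ∀ n t, Measurable (I n t)) (hε : ∀ n t, Measurable (ε n t))
    (hA2 : AssumptionA2 P D f I ε) (hA3 : AssumptionA3 P Q I ε) :
    ∃ C : ℝ, 0 ≤ C ∧ ∀ n : ℕ, 1 ≤ n → ∀ (l u : Fin d₂ → ℤ) (p : Fin d₂ → ℕ),
      (∀ j, u j = l j + 2 ^ (p j + 1)) → ∃ W : Ω → ℝ, Integrable W P ∧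
        (∀ ω (a b : Covariate d₁ d₂), |∑ t ∈ (Finset.Icc 1 n).filter
          (fun t => I n t ω ∈ slice d₁ (gridIoc (gridLine Q n) l u) ∧ I n t ω ∈ Set.Icc a b),
            ε n t ω| ≤ W ω) ∧
        ∫ ω, W ω ∂P ≤ C * (n : ℝ) ^ (1 / ((d₂ : ℝ) + 2)) * ∏ j, √2 ^ p j := by
  obtain ⟨C₀, hC₀, h1⟩ := exists_rectangle_bound hd hI hε hA2 hA3
  obtain ⟨C₂, hC₂, h2⟩ := exists_expCount_slice_le hA3
  -- One factor `2 ^ d₂` comes from block widths `2 ^ (p j + 1)`, another from `gridH ≤ 2 / r`. The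
  -- summand `2` absorbs the additive one in the expected count and ensures `V ≥ 2`.
  set C' : ℝ := C₂ * 4 ^ d₂ + 2 with hC'
  have hC'2 : 2 ≤ C' := le_add_of_nonneg_left (by positivity)
  refine ⟨C₀ * √C', by positivity, fun n hn l u p hlu => ?_⟩
  set r : ℝ := (n : ℝ) ^ (1 / ((d₂ : ℝ) + 2)) with hr
  have hr1 : 1 ≤ r := Real.one_le_rpow (by exact_mod_cast hn) (by positivity)
  have hr0 : 0 < r := by linarith
  have hh0 := gridH_pos (d₂ := d₂) hn
  have hh : gridH d₂ n ≤ 2 * r⁻¹ := by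
    have := gridH_le (d₂ := d₂) hn
    rwa [Real.rpow_neg (Nat.cast_nonneg n)] at this
  set π : ℝ := ∏ j, (2 : ℝ) ^ p j with hπ
  have hπ1 : 1 ≤ π := by
    rw [hπ, Finset.prod_pow_eq_pow_sum]
    exact one_le_pow₀ (by norm_num)
  -- A cell has expected count of order at most `r²`, because `r ^ (d₂ + 2) = n`.
  have hnh : (n : ℝ) * gridH d₂ n ^ d₂ ≤ 2 ^ d₂ * r ^ 2 := by
    have h3 : gridH d₂ n ^ d₂ ≤ (2 * r⁻¹) ^ d₂ := pow_le_pow_left₀ hh0.le hh _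
    calc (n : ℝ) * gridH d₂ n ^ d₂ ≤ n * (2 * r⁻¹) ^ d₂ := by gcongr
      _ = 2 ^ d₂ * r ^ 2 := by
        rw [← rate_pow (d₂ := d₂) (n := n), ← hr, pow_add, mul_pow, inv_pow]
        field_simp
  have hV2 : 2 ≤ C' * r ^ 2 * π := by nlinarith [one_le_mul_of_one_le_of_one_le (one_le_pow₀ hr1 (n := 2)) hπ1]
  have hset : gridIoc (gridLine Q n) l u =
      fun j => quantileIoc (Q j) ((l j : ℝ) * gridH d₂ n) ((u j : ℝ) * gridH d₂ n) := rfl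
  have hwidth : ∀ j, (u j : ℝ) * gridH d₂ n - (l j : ℝ) * gridH d₂ n =
      (2 * gridH d₂ n) * 2 ^ p j := fun j => by
    rw [hlu j]; push_cast; ring
  have hcount : expCount P (I n) (slice d₁ (gridIoc (gridLine Q n) l u)) n < C' * r ^ 2 * π := by
    rw [hset]
    refine (h2 n hn _ _ fun j => ?_).trans_lt ?_
    · have := hwidth j
      have : 0 ≤ (2 * gridH d₂ n) * 2 ^ p j := by positivity
      linarith
    · rw [Finset.prod_congr rfl fun j _ => hwidth j, Finset.prod_mul_distrib, Finset.prod_const,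
        Finset.card_univ, Fintype.card_fin, ← hπ, mul_pow]
      have h4 : C₂ * n * (2 ^ d₂ * gridH d₂ n ^ d₂ * π) ≤ C₂ * 4 ^ d₂ * (r ^ 2 * π) := by
        calc C₂ * n * (2 ^ d₂ * gridH d₂ n ^ d₂ * π)
            = C₂ * 2 ^ d₂ * π * (n * gridH d₂ n ^ d₂) := by ring
          _ ≤ C₂ * 2 ^ d₂ * π * (2 ^ d₂ * r ^ 2) := by gcongr
          _ = C₂ * 4 ^ d₂ * (r ^ 2 * π) := by
            rw [show (4 : ℝ) = 2 * 2 by norm_num, mul_pow]; ring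
      have h5 : 1 ≤ r ^ 2 * π := one_le_mul_of_one_le_of_one_le (one_le_pow₀ hr1) hπ1
      rw [hC']
      nlinarith
  obtain ⟨W, hW1, hW2, hW3⟩ := h1 n (gridIoc (gridLine Q n) l u)
    (fun j => ordConnected_quantileIoc _ _ _) _ hV2 hcount
  refine ⟨W, hW1, hW2, hW3.trans (le_of_eq ?_)⟩
  have hsq : √π = ∏ j, √2 ^ p j := by
    rw [Real.sqrt_eq_iff_mul_self_eq (by linarith) (by positivity), ← Finset.prod_mul_distrib]
    refine Finset.prod_congr rfl fun j _ => ?_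
    rw [← mul_pow, Real.mul_self_sqrt (by norm_num)]
  rw [Real.sqrt_mul (by positivity), Real.sqrt_mul (by positivity), Real.sqrt_sq hr0.le, hsq]
  ring

/-- Summability of the noise contributions over all blocks. -/
lemma sum_geometric_le (M : ℕ) :
    ∑ p ∈ Fintype.piFinset fun _ : Fin d₂ => Finset.range M, ∏ j, (√2 / 2) ^ p j ≤
      ((1 - √2 / 2)⁻¹) ^ d₂ := by
  have h0 : (0 : ℝ) ≤ √2 / 2 := by positivity
  have h1 : √2 / 2 < 1 := by
    have : √2 < 2 := by rw [Real.sqrt_lt' (by norm_num)]; norm_num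
    linarith
  rw [← Finset.prod_univ_sum (fun _ : Fin d₂ => Finset.range M) fun _ i => (√2 / 2) ^ i,
    Finset.prod_const, Finset.card_univ, Fintype.card_fin]
  refine pow_le_pow_left₀ (Finset.sum_nonneg fun _ _ => by positivity) ?_ _
  rw [← tsum_geometric_of_lt_one h0 h1]
  exact (summable_geometric_of_lt_one h0 h1).sum_le_tsum _ fun _ _ => by positivity

end Noise

/-! ### Integration over the cells. -/

section Rate

variable {d₁ d₂ : ℕ}

/-- The total contribution of the bias. -/
lemma sum_supBelow_increment_le {D : Set (Covariate d₁ d₂)} {f : Covariate d₁ d₂ → ℝ} {B : ℝ}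
    (hf : ∀ x ∈ D, |f x| ≤ B) (h0 : 0 ≤ B) (q : Fin d₂ → ℤ → EReal) (k : Fin d₁ → ℕ) (M : ℕ) :
    ∑ l ∈ Fintype.piFinset (fun _ : Fin d₂ => Finset.Icc 2 (M - 1)),
      (supBelow D f B q k (fun j => (l j : ℤ) + 1) - supBelow D f B q k (fun j => (l j : ℤ) - 2)) ≤
        6 * B * (d₂ * (M : ℝ) ^ (d₂ - 1)) := by
  refine le_trans (le_of_eq (Finset.sum_congr rfl fun l hl => ?_)) (sum_diagonal_increment_le
    (G := fun m => supBelow D f B q k fun j => (m j : ℤ)) (M := M)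
    fun m => abs_supBelow_le hf h0)
  have : ∀ j, 2 ≤ l j := fun j => (Finset.mem_Icc.1 (Fintype.mem_piFinset.1 hl j)).1
  have h2 : (fun j => (l j : ℤ) - 2) = fun j => ((l j - 2 : ℕ) : ℤ) := by
    funext j; rw [Nat.cast_sub (this j)]; rfl
  simp only [h2]
  push_cast
  rfl

/-- Boundary terms number of order `d M ^ (d - 1)` and weigh `h ^ d` each. For `d = 0` the factor
`d` kills the truncated exponent. -/
lemma mul_pow_pred_le {M : ℕ} {h : ℝ} (hMh : (M : ℝ) * h = 1) (d : ℕ) :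
    h ^ d * (d * (M : ℝ) ^ (d - 1)) = d * h := by
  rcases d with _ | d
  · simp
  · rw [Nat.add_sub_cancel, pow_succ]
    calc h ^ d * h * (((d + 1 : ℕ) : ℝ) * (M : ℝ) ^ d) = ((d + 1 : ℕ) : ℝ) * h * (M * h) ^ d := by
          rw [mul_pow]; ring
      _ = _ := by rw [hMh, one_pow, mul_one]

/-- Integration over the region, cell by cell. -/
lemma lintegral_region_le {Q : Fin d₂ → Measure ℝ} [∀ j, IsProbabilityMeasure (Q j)]
    (hc : ∀ j, Continuous (cdf (Q j))) {n : ℕ} (hn : 1 ≤ n) {K : ℕ} {J : Fin d₂ → Set ℝ}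
    (hJ : ∀ᵐ x ∂(nu d₁ Q), x ∈ domain d₁ J) {g : Covariate d₁ d₂ → ℝ}
    {c : (Fin d₁ → ℕ) → (Fin d₂ → ℕ) → ℝ} (hc0 : ∀ k l, (∀ i, k i ≤ K) →
      (∀ j, 2 ≤ l j ∧ l j + 1 ≤ gridM d₂ n) → 0 ≤ c k l)
    (hg : ∀ k l, (∀ i, k i ≤ K) → (∀ j, 2 ≤ l j ∧ l j + 1 ≤ gridM d₂ n) → ∀ x ∈ domain d₁ J,
      x ∈ gridBox (gridLine Q n) k (fun j => (l j : ℤ) - 1) (fun j => l j) → g x ≤ c k l) :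
    ∫⁻ x in region d₁ Q K n, ENNReal.ofReal (g x) ∂(nu d₁ Q) ≤
      ENNReal.ofReal (∑ k ∈ Fintype.piFinset (fun _ : Fin d₁ => Finset.range (K + 1)),
        ∑ l ∈ Fintype.piFinset (fun _ : Fin d₂ => Finset.Icc 2 (gridM d₂ n - 1)),
          gridH d₂ n ^ d₂ * c k l) := by
  set S := Fintype.piFinset (fun _ : Fin d₁ => Finset.range (K + 1)) ×ˢ
    Fintype.piFinset (fun _ : Fin d₂ => Finset.Icc 2 (gridM d₂ n - 1)) with hS
  set b : (Fin d₁ → ℕ) × (Fin d₂ → ℕ) → Set (Covariate d₁ d₂) := fun kl =>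
    gridBox (gridLine Q n) kl.1 (fun j => (kl.2 j : ℤ) - 1) (fun j => kl.2 j) with hb
  have hmem : ∀ kl, kl ∈ S ↔ (∀ i, kl.1 i ≤ K) ∧ ∀ j, 2 ≤ kl.2 j ∧ kl.2 j + 1 ≤ gridM d₂ n := by
    intro kl
    simp only [hS, Finset.mem_product, Fintype.mem_piFinset, Finset.mem_range, Finset.mem_Icc]
    refine and_congr (forall_congr' fun i => by omega) (forall_congr' fun j => by omega)
  have hh0 := gridH_pos (d₂ := d₂) hn
  have hsub : region d₁ Q K n ⊆ ⋃ kl : S, b kl := fun x hx => by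
    obtain ⟨l, hl, hxl⟩ := exists_gridBox_of_mem_region hn hx
    exact Set.mem_iUnion.2 ⟨⟨(x.1, l), (hmem _).2 ⟨hx.1, hl⟩⟩, hxl⟩
  rw [← Finset.sum_product', ENNReal.ofReal_sum_of_nonneg fun kl hkl =>
    mul_nonneg (by positivity) (hc0 _ _ ((hmem kl).1 hkl).1 ((hmem kl).1 hkl).2)]
  refine (lintegral_mono_set hsub).trans ((lintegral_iUnion_le _ _).trans ?_)
  rw [tsum_fintype, Finset.sum_coe_sort S
    (fun kl => ∫⁻ x in b kl, ENNReal.ofReal (g x) ∂(nu d₁ Q))]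
  refine Finset.sum_le_sum fun kl hkl => ?_
  obtain ⟨hk, hl⟩ := (hmem kl).1 hkl
  calc ∫⁻ x in b kl, ENNReal.ofReal (g x) ∂(nu d₁ Q)
      ≤ ∫⁻ _ in b kl, ENNReal.ofReal (c kl.1 kl.2) ∂(nu d₁ Q) := by
        refine setLIntegral_mono_ae measurable_const.aemeasurable ?_
        filter_upwards [hJ] with x hx hxb
        exact ENNReal.ofReal_le_ofReal (hg _ _ hk hl x hx hxb)
    _ = ENNReal.ofReal (c kl.1 kl.2) * nu d₁ Q (b kl) := setLIntegral_const _ _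
    _ ≤ ENNReal.ofReal (c kl.1 kl.2) * ENNReal.ofReal (gridH d₂ n ^ d₂) := by
        gcongr
        exact nu_gridBox_le hc hn _ _
    _ = _ := by rw [← ENNReal.ofReal_mul (hc0 _ _ hk hl), mul_comm]

end Rate


open Classical in
/-- On the good event, the estimation error on a cell is bounded by the increment of `f` across
neighbouring cells and the averaged noise. -/
lemma abs_estimate_sub_le {d₁ d₂ n : ℕ} {J : Fin d₂ → Set ℝ} {f g : Covariate d₁ d₂ → ℝ}
    {I : ℕ → Covariate d₁ d₂} {Y ε : ℕ → ℝ} (hY : ∀ t, Y t = f (I t) + ε t)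
    (hf : MonotoneOn f (domain d₁ J)) {B : ℝ} (hB : ∀ x ∈ domain d₁ J, |f x| ≤ B) (hB0 : 0 ≤ B)
    (hID : ∀ t ∈ Finset.Icc 1 n, I t ∈ domain d₁ J)
    (hg : IsIsotonicEstimate (domain d₁ J) n I Y g) (Q : Fin d₂ → Measure ℝ) (hn : 1 ≤ n)
    {N₀ : ℝ} (hN₀ : 0 < N₀) {k : Fin d₁ → ℕ}
    (hcell : ∀ l : Fin d₂ → ℕ, (∀ j, 1 ≤ l j ∧ l j ≤ gridM d₂ n) →
      N₀ ≤ obsCount n I (cell Q n k l))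
    {l : Fin d₂ → ℕ} (hl : ∀ j, 2 ≤ l j ∧ l j + 1 ≤ gridM d₂ n) {x : Covariate d₁ d₂}
    (hx : x ∈ domain d₁ J)
    (hxl : x ∈ gridBox (gridLine Q n) k (fun j => (l j : ℤ) - 1) (fun j => l j))
    {W W' : (Fin d₂ → ℕ) → ℝ}
    (hW : ∀ p (a b : Covariate d₁ d₂), |∑ t ∈ (Finset.Icc 1 n).filter
      (fun t => I t ∈ slice d₁ (gridIoc (gridLine Q n) (fun j => (l j : ℤ) + 1 - 2 ^ (p j + 1))
        (fun j => (l j : ℤ) + 1)) ∧ I t ∈ Set.Icc a b), ε t| ≤ W p)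
    (hW' : ∀ p (a b : Covariate d₁ d₂), |∑ t ∈ (Finset.Icc 1 n).filter
      (fun t => I t ∈ slice d₁ (gridIoc (gridLine Q n) (fun j => (l j : ℤ) - 2)
        (fun j => (l j : ℤ) - 2 + 2 ^ (p j + 1))) ∧ I t ∈ Set.Icc a b), ε t| ≤ W' p) :
    |g x - f x| ≤ (supBelow (domain d₁ J) f B (gridLine Q n) k (fun j => (l j : ℤ) + 1) -
        supBelow (domain d₁ J) f B (gridLine Q n) k (fun j => (l j : ℤ) - 2)) +
      ∑ p ∈ Fintype.piFinset fun _ : Fin d₂ => Finset.range (gridM d₂ n),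
        (W p + W' p) / (N₀ * ∏ j, ((2 ^ p j : ℕ) : ℝ)) := by
  have hq := gridLine_mono Q n
  have hcell' : ∀ l : Fin d₂ → ℕ, (∀ j, 1 ≤ l j ∧ l j ≤ gridM d₂ n) →
      N₀ ≤ obsCount n I (gridBox (gridLine Q n) k (fun j => (l j : ℤ) - 1) (fun j => l j)) :=
    fun l hl => by rw [← cell_eq_gridBox]; exact hcell l hl
  have hup := upperEst_le_add_sum hY hf hID hq (fun j i hi => gridLine_of_nonpos Q n j hi) hN₀
    hcell' hl hx hxl hW (F := supBelow (domain d₁ J) f B (gridLine Q n) k fun j => (l j : ℤ) + 1)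
    fun y hy hk hm => le_supBelow hB hB0 hy hk hm
  have hlo := sub_sum_le_lowerEst hY hf hID hq (fun j i hi => gridLine_of_gridM_lt Q hn j hi) hN₀
    hcell' hl hx hxl hW' (F := supBelow (domain d₁ J) f B (gridLine Q n) k fun j => (l j : ℤ) - 2)
    fun y hy hk hm => supBelow_le_of_lt hB hf hy hk hm
  have h1 := (hg.2 x hx).1
  have h2 := (hg.2 x hx).2
  have h3 : f x ≤ supBelow (domain d₁ J) f B (gridLine Q n) k fun j => (l j : ℤ) + 1 :=
    le_supBelow hB hB0 hx hxl.1 fun j => (hxl.2 j).2.trans (hq j (by beta_reduce; omega))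
  have h4 : supBelow (domain d₁ J) f B (gridLine Q n) k (fun j => (l j : ℤ) - 2) ≤ f x :=
    supBelow_le_of_lt hB hf hx hxl.1
      fun j => (hq j (by beta_reduce; omega)).trans_lt (hxl.2 j).1
  have hpos : ∀ {V : (Fin d₂ → ℕ) → ℝ}, (∀ p, 0 ≤ V p) →
      0 ≤ ∑ p ∈ Fintype.piFinset fun _ : Fin d₂ => Finset.range (gridM d₂ n),
        V p / (N₀ * ∏ j, ((2 ^ p j : ℕ) : ℝ)) := fun hV =>
    Finset.sum_nonneg fun p _ => div_nonneg (hV p) (by positivity)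
  have h5 := hpos fun p => (abs_nonneg _).trans (hW p x x)
  have h6 := hpos fun p => (abs_nonneg _).trans (hW' p x x)
  simp_rw [add_div, Finset.sum_add_distrib]
  rw [abs_le]
  constructor <;> linarith

end IsoReg

theorem theorem3p1 {Ω : Type*} [MeasurableSpace Ω] (P : Measure Ω) [IsProbabilityMeasure P]
    (d₁ d₂ : ℕ) (hd : 0 < d₁ + d₂)
    -- the domain `D = ℕ₀^{d₁} × J₁ × ⋯ × J_{d₂}` with intervals `Jⱼ`, and the isotonic function
    (J : Fin d₂ → Set ℝ) (hJ : ∀ j, (J j).OrdConnected)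
    (f : IsoReg.Covariate d₁ d₂ → ℝ) (hf : Measurable f)
    (hf_mono : MonotoneOn f (IsoReg.domain d₁ J))
    -- the triangular array of covariates, errors and responses
    (I : ℕ → ℕ → Ω → IsoReg.Covariate d₁ d₂) (ε Y : ℕ → ℕ → Ω → ℝ)
    (hI : ∀ n t, Measurable (I n t)) (hε : ∀ n t, Measurable (ε n t))
    (hID : ∀ n t, 1 ≤ t → t ≤ n → ∀ᵐ ω ∂P, I n t ω ∈ IsoReg.domain d₁ J)
    (hY : ∀ n t ω, Y n t ω = f (I n t ω) + ε n t ω)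
    (Q : Fin d₂ → Measure ℝ) [∀ j, IsProbabilityMeasure (Q j)]
    (hA2 : IsoReg.AssumptionA2 P (IsoReg.domain d₁ J) f I ε)
    (hA3 : IsoReg.AssumptionA3 P Q I ε)
    -- the estimator: any measurable choice of an isotonic function between the two envelopes
    (fhat : ℕ → Ω → IsoReg.Covariate d₁ d₂ → ℝ)
    (hfhat_meas : ∀ n, Measurable (fun p : Ω × IsoReg.Covariate d₁ d₂ => fhat n p.1 p.2))
    (hfhat : ∀ n ω, IsoReg.IsIsotonicEstimate (IsoReg.domain d₁ J) n
      (fun t => I n t ω) (fun t => Y n t ω) (fhat n ω))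
    (K : ℕ) (C₄ : ℝ) (hC₄ : 0 < C₄) :
    ∃ C : ℝ, ∀ᶠ n : ℕ in atTop,
      ∫⁻ ω in IsoReg.goodEvent Q K C₄ n (I n),
        (∫⁻ x in IsoReg.region d₁ Q K n, ENNReal.ofReal |fhat n ω x - f x| ∂(IsoReg.nu d₁ Q)) ∂P
        ≤ ENNReal.ofReal (C * (n : ℝ) ^ (-(1 / ((d₂ : ℝ) + 2)))) := by
  classical

  obtain ⟨C₀, hC₀, hblock⟩ := IsoReg.exists_block_bound hd hI hε hA2 hA3
  obtain ⟨B, hB⟩ : ∃ B, 0 ≤ B ∧ ∀ x ∈ IsoReg.domain d₁ J, |f x| ≤ B := by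
    obtain ⟨b, hb⟩ := hA2.bounded
    exact ⟨max b 0, le_max_right _ _, fun x hx => (hb x hx).trans (le_max_left _ _)⟩
  obtain ⟨hB0, hB⟩ := hB
  have hdom := IsoReg.ae_mem_domain hJ hID hA3
  set S : ℝ := ((1 - √2 / 2)⁻¹) ^ d₂ with hS
  -- There are `(K + 1) ^ d₁` discrete values. Bias: `6 B d₂ h` with `h ≤ 2 / r`. Noise: two
  -- envelopes, the constant `C₀` of the error sums over the constant `C₄` of the counts, and the
  -- sum `S` over block sizes.
  refine ⟨((K : ℝ) + 1) ^ d₁ * (12 * B * d₂ + 2 * C₀ * S / C₄), ?_⟩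
  filter_upwards [eventually_ge_atTop 1] with n hn
  set r : ℝ := (n : ℝ) ^ (1 / ((d₂ : ℝ) + 2)) with hr
  have hr0 : 0 < r := Real.rpow_pos_of_pos (by exact_mod_cast hn) _
  set M := IsoReg.gridM d₂ n with hM
  set h := IsoReg.gridH d₂ n with hh
  have hh0 : 0 < h := IsoReg.gridH_pos hn
  have hMh : (M : ℝ) * h = 1 := IsoReg.gridM_mul_gridH hn
  set N₀ : ℝ := C₄ * r ^ 2 with hN₀
  have hN₀pos : 0 < N₀ := by positivity
  -- Each cell `l` has its own noise bounds, since an integrated error needs no supremum over the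
  -- cells.
  choose W hW1 hW2 hW3 using fun l p : Fin d₂ → ℕ =>
    hblock n hn (fun j => (l j : ℤ) + 1 - 2 ^ (p j + 1)) (fun j => (l j : ℤ) + 1) p
      fun j => by ring
  choose W' hW1' hW2' hW3' using fun l p : Fin d₂ → ℕ =>
    hblock n hn (fun j => (l j : ℤ) - 2) (fun j => (l j : ℤ) - 2 + 2 ^ (p j + 1)) p fun j => rfl
  set Δ : (Fin d₁ → ℕ) → (Fin d₂ → ℕ) → ℝ := fun k l =>
    IsoReg.supBelow (IsoReg.domain d₁ J) f B (IsoReg.gridLine Q n) k (fun j => (l j : ℤ) + 1) -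
      IsoReg.supBelow (IsoReg.domain d₁ J) f B (IsoReg.gridLine Q n) k (fun j => (l j : ℤ) - 2) with hΔ
  set A := Fintype.piFinset fun _ : Fin d₁ => Finset.range (K + 1) with hA
  set L := Fintype.piFinset fun _ : Fin d₂ => Finset.Icc 2 (M - 1) with hL
  set T := Fintype.piFinset fun _ : Fin d₂ => Finset.range M with hT
  set N : (Fin d₂ → ℕ) → Ω → ℝ := fun l ω =>
    ∑ p ∈ T, (W l p ω + W' l p ω) / (N₀ * ∏ j, ((2 ^ p j : ℕ) : ℝ)) with hN
  have hΔ0 : ∀ k l, 0 ≤ Δ k l := fun k l => sub_nonneg.2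
    (IsoReg.supBelow_mono hB hB0 (IsoReg.gridLine_mono Q n) fun j => by omega)
  have hN0 : ∀ l ω, 0 ≤ N l ω := fun l ω => Finset.sum_nonneg fun p _ => div_nonneg
    (add_nonneg ((abs_nonneg _).trans (hW2 l p ω 0 0)) ((abs_nonneg _).trans (hW2' l p ω 0 0)))
    (by positivity)
  have hterm : ∀ l p, Integrable
      (fun ω => (W l p ω + W' l p ω) / (N₀ * ∏ j, ((2 ^ p j : ℕ) : ℝ))) P := fun l p =>
    ((hW1 l p).add (hW1' l p)).div_const _
  have hNint : ∀ l, Integrable (N l) P := fun l => integrable_finsetSum _ fun p _ => hterm l p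
  have hNle : ∀ l, ∫ ω, N l ω ∂P ≤ 2 * C₀ * S / C₄ * r⁻¹ := fun l => by
    rw [hN]
    beta_reduce
    rw [integral_finsetSum _ fun p _ => hterm l p]
    -- Error sums of order `r ∏ √2 ^ p j` against counts of order `r² ∏ 2 ^ p j` leave `r⁻¹` times a
    -- summable product.
    calc ∑ p ∈ T, ∫ ω, (W l p ω + W' l p ω) / (N₀ * ∏ j, ((2 ^ p j : ℕ) : ℝ)) ∂P
        ≤ ∑ p ∈ T, 2 * C₀ / C₄ * r⁻¹ * ∏ j, (√2 / 2) ^ p j := by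
          refine Finset.sum_le_sum fun p _ => ?_
          rw [integral_div, integral_add (hW1 l p) (hW1' l p), div_le_iff₀ (by positivity)]
          refine (add_le_add (hW3 l p) (hW3' l p)).trans (le_of_eq ?_)
          simp only [div_pow, Finset.prod_div_distrib]
          push_cast
          have : (∏ j, (2 : ℝ) ^ p j) ≠ 0 := by positivity
          rw [hN₀]
          field_simp
          ring
      _ = 2 * C₀ / C₄ * r⁻¹ * ∑ p ∈ T, ∏ j, (√2 / 2) ^ p j := by rw [Finset.mul_sum]
      _ ≤ 2 * C₀ / C₄ * r⁻¹ * S := by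
          gcongr
          exact IsoReg.sum_geometric_le M
      _ = _ := by ring
  set R : Ω → ℝ := fun ω => ∑ k ∈ A, ∑ l ∈ L, h ^ d₂ * (Δ k l + N l ω) with hR
  have hcellint : ∀ k l, Integrable (fun ω => h ^ d₂ * (Δ k l + N l ω)) P := fun k l =>
    ((integrable_const _).add (hNint l)).const_mul _
  have hRint : Integrable R P :=
    integrable_finsetSum _ fun k _ => integrable_finsetSum _ fun l _ => hcellint k l
  have hR0 : ∀ ω, 0 ≤ R ω := fun ω => Finset.sum_nonneg fun k _ => Finset.sum_nonneg fun l _ =>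
    mul_nonneg (by positivity) (add_nonneg (hΔ0 k l) (hN0 l ω))
  have hae : ∀ᵐ ω ∂P, ∀ t ∈ Finset.Icc 1 n, I n t ω ∈ IsoReg.domain d₁ J :=
    (Finset.eventually_all _).2 fun t ht => by
      rw [Finset.mem_Icc] at ht
      exact hID n t ht.1 ht.2
  have hRle : ∫ ω, R ω ∂P ≤
      ((K : ℝ) + 1) ^ d₁ * (12 * B * d₂ + 2 * C₀ * S / C₄) * r⁻¹ := by
    have e1 : ∫ ω, R ω ∂P = ∑ k ∈ A, ∑ l ∈ L, h ^ d₂ * (Δ k l + ∫ ω, N l ω ∂P) := by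
      rw [hR]
      beta_reduce
      rw [integral_finsetSum _ fun k _ => integrable_finsetSum _ fun l _ => hcellint k l]
      refine Finset.sum_congr rfl fun k _ => ?_
      rw [integral_finsetSum _ fun l _ => hcellint k l]
      refine Finset.sum_congr rfl fun l _ => ?_
      rw [integral_const_mul, integral_add (integrable_const _) (hNint l), integral_const,
        probReal_univ, one_smul]
    have hcardA : (A.card : ℝ) = ((K : ℝ) + 1) ^ d₁ := by
      rw [hA, Fintype.card_piFinset]; simp
    have hcardL : h ^ d₂ * (L.card : ℝ) ≤ 1 := by
      have : (L.card : ℝ) ≤ (M : ℝ) ^ d₂ := by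
        rw [hL, Fintype.card_piFinset]
        simp only [Nat.card_Icc, Finset.prod_const, Finset.card_univ, Fintype.card_fin]
        push_cast
        gcongr
        omega
      calc h ^ d₂ * (L.card : ℝ) ≤ h ^ d₂ * (M : ℝ) ^ d₂ := by gcongr
        _ = 1 := by rw [← mul_pow, mul_comm, hMh, one_pow]
    have hk : ∀ k ∈ A, ∑ l ∈ L, h ^ d₂ * (Δ k l + ∫ ω, N l ω ∂P) ≤
        (12 * B * d₂ + 2 * C₀ * S / C₄) * r⁻¹ := fun k _ => by
      have hS0 : 0 ≤ 2 * C₀ * S / C₄ * r⁻¹ :=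
        (integral_nonneg (hN0 0)).trans (hNle 0)
      have hhr : h ≤ 2 * r⁻¹ := by
        have := IsoReg.gridH_le (d₂ := d₂) hn
        rwa [Real.rpow_neg (Nat.cast_nonneg n)] at this
      calc ∑ l ∈ L, h ^ d₂ * (Δ k l + ∫ ω, N l ω ∂P)
          ≤ ∑ l ∈ L, h ^ d₂ * (Δ k l + 2 * C₀ * S / C₄ * r⁻¹) := by
            gcongr with l _; exact hNle l
        _ = h ^ d₂ * ∑ l ∈ L, Δ k l + h ^ d₂ * L.card * (2 * C₀ * S / C₄ * r⁻¹) := by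
            rw [← Finset.mul_sum, Finset.sum_add_distrib, Finset.sum_const, nsmul_eq_mul]; ring
        _ ≤ h ^ d₂ * (6 * B * (d₂ * (M : ℝ) ^ (d₂ - 1))) + 1 * (2 * C₀ * S / C₄ * r⁻¹) := by
            gcongr
            exact IsoReg.sum_supBelow_increment_le hB hB0 _ _ _
        _ = 6 * B * (d₂ * h) + 2 * C₀ * S / C₄ * r⁻¹ := by
            rw [← IsoReg.mul_pow_pred_le hMh]; ring
        _ ≤ 6 * B * (d₂ * (2 * r⁻¹)) + 2 * C₀ * S / C₄ * r⁻¹ := by gcongr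
        _ = _ := by ring
    rw [e1, ← hcardA]
    refine (Finset.sum_le_card_nsmul _ _ _ hk).trans (le_of_eq ?_)
    rw [nsmul_eq_mul]; ring
  calc ∫⁻ ω in IsoReg.goodEvent Q K C₄ n (I n),
        (∫⁻ x in IsoReg.region d₁ Q K n, ENNReal.ofReal |fhat n ω x - f x| ∂(IsoReg.nu d₁ Q)) ∂P
      ≤ ∫⁻ ω in IsoReg.goodEvent Q K C₄ n (I n), ENNReal.ofReal (R ω) ∂P := by
        refine setLIntegral_mono_ae hRint.aestronglyMeasurable.aemeasurable.ennreal_ofReal.restrict ?_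
        filter_upwards [hae] with ω hω hgood
        refine IsoReg.lintegral_region_le hA3.continuous_cdf hn hdom
          (fun k l _ _ => add_nonneg (hΔ0 k l) (hN0 l ω)) fun k l hk hl x hx hxl => ?_
        refine IsoReg.abs_estimate_sub_le (fun t => hY n t ω) hf_mono hB hB0 hω (hfhat n ω) Q hn hN₀pos
          (fun l' hl' => ?_) hl hx hxl (fun p => hW2 l p ω) (fun p => hW2' l p ω)
        have := hgood k l' hk hl'
        rwa [IsoReg.rate_sq] at this
    _ ≤ ∫⁻ ω, ENNReal.ofReal (R ω) ∂P := setLIntegral_le_lintegral _ _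
    _ = ENNReal.ofReal (∫ ω, R ω ∂P) :=
        (ofReal_integral_eq_lintegral_ofReal hRint (ae_of_all _ hR0)).symm
    _ ≤ _ := by
        rw [Real.rpow_neg (Nat.cast_nonneg n)]
        exact ENNReal.ofReal_le_ofReal hRle
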